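/- Let $p$ be an odd prime, $k$ a finite field of characteristic $p$, $\mathcal{O}_F=W(k)$ and $F=W(k)[1/p]$ (so $F$ is a finite unramified extension of $\mathbb{Q}_p$), with Frobenius $\sigma$. For $n\ge 1$ put $F_n=F(\mu_{p^n})$ and fix a primitive $p^n$-th root of unity $\zeta_{p^n}\in F_n$. Let $T$ be a free $\mathbb{Z}_p$-module of finite rank with a continuous action of $G_F$ such that $V=T\otimes\mathbb{Q}_p$ is crystalline, let $\mathbb{D}_{\mathrm{cris}}(V)=(\mathbb{B}_{\mathrm{cris}}\otimes V)^{G_F}$ with its $\sigma$-semilinear Frobenius $\varphi$ and its filtration, and let $D\subset\mathbb{D}_{\mathrm{cris}}(V)$ be an $\mathcal{O}_F$-lattice with $\mathcal{O}_F$-basis $v_1,\dots,v_d$ (for instance the lattice $D=\mathbb{D}_{\mathrm{cris}}(T)$, when $T$ satisfies the Fontaine–Laffaille condition). Put $\mathrm{Fil}^0D=D\cap\mathrm{Fil}^0\mathbb{D}_{\mathrm{cris}}(V)$. Assume that no eigenvalue of $\varphi$ on $\mathbb{D}_{\mathrm{cris}}(V)$ is an integral power of $p$. Let $r,s_1,s_2\ge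 0$ be integers such that $$(p^r\varphi)^j(D)\subset p^{-s_1}D\ \text{ for all } j\ge 0,\qquad (1-\varphi)^{-1}(D)\subset p^{-s_2}D .$$ Let $\mathbb{A}_F^+=\mathcal{O}_F[[\pi]]$, and let $\mathbb{B}^+_{F,\mathrm{rig}}\subset F[[\pi]]$ be the ring of power series that converge on the open unit disk, with $\varphi\big(\sum a_m\pi^m\big)=\sum\sigma(a_m)((1+\pi)^p-1)^m$ and with $\psi$ the left inverse of $\varphi$ that sends $(1+\pi)^i$ to $(1+\pi)^{i/p}$ if $p\mid i$ and to $0$ otherwise. For $g\in(\mathbb{A}_F^+)^{\psi=0}\otimes_{\mathcal{O}_F}D$ let $G=\sum_i f_i\otimes v_i\in\mathbb{B}^+_{F,\mathrm{rig}}\otimes_{\mathcal{O}_F}D$ be the solution of $(1-\varphi\otimes\varphi)G=g$, and put $G^{\sigma^{-n}}=\sum_i f_i^{\sigma^{-n}}\otimes v_i$, where $\sigma^{-n}$ acts on the coefficients of the $f_i$. Let $\Theta_{T,n}(g)$ be the class of $G^{\sigma^{-n}}(\zeta_{p^n}-1)$ in $$t_n(V)=F_n\otimes_F\mathbb{D}_{\mathrm{cris}}(V)/\mathrm{Fil}^0\mathbb{D}_{\mathrm{cris}}(V),$$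 let $A_n\subset t_n(V)$ be the image of $(\mathbb{A}_F^+)^{\psi=0}\otimes D$ under $\Theta_{T,n}$, and let $L_n=\mathcal{O}_{F_n}\otimes_{\mathcal{O}_F}(D/\mathrm{Fil}^0D)\subset t_n(V)$. Let $d'$ be the $\mathbb{Z}_p$-rank of $D/\mathrm{Fil}^0D$ and $d'_n=d'\,[F_n:F]$. Then, for every $n\ge 1$, the subgroups $A_n$ and $L_n$ of $t_n(V)$ are commensurable, and the generalized index $(A_n:L_n)=[A_n:A_n\cap L_n]\,/\,[L_n:A_n\cap L_n]$ satisfies $$(A_n:L_n)\le p^{(r(p^{n-1}+p-2)+s_2(p-1))d'+s_1d'_n}.$$ -/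

import Mathlib

open Ideal WittVector
open scoped Isocrystal TensorProduct Nat

noncomputable section

namespace Crystalline

section PCompletion

/-- The `p`-adic completion `lim R / p ^ n R` of a ring `R`. -/
def pCompletion (p : ℕ) (R : Type*) [CommRing R] : Type _ :=
  AdicCompletion (span {(p : R)}) R
deriving CommRing

variable {p : ℕ} {R S T : Type*} [CommRing R] [CommRing S] [CommRing T]

/-- The projection of the `p`-adic completion to `R / p ^ n R`. -/
def pCompletionEval (p : ℕ) (R : Type*) [CommRing R] (n : ℕ) :
    pCompletion p R →+* R ⧸ span {(p : R)} ^ n :=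
  (AdicCompletion.evalₐ (span {(p : R)}) n : AdicCompletion (span {(p : R)}) R →+* _)

/-- The canonical map from a ring to its `p`-adic completion. -/
def toPCompletion (p : ℕ) (R : Type*) [CommRing R] : R →+* pCompletion p R :=
  algebraMap R (AdicCompletion (span {(p : R)}) R)

/-- The limit in the `p`-adic completion of a sequence with `a n ≡ a (n + 1)` modulo `p ^ n`. -/
def pCompletionLim (a : ℕ → R) (ha : ∀ n, a (n + 1) - a n ∈ span {(p : R)} ^ n) :
    pCompletion p R :=
  AdicCompletion.mk _ R (AdicCompletion.AdicCauchySequence.mk (span {(p : R)}) R a (by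
    intro n
    rw [SModEq.comm, SModEq.sub_mem, smul_eq_mul, Ideal.mul_top]
    exact ha n))

theorem pCompletion_ext {x y : pCompletion p R}
    (h : ∀ n, pCompletionEval p R n x = pCompletionEval p R n y) : x = y :=
  AdicCompletion.ext_evalₐ (I := span {(p : R)}) h

theorem pCompletionEval_lim (a : ℕ → R) (ha : ∀ n, a (n + 1) - a n ∈ span {(p : R)} ^ n) (n : ℕ) :
    pCompletionEval p R n (pCompletionLim a ha) = Ideal.Quotient.mk _ (a n) :=
  AdicCompletion.evalₐ_mk _ n _

theorem pCompletionEval_of (r : R) (n : ℕ) :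
    pCompletionEval p R n (toPCompletion p R r) = Ideal.Quotient.mk _ r :=
  AdicCompletion.evalₐ_of _ n _

theorem factorPow_pCompletionEval {m n : ℕ} (h : m ≤ n) (x : pCompletion p R) :
    Ideal.Quotient.factorPow (span {(p : R)}) h (pCompletionEval p R n x)
      = pCompletionEval p R m x := by
  obtain ⟨x, rfl⟩ := AdicCompletion.mk_surjective (span {(p : R)}) R x
  erw [AdicCompletion.evalₐ_mk, AdicCompletion.evalₐ_mk]
  exact AdicCompletion.Ideal.mk_eq_mk _ h x

theorem span_pow_le_comap (p : ℕ) (f : R →+* S) (n : ℕ) :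
    span {(p : R)} ^ n ≤ (span {(p : S)} ^ n).comap f := by
  rw [← Ideal.map_le_iff_le_comap, Ideal.map_pow, Ideal.map_span]
  simp

theorem pCompletionMap_aux (f : R →+* S) {m n : ℕ} (hle : m ≤ n) :
    (Ideal.Quotient.factorPow (span {(p : S)}) hle).comp
      ((Ideal.quotientMap (span {(p : S)} ^ n) f (span_pow_le_comap p f n)).comp
        (pCompletionEval p R n)) =
      (Ideal.quotientMap (span {(p : S)} ^ m) f (span_pow_le_comap p f m)).comp
        (pCompletionEval p R m) := by
  ext x
  simp only [RingHom.comp_apply]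
  rw [← factorPow_pCompletionEval hle x]
  obtain ⟨r, hr⟩ := Ideal.Quotient.mk_surjective (pCompletionEval p R n x)
  rw [← hr]
  rfl

/-- Functoriality of the `p`-adic completion. -/
def pCompletionMap (p : ℕ) (f : R →+* S) : pCompletion p R →+* pCompletion p S :=
  AdicCompletion.liftRingHom (span {(p : S)})
    (fun n => (Ideal.quotientMap _ f (span_pow_le_comap p f n)).comp (pCompletionEval p R n))
    (pCompletionMap_aux f)

theorem pCompletionEval_map (f : R →+* S) (n : ℕ) (x : pCompletion p R) :
    pCompletionEval p S n (pCompletionMap p f x)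
      = Ideal.quotientMap _ f (span_pow_le_comap p f n) (pCompletionEval p R n x) :=
  AdicCompletion.evalₐ_liftRingHom (span {(p : S)})
    (fun n => (Ideal.quotientMap _ f (span_pow_le_comap p f n)).comp (pCompletionEval p R n))
    (pCompletionMap_aux f) n x

theorem pCompletionMap_comp (f : S →+* T) (g : R →+* S) :
    pCompletionMap p (f.comp g) = (pCompletionMap p f).comp (pCompletionMap p g) := by
  ext x
  refine pCompletion_ext fun n => ?_
  simp only [RingHom.comp_apply, pCompletionEval_map]
  obtain ⟨r, hr⟩ := Ideal.Quotient.mk_surjective (pCompletionEval p R n x)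
  rw [← hr]
  rfl

theorem pCompletionMap_id : pCompletionMap p (RingHom.id R) = RingHom.id _ := by
  ext x
  refine pCompletion_ext fun n => ?_
  simp only [RingHom.id_apply, pCompletionEval_map]
  obtain ⟨r, hr⟩ := Ideal.Quotient.mk_surjective (pCompletionEval p R n x)
  rw [← hr]
  rfl

theorem pCompletionMap_of (f : R →+* S) (r : R) :
    pCompletionMap p f (toPCompletion p R r) = toPCompletion p S (f r) := by
  refine pCompletion_ext fun n => ?_
  rw [pCompletionEval_map, pCompletionEval_of, pCompletionEval_of]
  rfl

theorem pCompletionMap_lim (f : R →+* S) (a : ℕ → R)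
    (ha : ∀ n, a (n + 1) - a n ∈ span {(p : R)} ^ n)
    (hb : ∀ n, f (a (n + 1)) - f (a n) ∈ span {(p : S)} ^ n) :
    pCompletionMap p f (pCompletionLim a ha) = pCompletionLim (fun n => f (a n)) hb := by
  refine pCompletion_ext fun n => ?_
  rw [pCompletionEval_map, pCompletionEval_lim, pCompletionEval_lim]
  rfl

/-- The `p`-adic completion is `p`-adically complete. -/
instance pCompletion_isAdicComplete (p : ℕ) (R : Type*) [CommRing R] :
    IsAdicComplete (span {(p : pCompletion p R)}) (pCompletion p R) := by
  have h1 : IsAdicComplete (span {(p : R)}) (AdicCompletion (span {(p : R)}) R) :=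
    AdicCompletion.isAdicComplete (I := span {(p : R)}) (M := R)
      (Submodule.fg_span_singleton _)
  have h2 := (IsAdicComplete.map_algebraMap_iff (S := AdicCompletion (span {(p : R)}) R)
    (span {(p : R)}) (AdicCompletion (span {(p : R)}) R)).2 h1
  rw [Ideal.map_span, Set.image_singleton, map_natCast] at h2
  exact h2

end PCompletion

section Tilt

variable {p : ℕ} [Fact p.Prime] {R : Type*} [CommRing R] [Fact ¬IsUnit (p : R)]

/-- The endomorphism of the tilt induced by an endomorphism of the ring. -/
def tiltMap (p : ℕ) [Fact p.Prime] {R : Type*} [CommRing R] [Fact ¬IsUnit (p : R)] (f : R →+* R) :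
    PreTilt R p →+* PreTilt R p :=
  Perfection.map (R := ModP R p) (S := ModP R p) p
    (Ideal.quotientMap (span {(p : R)}) f
      (by simpa only [pow_one] using span_pow_le_comap p f 1) : ModP R p →+* ModP R p)

theorem tiltMap_coeff (f : R →+* R) (x : PreTilt R p) (n : ℕ) :
    PreTilt.coeff n (tiltMap p f x) = Ideal.quotientMap (span {(p : R)}) f
      (by simpa only [pow_one] using span_pow_le_comap p f 1) (PreTilt.coeff n x) := rfl

theorem tiltMap_leftInverse (f g : R →+* R) (h : g.comp f = RingHom.id R) (x : PreTilt R p) :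
    tiltMap p g (tiltMap p f x) = x := by
  refine Perfection.ext fun n => ?_
  change PreTilt.coeff n _ = PreTilt.coeff n _
  rw [tiltMap_coeff, tiltMap_coeff]
  obtain ⟨r, hr⟩ := Ideal.Quotient.mk_surjective (PreTilt.coeff n x)
  rw [← hr, Ideal.quotientMap_mk, Ideal.quotientMap_mk]
  exact congrArg (Ideal.Quotient.mk _) (congrArg (fun F => F r) h)

variable [IsAdicComplete (span {(p : R)}) R]

theorem untilt_tiltMap (f : R →+* R) (x : PreTilt R p) :
    (tiltMap p f x).untilt = f x.untilt := by
  refine Perfection.teichmuller_spec fun n => ?_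
  obtain ⟨r, hr⟩ := Ideal.Quotient.mk_surjective (PreTilt.coeff n x)
  refine ⟨f r, ?_, ?_⟩
  · change _ = PreTilt.coeff n (tiltMap p f x)
    rw [tiltMap_coeff, ← hr, Ideal.quotientMap_mk]
  · have h := Perfection.teichmuller_sModEq (I := span {(p : R)}) (x := x) (n := n) hr
    rw [SModEq.sub_mem] at h ⊢
    have h2 := span_pow_le_comap p f (n + 1) h
    rw [Ideal.mem_comap, map_sub, map_pow] at h2
    rw [← neg_mem_iff, neg_sub]
    exact h2

theorem fontaineTheta_map (f : R →+* R) (x : WittVector p (PreTilt R p)) :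
    fontaineTheta R p (WittVector.map (tiltMap p f) x) = f (fontaineTheta R p x) := by
  rw [IsHausdorff.eq_iff_smodEq (I := span {(p : R)})]
  intro n
  rw [SModEq.sub_mem, smul_eq_mul, Ideal.mul_top, ← Ideal.Quotient.mk_eq_mk_iff_sub_mem]
  have := eq_of_apply_teichmuller_eq (p := p)
    ((Ideal.Quotient.mk (span {(p : R)} ^ n)).comp
      ((fontaineTheta R p).comp (WittVector.map (tiltMap p f))))
    ((Ideal.Quotient.mk (span {(p : R)} ^ n)).comp (f.comp (fontaineTheta R p)))
    ⟨n, by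
      rw [← map_natCast (Ideal.Quotient.mk _), ← map_pow, Ideal.Quotient.eq_zero_iff_mem]
      exact Ideal.pow_mem_pow (Ideal.mem_span_singleton_self _) _⟩
    (by
      intro y
      simp [untilt_tiltMap])
  exact congrArg (fun F => F x) this

end Tilt

section PeriodRings

variable (p : ℕ) [Fact p.Prime] (R : Type*) [CommRing R] [Fact ¬IsUnit (p : R)]

/-- `A_inf`: the Witt vectors of the tilt of `R`. -/
abbrev Ainf : Type _ := WittVector p (PreTilt R p)

/-- `A_inf[1/p]`, written as `ℚ ⊗ A_inf` (integers prime to `p` are units of `A_inf`). -/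
abbrev AinfQ : Type _ := ℚ ⊗[ℤ] Ainf p R

variable {p R} in
/-- The divided power `x ^ n / n!` in `A_inf[1/p]`. -/
def dpow (x : Ainf p R) (n : ℕ) : AinfQ p R := ((n ! : ℚ)⁻¹) ⊗ₜ[ℤ] (x ^ n)

/-- The endomorphism of `A_inf[1/p]` induced by an endomorphism of the tilt. -/
def ainfQMap (e : PreTilt R p →+* PreTilt R p) : AinfQ p R →+* AinfQ p R :=
  (Algebra.TensorProduct.map (AlgHom.id ℤ ℚ)
    (WittVector.map e : Ainf p R →+* Ainf p R).toIntAlgHom).toRingHom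

variable {p R} in
theorem ainfQMap_tmul (e : PreTilt R p →+* PreTilt R p) (q : ℚ) (x : Ainf p R) :
    ainfQMap p R e (q ⊗ₜ x) = q ⊗ₜ (WittVector.map e x) := rfl

variable [IsAdicComplete (span {(p : R)}) R]

/-- The divided power envelope of `A_inf` along the kernel of `θ`: the subring of `A_inf[1/p]`
generated by `A_inf` and all `x ^ n / n!` with `θ x = 0`. -/
def AcrisPre : Subring (AinfQ p R) :=
  Subring.closure ({z | ∃ a : Ainf p R, z = 1 ⊗ₜ a} ∪
    {z | ∃ (x : Ainf p R) (n : ℕ), fontaineTheta R p x = 0 ∧ z = dpow x n})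

/-- `A_cris`: the `p`-adic completion of the divided power envelope. -/
abbrev Acris : Type _ := pCompletion p (AcrisPre p R)

variable {p R}

/-- The inclusion of `A_inf`. -/
def ainfToPre : Ainf p R →+* AcrisPre p R :=
  (Algebra.TensorProduct.includeRight (R := ℤ) (A := ℚ) (B := Ainf p R)).toRingHom.codRestrict
    (AcrisPre p R) (fun a => Subring.subset_closure (Or.inl ⟨a, rfl⟩))

/-- The divided power `x ^ n / n!` of an element of the kernel of `θ`. -/
def dpowPre (x : Ainf p R) (hx : fontaineTheta R p x = 0) (n : ℕ) : AcrisPre p R :=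
  ⟨dpow x n, Subring.subset_closure (Or.inr ⟨x, n, hx, rfl⟩)⟩

variable (p R) in
/-- An injective ring endomorphism of the tilt that acts on the crystalline period rings. The
Frobenius and the Galois automorphisms are of this kind. -/
structure CrisEnd where
  toHom : PreTilt R p →+* PreTilt R p
  inj : Function.Injective toHom
  dpow_mem : ∀ x : Ainf p R, fontaineTheta R p x = 0 → ∀ n,
    dpow (WittVector.map toHom x) n ∈ AcrisPre p R
  untilt_eq_one : ∀ x : PreTilt R p, x.untilt = 1 → (toHom x).untilt = 1

theorem ainfQMap_mem (e : CrisEnd p R) (x : AinfQ p R) (hx : x ∈ AcrisPre p R) :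
    ainfQMap p R e.toHom x ∈ AcrisPre p R := by
  have h : AcrisPre p R ≤ (AcrisPre p R).comap (ainfQMap p R e.toHom) := by
    refine Subring.closure_le.2 ?_
    rintro z (⟨a, rfl⟩ | ⟨x, n, hx, rfl⟩)
    · exact Subring.subset_closure (Or.inl ⟨_, rfl⟩)
    · have := e.dpow_mem x hx n
      simp only [dpow, ← map_pow] at this
      simpa [dpow, ainfQMap_tmul] using this
  exact h hx

/-- The action on the divided power envelope. -/
def preMap (e : CrisEnd p R) : AcrisPre p R →+* AcrisPre p R :=
  (ainfQMap p R e.toHom).restrict (AcrisPre p R) (AcrisPre p R) (ainfQMap_mem e)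

/-- The action on `A_cris`. -/
def acrisMap (e : CrisEnd p R) : Acris p R →+* Acris p R := pCompletionMap p (preMap e)

/-- The partial sums `∑ (-1) ^ (i - 1) ([ε] - 1) ^ i / i` of the logarithm of `[ε]`; the `i`-th
term is `(-1) ^ (i - 1) (i - 1)!` times the `i`-th divided power of `[ε] - 1`. -/
def logPartial (ε : PreTilt R p) (hε : ε.untilt = 1) (N : ℕ) : AcrisPre p R :=
  ∑ i ∈ Finset.range N, (-1) ^ i * (i ! : AcrisPre p R) *
    dpowPre (teichmuller p ε - 1) (by simp [hε]) (i + 1)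

theorem pow_dvd_factorial_of_le (m i : ℕ) (h : p * m ≤ i) : p ^ m ∣ i ! := by
  refine dvd_trans ?_ (Nat.factorial_dvd_factorial h)
  clear h
  induction m with
  | zero => simp
  | succ m ih =>
    have hp : 0 < p := (Fact.out : p.Prime).pos
    obtain ⟨q, rfl⟩ : ∃ q, p = q + 1 := ⟨p - 1, by omega⟩
    rw [show (q + 1) * (m + 1) = ((q + 1) * m + q) + 1 by ring, Nat.factorial_succ, pow_succ]
    rw [mul_comm]
    refine mul_dvd_mul ⟨m + 1, by ring⟩ (ih.trans (Nat.factorial_dvd_factorial (by omega)))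

theorem logPartial_cauchy (ε : PreTilt R p) (hε : ε.untilt = 1) (n : ℕ) :
    logPartial ε hε (p * (n + 1)) - logPartial ε hε (p * n) ∈
      span {(p : AcrisPre p R)} ^ n := by
  unfold logPartial
  rw [← Finset.sum_range_add_sum_Ico _ (Nat.mul_le_mul_left p (Nat.le_succ n)), add_sub_cancel_left]
  refine Ideal.sum_mem _ fun i hi => Ideal.mul_mem_right _ _ (Ideal.mul_mem_left _ _ ?_)
  rw [Ideal.span_singleton_pow, Ideal.mem_span_singleton]
  exact_mod_cast (Nat.cast_dvd_cast (pow_dvd_factorial_of_le n i (Finset.mem_Ico.1 hi).1) :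
    ((p ^ n : ℕ) : AcrisPre p R) ∣ _)

/-- `t = log [ε]` in `A_cris`, for `ε` in the tilt with `ε^♯ = 1`. -/
def logT (ε : PreTilt R p) (hε : ε.untilt = 1) : Acris p R :=
  pCompletionLim (fun n => logPartial ε hε (p * n)) (logPartial_cauchy ε hε)

theorem preMap_logPartial (e : CrisEnd p R) (ε : PreTilt R p) (hε : ε.untilt = 1) (N : ℕ) :
    preMap e (logPartial ε hε N) = logPartial (e.toHom ε) (e.untilt_eq_one ε hε) N := by
  simp only [logPartial, map_sum, map_mul, map_pow, map_neg, map_one, map_natCast]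
  refine Finset.sum_congr rfl fun i _ => ?_
  congr 1
  refine Subtype.ext ?_
  change ainfQMap p R e.toHom (dpow _ _) = dpow _ _
  simp only [dpow, ainfQMap_tmul, map_pow, map_sub, map_one, map_teichmuller]

theorem acrisMap_logT (e : CrisEnd p R) (ε : PreTilt R p) (hε : ε.untilt = 1) :
    acrisMap e (logT ε hε) = logT (e.toHom ε) (e.untilt_eq_one ε hε) := by
  refine pCompletion_ext fun n => ?_
  unfold acrisMap logT
  rw [pCompletionEval_map, pCompletionEval_lim, pCompletionEval_lim, Ideal.quotientMap_mk,
    preMap_logPartial]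

variable (p R) in
/-- The multiplicative set generated by `p` and by the elements `t = log [ε]`, where `ε ≠ 1`
runs through the compatible systems of `p`-power roots of unity (`ε^♯ = 1`, that is, through the
nonzero elements of `ℤ_p(1)`). All these `t` agree up to units and powers of `p`. -/
def crisSubmonoid : Submonoid (Acris p R) :=
  Submonoid.closure ({(p : Acris p R)} ∪
    {t | ∃ (ε : PreTilt R p) (hε : ε.untilt = 1), ε ≠ 1 ∧ t = logT ε hε})

variable (p R) in
/-- `B_cris = A_cris[1/p, 1/t]`. -/
def Bcris : Type _ := Localization (crisSubmonoid p R)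
deriving CommRing

instance bcrisAlgebra : Algebra (Acris p R) (Bcris p R) :=
  inferInstanceAs (Algebra (Acris p R) (Localization (crisSubmonoid p R)))

instance bcrisIsLocalization : IsLocalization (crisSubmonoid p R) (Bcris p R) :=
  inferInstanceAs (IsLocalization (crisSubmonoid p R) (Localization (crisSubmonoid p R)))

theorem crisSubmonoid_le_comap (e : CrisEnd p R) :
    crisSubmonoid p R ≤ (crisSubmonoid p R).comap (acrisMap e) := by
  refine Submonoid.closure_le.2 ?_
  rintro z (rfl | ⟨ε, hε, h1, rfl⟩)
  · change acrisMap e (p : Acris p R) ∈ crisSubmonoid p R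
    rw [map_natCast]
    exact Submonoid.subset_closure (Or.inl rfl)
  · change acrisMap e (logT ε hε) ∈ crisSubmonoid p R
    rw [acrisMap_logT]
    refine Submonoid.subset_closure (Or.inr ⟨_, _, fun h => h1 (e.inj ?_), rfl⟩)
    rw [h, map_one]

/-- The action on `B_cris`. -/
def bcrisMap (e : CrisEnd p R) : Bcris p R →+* Bcris p R :=
  IsLocalization.map (Bcris p R) (acrisMap e) (crisSubmonoid_le_comap e)

theorem bcrisMap_algebraMap (e : CrisEnd p R) (a : Acris p R) :
    bcrisMap e (algebraMap _ _ a) = algebraMap _ _ (acrisMap e a) :=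
  IsLocalization.map_eq _ a

theorem bcrisMap_comm (e e' : CrisEnd p R)
    (h : ∀ x, e.toHom (e'.toHom x) = e'.toHom (e.toHom x)) (b : Bcris p R) :
    bcrisMap e (bcrisMap e' b) = bcrisMap e' (bcrisMap e b) := by
  have h1 : (ainfQMap p R e.toHom).comp (ainfQMap p R e'.toHom)
      = (ainfQMap p R e'.toHom).comp (ainfQMap p R e.toHom) := by
    refine RingHom.ext fun z => ?_
    induction z using TensorProduct.induction_on with
    | zero => simp
    | tmul q x =>
      simp only [RingHom.comp_apply, ainfQMap_tmul]
      congr 1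
      ext i
      simp [h]
    | add x y hx hy => rw [map_add, map_add, hx, hy]
  have h2 : (preMap e).comp (preMap e') = (preMap e').comp (preMap e) := by
    ext z
    exact congrArg (fun F => F (z : AinfQ p R)) h1
  have h3 : (acrisMap e).comp (acrisMap e') = (acrisMap e').comp (acrisMap e) := by
    unfold acrisMap
    rw [← pCompletionMap_comp, ← pCompletionMap_comp, h2]
  have h4 : (bcrisMap e).comp (bcrisMap e') = (bcrisMap e').comp (bcrisMap e) := by
    refine IsLocalization.ringHom_ext (crisSubmonoid p R) ?_
    ext a
    simp only [RingHom.comp_apply, bcrisMap_algebraMap]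
    exact congrArg (fun F => algebraMap (Acris p R) (Bcris p R) (F a)) h3
  exact congrArg (fun F => F b) h4

variable (p R) in
/-- The ideal of the divided power envelope generated by all `x ^ n / n!` with `θ x = 0` and
`j ≤ n`. -/
def dpIdeal (j : ℕ) : Ideal (AcrisPre p R) :=
  span {z | ∃ (x : Ainf p R) (hx : fontaineTheta R p x = 0) (n : ℕ), j ≤ n ∧ z = dpowPre x hx n}

variable (p R) in
/-- `Fil^j A_cris`: the `p`-adic closure of the `j`-th divided power ideal. It is the set of
elements of `A_cris` that lie in `Fil^j B_dR`. -/
def filAcris (j : ℕ) : Set (Acris p R) :=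
  {y | ∀ N, pCompletionEval p (AcrisPre p R) N y ∈
    (dpIdeal p R j).map (Ideal.Quotient.mk (span {(p : AcrisPre p R)} ^ N))}

variable (p R) in
/-- `Fil^0 B_cris`: the elements `y / (p ^ N t ^ j)` with `y` in `Fil^j A_cris`. -/
def filZeroBcris : Set (Bcris p R) :=
  {b | ∃ (N j : ℕ) (ε : PreTilt R p) (hε : ε.untilt = 1) (y : Acris p R), ε ≠ 1 ∧
    y ∈ filAcris p R j ∧
    (p : Bcris p R) ^ N * algebraMap (Acris p R) (Bcris p R) (logT ε hε) ^ j * b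
      = algebraMap (Acris p R) (Bcris p R) y}

end PeriodRings

section Frobenius

variable {p : ℕ} [Fact p.Prime] {R : Type*} [CommRing R] [Fact ¬IsUnit (p : R)]

/-- The canonical map from `ℤ_p = W(𝔽_p)` to the Witt vectors of a ring of characteristic `p`. -/
def zpToWitt (p : ℕ) [Fact p.Prime] (A : Type*) [CommRing A] [CharP A p] :
    ℤ_[p] →+* WittVector p A :=
  (WittVector.map (ZMod.castHom dvd_rfl A)).comp (WittVector.equiv p).symm.toRingHom

theorem isUnit_natCast_witt {A : Type*} [CommRing A] [CharP A p] (u : ℕ) (hu : u.Coprime p) :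
    IsUnit (u : WittVector p A) := by
  have h : IsUnit (u : ℤ_[p]) := by
    rw [PadicInt.isUnit_iff]
    have := PadicInt.norm_lt_one_iff_dvd (p := p) (u : ℤ_[p])
    refine le_antisymm (PadicInt.norm_le_one _) (not_lt.1 fun h => ?_)
    rw [← Int.cast_natCast, PadicInt.norm_int_lt_one_iff_dvd] at h
    have h2 : p ∣ u := by exact_mod_cast h
    have := Nat.Coprime.eq_one_of_dvd hu.symm h2
    exact (Fact.out : p.Prime).one_lt.ne' this
  simpa using h.map (zpToWitt p A)

theorem exists_map_frobenius_eq (x : Ainf p R) :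
    ∃ z, WittVector.map (_root_.frobenius (PreTilt R p) p) x = x ^ p + p * z := by
  have h : (WittVector.map (_root_.frobenius (PreTilt R p) p) x - x ^ p) ∈
      span {(p : Ainf p R)} := by
    rw [mem_span_p_iff_coeff_zero_eq_zero]
    have h : (constantCoeff : Ainf p R →+* PreTilt R p)
        (WittVector.map (_root_.frobenius (PreTilt R p) p) x - x ^ p) = 0 := by
      rw [map_sub, map_pow]
      simp [constantCoeff_apply, map_coeff, _root_.frobenius_def]
    exact h
  obtain ⟨z, hz⟩ := Ideal.mem_span_singleton.1 h
  exact ⟨z, by rw [← hz]; ring⟩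

variable [IsAdicComplete (span {(p : R)}) R]

theorem pow_div_factorial_mem (n : ℕ) :
    ((p : ℚ) ^ n * (n ! : ℚ)⁻¹) ⊗ₜ[ℤ] (1 : Ainf p R) ∈ AcrisPre p R := by
  obtain ⟨v, u, hu, hn⟩ :=
    Nat.exists_eq_pow_mul_and_not_dvd (Nat.factorial_ne_zero n) p (Fact.out : p.Prime).ne_one
  have hcop : u.Coprime p := ((Nat.Prime.coprime_iff_not_dvd Fact.out).2 hu).symm
  have hvn : v ≤ n := by
    have h1 := sub_one_mul_padicValNat_factorial (p := p) n
    have h2 : v ≤ padicValNat p (n !) :=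
      (padicValNat_dvd_iff_le (Nat.factorial_ne_zero n)).1 ⟨u, hn⟩
    have h3 : 1 ≤ p - 1 := by have := (Fact.out : p.Prime).two_le; omega
    calc v ≤ padicValNat p (n !) := h2
      _ ≤ (p - 1) * padicValNat p (n !) := Nat.le_mul_of_pos_left _ h3
      _ ≤ n := by rw [h1]; exact Nat.sub_le _ _
  obtain ⟨y, hy⟩ := (isUnit_natCast_witt (A := PreTilt R p) u hcop).exists_right_inv
  have hu0 : (u : ℚ) ≠ 0 := by
    rintro h
    exact hu (by rw [Nat.cast_eq_zero.1 h]; exact dvd_zero p)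
  have hp0 : (p : ℚ) ≠ 0 := Nat.cast_ne_zero.2 (Fact.out : p.Prime).ne_zero
  have h1 : ((p : ℚ) ^ n * (n ! : ℚ)⁻¹) ⊗ₜ[ℤ] (1 : Ainf p R)
      = (p ^ (n - v) : ℕ) • ((1 : ℚ) ⊗ₜ[ℤ] y) := by
    rw [← hy, ← nsmul_eq_mul, TensorProduct.tmul_smul, TensorProduct.smul_tmul',
      TensorProduct.smul_tmul']
    congr 1
    rw [hn, nsmul_eq_mul, nsmul_eq_mul]
    push_cast
    have : (p : ℚ) ^ n = p ^ (n - v) * p ^ v := by rw [← pow_add, Nat.sub_add_cancel hvn]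
    rw [this]
    field_simp
  rw [h1]
  have h2 : (1 : ℚ) ⊗ₜ[ℤ] y ∈ AcrisPre p R := Subring.subset_closure (Or.inl ⟨y, rfl⟩)
  exact nsmul_mem h2 _

variable (p R) in
/-- The Frobenius. -/
def frobEnd : CrisEnd p R where
  toHom := _root_.frobenius (PreTilt R p) p
  inj := (frobeniusEquiv (PreTilt R p) p).injective
  dpow_mem x hx n := by
    obtain ⟨z, hz⟩ := exists_map_frobenius_eq x
    set w : AinfQ p R := (((p - 1) ! : ℕ) : AinfQ p R) * dpow x p + 1 ⊗ₜ z with hw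
    have hwm : w ∈ AcrisPre p R := by
      refine add_mem (mul_mem (natCast_mem _ _) ?_) ?_
      · exact Subring.subset_closure (Or.inr ⟨x, p, hx, rfl⟩)
      · exact Subring.subset_closure (Or.inl ⟨z, rfl⟩)
    have h1 : dpow (WittVector.map (_root_.frobenius (PreTilt R p) p) x) n
        = ((p : ℚ) ^ n * (n ! : ℚ)⁻¹) ⊗ₜ[ℤ] (1 : Ainf p R) * w ^ n := by
      have hp0 : (p : ℚ) ≠ 0 := Nat.cast_ne_zero.2 (Fact.out : p.Prime).ne_zero
      have hf0 : ((p - 1) ! : ℚ) ≠ 0 := Nat.cast_ne_zero.2 (Nat.factorial_ne_zero _)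
      have hc : ∀ m : ℕ, ((m : ℕ) : AinfQ p R) = (m : ℚ) ⊗ₜ[ℤ] (1 : Ainf p R) := fun m => by
        rw [← nsmul_one m, Algebra.TensorProduct.one_def, TensorProduct.smul_tmul', nsmul_one]
      have h2 : (p : AinfQ p R) * w =
          (1 : ℚ) ⊗ₜ[ℤ] (WittVector.map (_root_.frobenius (PreTilt R p) p) x) := by
        rw [hz, hw, mul_add, TensorProduct.tmul_add, ← mul_assoc, hc, hc]
        congr 1
        · rw [dpow, Algebra.TensorProduct.tmul_mul_tmul, Algebra.TensorProduct.tmul_mul_tmul,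
            one_mul, one_mul, ← Nat.cast_mul, Nat.mul_factorial_pred (Fact.out : p.Prime).ne_zero,
            mul_inv_cancel₀ (Nat.cast_ne_zero.2 (Nat.factorial_ne_zero _))]
        · rw [Algebra.TensorProduct.tmul_mul_tmul, one_mul, mul_one, ← nsmul_eq_mul,
            TensorProduct.tmul_smul, TensorProduct.smul_tmul', nsmul_one]
      have h3 : ((p : ℚ) ^ n * (n ! : ℚ)⁻¹) ⊗ₜ[ℤ] (1 : Ainf p R)
          = ((n ! : ℚ)⁻¹ ⊗ₜ[ℤ] (1 : Ainf p R)) * (p : AinfQ p R) ^ n := by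
        rw [hc, Algebra.TensorProduct.tmul_pow, Algebra.TensorProduct.tmul_mul_tmul, one_pow,
          one_mul, mul_comm]
      rw [h3, mul_assoc, ← mul_pow, h2, Algebra.TensorProduct.tmul_pow,
        Algebra.TensorProduct.tmul_mul_tmul, one_pow, one_mul, mul_one, dpow]
    rw [h1]
    exact mul_mem (pow_div_factorial_mem n) (pow_mem hwm n)
  untilt_eq_one x hx := by
    rw [_root_.frobenius_def, map_pow, hx, one_pow]

/-- The action of an automorphism of `R`. -/
def autEnd (f : R ≃+* R) : CrisEnd p R where
  toHom := tiltMap p f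
  inj := Function.LeftInverse.injective (g := tiltMap p (f.symm : R →+* R))
    (tiltMap_leftInverse _ _ (by ext; simp))
  dpow_mem x hx n := Subring.subset_closure (Or.inr ⟨_, n, by rw [fontaineTheta_map, hx, map_zero], rfl⟩)
  untilt_eq_one x hx := by
    rw [untilt_tiltMap, hx, map_one]

end Frobenius

section PadicField

variable (p : ℕ) [Fact p.Prime] (k : Type*) [Field k] [Finite k] [CharP k p]

instance perfectRing_of_finite : PerfectRing k p := inferInstance

/-- An algebraic closure of `F = W(k)[1/p]`. -/
abbrev Fbar : Type _ := AlgebraicClosure K(p, k)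

/-- The ring of integers of the algebraic closure. -/
abbrev OFbar : Type _ := integralClosure (WittVector p k) (Fbar p k)

/-- The ring of integers of `ℂ_p`: the `p`-adic completion of the integers of the algebraic
closure. -/
abbrev OC : Type _ := pCompletion p (OFbar p k)

/-- The absolute Galois group of `F`. -/
abbrev GalF : Type _ := Gal(Fbar p k / K(p, k))

instance fact_not_isUnit : Fact ¬IsUnit (p : OC p k) := ⟨by
  intro h
  have h1 := h.map (pCompletionEval p (OFbar p k) 1)
  rw [map_natCast] at h1
  have h0 : (p : OFbar p k ⧸ span {(p : OFbar p k)} ^ 1) = 0 := by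
    rw [← map_natCast (Ideal.Quotient.mk _), Ideal.Quotient.eq_zero_iff_mem, pow_one]
    exact Ideal.mem_span_singleton_self _
  rw [h0, isUnit_zero_iff, ← map_zero (Ideal.Quotient.mk _), ← map_one (Ideal.Quotient.mk _),
    Ideal.Quotient.eq, pow_one, Ideal.mem_span_singleton] at h1
  obtain ⟨y', hy'⟩ := h1
  obtain ⟨y, hy⟩ : ∃ y : OFbar p k, 1 = p * y :=
    ⟨-y', by rw [mul_neg, ← hy', zero_sub, neg_neg]⟩
  clear hy' y'
  have hp0 : (p : K(p, k)) ≠ 0 := FractionRing.p_nonzero p k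
  have hy' : (1 : Fbar p k) = p * (y : Fbar p k) := by
    have := congrArg (fun z : OFbar p k => (z : Fbar p k)) hy
    simpa using this
  have hy2 : algebraMap K(p, k) (Fbar p k) ((p : K(p, k))⁻¹) = y := by
    rw [map_inv₀, map_natCast]
    exact inv_eq_of_mul_eq_one_right hy'.symm
  have hint : IsIntegral (WittVector p k) ((p : K(p, k))⁻¹) := by
    rw [← isIntegral_algebraMap_iff (algebraMap K(p, k) (Fbar p k)).injective, hy2]
    exact y.2
  obtain ⟨w, hw⟩ := IsIntegrallyClosed.algebraMap_eq_of_integral hint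
  have h1 : (p : WittVector p k) * w = 1 := by
    apply IsFractionRing.injective (WittVector p k) K(p, k)
    rw [map_mul, map_natCast, hw, mul_inv_cancel₀ hp0, map_one]
  have h2 := congrArg (constantCoeff : WittVector p k →+* k) h1
  rw [map_mul, map_natCast, CharP.cast_eq_zero, zero_mul, map_one] at h2
  exact zero_ne_one h2⟩

/-- The action of the Galois group on the ring of integers of `ℂ_p`. -/
def galOC (g : GalF p k) : OC p k ≃+* OC p k :=
  let e : OFbar p k ≃+* OFbar p k :=
    (AlgEquiv.mapIntegralClosure (g.restrictScalars (WittVector p k))).toRingEquiv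
  RingEquiv.ofRingHom (pCompletionMap p e) (pCompletionMap p e.symm)
    (by rw [← pCompletionMap_comp]; simp [pCompletionMap_id])
    (by rw [← pCompletionMap_comp]; simp [pCompletionMap_id])

/-- The inclusion of `W(k)` in the ring of integers of `ℂ_p`. -/
def wittToOC : WittVector p k →+* OC p k :=
  (toPCompletion p (OFbar p k)).comp (algebraMap (WittVector p k) (OFbar p k))

theorem galOC_wittToOC (g : GalF p k) (w : WittVector p k) :
    galOC p k g (wittToOC p k w) = wittToOC p k w := by
  change pCompletionMap p _ (toPCompletion p _ _) = _
  rw [pCompletionMap_of]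
  refine congrArg (toPCompletion p (OFbar p k)) ?_
  exact AlgEquiv.commutes (AlgEquiv.mapIntegralClosure (g.restrictScalars (WittVector p k))) w

theorem ker_constantCoeff_le :
    RingHom.ker (constantCoeff : WittVector p k →+* k) ≤
      RingHom.ker ((Ideal.Quotient.mk (span {(p : OC p k)})).comp (wittToOC p k)) := by
  intro x hx
  have h := (mem_span_p_iff_coeff_zero_eq_zero (p := p) x).2 hx
  obtain ⟨y, rfl⟩ := Ideal.mem_span_singleton.1 h
  rw [RingHom.mem_ker, RingHom.comp_apply, Ideal.Quotient.eq_zero_iff_mem, map_mul, map_natCast]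
  exact Ideal.mul_mem_right _ _ (Ideal.mem_span_singleton_self _)

/-- The embedding of the residue field `k = W(k)/p` of `F` in `O_{ℂ_p}/p`. -/
def residueEmb : k →+* ModP (OC p k) p :=
  RingHom.liftOfSurjective (constantCoeff : WittVector p k →+* k) (constantCoeff_surjective p)
    ⟨_, ker_constantCoeff_le p k⟩

theorem residueEmb_constantCoeff (w : WittVector p k) :
    residueEmb p k (constantCoeff w) = Ideal.Quotient.mk _ (wittToOC p k w) :=
  RingHom.liftOfSurjective_comp_apply ..

/-- The embedding of the residue field in the tilt. -/
def residueTilt : k →+* PreTilt (OC p k) p :=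
  Perfection.lift p k (ModP (OC p k) p) (residueEmb p k)

theorem tiltMap_residueTilt (g : GalF p k) (a : k) :
    tiltMap p (galOC p k g : OC p k →+* OC p k) (residueTilt p k a) = residueTilt p k a := by
  have h : (tiltMap p (galOC p k g : OC p k →+* OC p k)).comp (residueTilt p k)
      = residueTilt p k := by
    refine Perfection.hom_ext p fun x => ?_
    obtain ⟨w, rfl⟩ := constantCoeff_surjective p x
    change Ideal.quotientMap (span {(p : OC p k)}) (galOC p k g : OC p k →+* OC p k)
      (by simpa only [pow_one] using span_pow_le_comap p (galOC p k g : OC p k →+* OC p k) 1)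
      (residueEmb p k (constantCoeff w)) = residueEmb p k (constantCoeff w)
    rw [residueEmb_constantCoeff, Ideal.quotientMap_mk]
    exact congrArg _ (galOC_wittToOC p k g w)
  exact congrArg (fun F => F a) h

/-- The ring `B_cris` of the field `F`. -/
abbrev BcrisF : Type _ := Bcris p (OC p k)

/-- The structure map `W(k) → A_inf → A_cris`. -/
def wittToAcris : WittVector p k →+* Acris p (OC p k) :=
  ((toPCompletion p (AcrisPre p (OC p k))).comp ainfToPre).comp
    (WittVector.map (residueTilt p k))

theorem acrisMap_wittToAcris (e : CrisEnd p (OC p k)) (s : k →+* k)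
    (h : ∀ a, e.toHom (residueTilt p k a) = residueTilt p k (s a)) (w : WittVector p k) :
    acrisMap e (wittToAcris p k w) = wittToAcris p k (WittVector.map s w) := by
  change pCompletionMap p _ (toPCompletion p _ _) = toPCompletion p _ _
  rw [pCompletionMap_of]
  congr 1
  refine Subtype.ext ?_
  change ainfQMap p _ e.toHom (1 ⊗ₜ _) = 1 ⊗ₜ _
  rw [ainfQMap_tmul]
  congr 1
  ext i
  simp [h]

instance bcrisWittAlgebra : Algebra (WittVector p k) (BcrisF p k) :=
  ((algebraMap (Acris p (OC p k)) (BcrisF p k)).comp (wittToAcris p k)).toAlgebra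

theorem algebraMap_witt_apply (w : WittVector p k) :
    algebraMap (WittVector p k) (BcrisF p k) w
      = algebraMap (Acris p (OC p k)) (BcrisF p k) (wittToAcris p k w) := rfl

theorem isUnit_p_bcris : IsUnit (p : BcrisF p k) := by
  have h := IsLocalization.map_units (BcrisF p k)
    (⟨(p : Acris p (OC p k)), Submonoid.subset_closure (Or.inl rfl)⟩ : crisSubmonoid p (OC p k))
  simpa using h

theorem isUnit_witt_bcris (w : nonZeroDivisors (WittVector p k)) :
    IsUnit (algebraMap (WittVector p k) (BcrisF p k) w) := by
  obtain ⟨m, b, h⟩ := exists_eq_pow_p_mul' (p := p) (w : WittVector p k)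
    (nonZeroDivisors.ne_zero w.2)
  rw [h, map_mul, map_pow, map_natCast]
  exact ((isUnit_p_bcris p k).pow m).mul (b.isUnit.map _)

/-- The structure of an `F`-algebra on `B_cris`. -/
instance bcrisFieldAlgebra : Algebra K(p, k) (BcrisF p k) :=
  (IsLocalization.lift (M := nonZeroDivisors (WittVector p k)) (isUnit_witt_bcris p k)).toAlgebra

instance bcrisTower : IsScalarTower (WittVector p k) K(p, k) (BcrisF p k) :=
  IsScalarTower.of_algebraMap_eq fun w => (IsLocalization.lift_eq (isUnit_witt_bcris p k) w).symm

/-- The structure of a `ℤ_p`-algebra on `B_cris`. -/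
instance bcrisZpAlgebra : Algebra ℤ_[p] (BcrisF p k) :=
  ((algebraMap (WittVector p k) (BcrisF p k)).comp (zpToWitt p k)).toAlgebra

theorem bcrisMap_witt (e : CrisEnd p (OC p k)) (s : k →+* k)
    (h : ∀ a, e.toHom (residueTilt p k a) = residueTilt p k (s a)) (w : WittVector p k) :
    bcrisMap e (algebraMap (WittVector p k) (BcrisF p k) w)
      = algebraMap (WittVector p k) (BcrisF p k) (WittVector.map s w) := by
  rw [algebraMap_witt_apply, bcrisMap_algebraMap, acrisMap_wittToAcris p k e s h]
  rfl

theorem bcrisMap_zp (e : CrisEnd p (OC p k)) (s : k →+* k)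
    (h : ∀ a, e.toHom (residueTilt p k a) = residueTilt p k (s a)) (z : ℤ_[p]) :
    bcrisMap e (algebraMap ℤ_[p] (BcrisF p k) z) = algebraMap ℤ_[p] (BcrisF p k) z := by
  change bcrisMap e (algebraMap (WittVector p k) (BcrisF p k) (zpToWitt p k z)) = _
  rw [bcrisMap_witt p k e s h]
  change _ = algebraMap (WittVector p k) (BcrisF p k) (zpToWitt p k z)
  congr 1
  ext i
  simp only [zpToWitt, RingHom.comp_apply, map_coeff]
  exact RingHom.congr_fun (Subsingleton.elim (s.comp (ZMod.castHom dvd_rfl k))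
    (ZMod.castHom dvd_rfl k)) _

/-- The Galois action on `B_cris`. -/
def galB (g : GalF p k) : BcrisF p k →+* BcrisF p k := bcrisMap (autEnd (galOC p k g))

/-- The Frobenius of `B_cris`. -/
def phiB : BcrisF p k →+* BcrisF p k := bcrisMap (frobEnd p (OC p k))

theorem galB_phiB (g : GalF p k) (b : BcrisF p k) :
    galB p k g (phiB p k b) = phiB p k (galB p k g b) :=
  bcrisMap_comm _ _ (fun _ => RingHom.map_frobenius _ _ _) b

theorem galB_algebraMap (g : GalF p k) (a : K(p, k)) :
    galB p k g (algebraMap _ _ a) = algebraMap _ _ a := by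
  have h : (galB p k g).comp (algebraMap K(p, k) (BcrisF p k)) = algebraMap K(p, k) (BcrisF p k) := by
    refine IsLocalization.ringHom_ext (nonZeroDivisors (WittVector p k)) ?_
    ext w
    simp only [RingHom.comp_apply]
    rw [← IsScalarTower.algebraMap_apply]
    have := bcrisMap_witt p k (autEnd (galOC p k g)) (RingHom.id k)
      (fun a => tiltMap_residueTilt p k g a) w
    refine this.trans (congrArg _ ?_)
    ext i
    simp
  exact congrArg (fun F => F a) h

theorem phiB_algebraMap (a : K(p, k)) :
    phiB p k (algebraMap _ _ a) = algebraMap _ _ (φ(p, k) a) := by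
  have h : (phiB p k).comp (algebraMap K(p, k) (BcrisF p k))
      = (algebraMap K(p, k) (BcrisF p k)).comp φ(p, k) := by
    refine IsLocalization.ringHom_ext (nonZeroDivisors (WittVector p k)) ?_
    ext w
    simp only [RingHom.comp_apply]
    rw [← IsScalarTower.algebraMap_apply]
    have h1 := bcrisMap_witt p k (frobEnd p (OC p k)) (_root_.frobenius k p)
      (fun a => (RingHom.map_frobenius (residueTilt p k) p a).symm) w
    have h2 : φ(p, k) (algebraMap (WittVector p k) K(p, k) w)
        = algebraMap (WittVector p k) K(p, k) (WittVector.map (_root_.frobenius k p) w) := by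
      rw [← frobenius_eq_map_frobenius]
      exact IsFractionRing.ringEquivOfRingEquiv_algebraMap _ _
    rw [h2, ← IsScalarTower.algebraMap_apply]
    exact h1
  exact congrArg (fun F => F a) h

end PadicField

section Dcris

variable (p : ℕ) [Fact p.Prime] {k : Type*} [Field k] [Finite k] [CharP k p]
variable {T : Type*} [AddCommGroup T] [Module ℤ_[p] T]

theorem galB_zp (g : GalF p k) (z : ℤ_[p]) (b : BcrisF p k) :
    galB p k g (z • b) = z • galB p k g b := by
  rw [Algebra.smul_def, map_mul, Algebra.smul_def]
  congr 1
  exact bcrisMap_zp p k (autEnd (galOC p k g)) (RingHom.id k)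
    (fun a => tiltMap_residueTilt p k g a) z

theorem phiB_zp (z : ℤ_[p]) (b : BcrisF p k) : phiB p k (z • b) = z • phiB p k b := by
  rw [Algebra.smul_def, map_mul, Algebra.smul_def]
  congr 1
  exact bcrisMap_zp p k (frobEnd p (OC p k)) (_root_.frobenius k p)
    (fun a => (RingHom.map_frobenius (residueTilt p k) p a).symm) z

/-- The diagonal action of the Galois group on `B_cris ⊗ T`. -/
def galTensor (ρ : Representation ℤ_[p] (GalF p k) T) (g : GalF p k) :
    BcrisF p k ⊗[ℤ_[p]] T →ₗ[ℤ_[p]] BcrisF p k ⊗[ℤ_[p]] T :=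
  TensorProduct.map
    { toFun := galB p k g, map_add' := map_add _, map_smul' := galB_zp p g } (ρ g)

variable (k T) in
/-- The Frobenius `φ ⊗ 1` of `B_cris ⊗ T`. -/
def phiTensor : BcrisF p k ⊗[ℤ_[p]] T →ₗ[ℤ_[p]] BcrisF p k ⊗[ℤ_[p]] T :=
  TensorProduct.map
    { toFun := phiB p k, map_add' := map_add _, map_smul' := phiB_zp p } LinearMap.id

theorem galTensor_smul (ρ : Representation ℤ_[p] (GalF p k) T) (g : GalF p k) (a : K(p, k))
    (x : BcrisF p k ⊗[ℤ_[p]] T) : galTensor p ρ g (a • x) = a • galTensor p ρ g x := by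
  induction x using TensorProduct.induction_on with
  | zero => simp
  | add x y hx hy => simp only [smul_add, map_add, hx, hy]
  | tmul b t =>
    rw [TensorProduct.smul_tmul', galTensor, TensorProduct.map_tmul, TensorProduct.map_tmul,
      TensorProduct.smul_tmul']
    congr 1
    change galB p k g (a • b) = a • galB p k g b
    rw [Algebra.smul_def, map_mul, galB_algebraMap, Algebra.smul_def]

theorem phiTensor_smul (a : K(p, k)) (x : BcrisF p k ⊗[ℤ_[p]] T) :
    phiTensor p k T (a • x) = φ(p, k) a • phiTensor p k T x := by
  induction x using TensorProduct.induction_on with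
  | zero => simp
  | add x y hx hy => simp only [smul_add, map_add, hx, hy]
  | tmul b t =>
    rw [TensorProduct.smul_tmul', phiTensor, TensorProduct.map_tmul, TensorProduct.map_tmul,
      TensorProduct.smul_tmul']
    congr 1
    change phiB p k (a • b) = φ(p, k) a • phiB p k b
    rw [Algebra.smul_def, map_mul, phiB_algebraMap, Algebra.smul_def]

theorem galTensor_phiTensor (ρ : Representation ℤ_[p] (GalF p k) T) (g : GalF p k)
    (x : BcrisF p k ⊗[ℤ_[p]] T) :
    galTensor p ρ g (phiTensor p k T x) = phiTensor p k T (galTensor p ρ g x) := by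
  induction x using TensorProduct.induction_on with
  | zero => simp
  | add x y hx hy => simp only [map_add, hx, hy]
  | tmul b t =>
    simp only [galTensor, phiTensor, TensorProduct.map_tmul, LinearMap.id_apply]
    congr 1
    exact galB_phiB p k g b

variable (k T) in
/-- `B_cris ⊗ T`, the tensor product over `ℤ_p`. -/
def BT : Type _ := BcrisF p k ⊗[ℤ_[p]] T

instance : AddCommGroup (BT p k T) := inferInstanceAs (AddCommGroup (BcrisF p k ⊗[ℤ_[p]] T))

instance : Module ℤ_[p] (BT p k T) := inferInstanceAs (Module ℤ_[p] (BcrisF p k ⊗[ℤ_[p]] T))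

instance : Module (BcrisF p k) (BT p k T) :=
  inferInstanceAs (Module (BcrisF p k) (BcrisF p k ⊗[ℤ_[p]] T))

instance : Module K(p, k) (BT p k T) := inferInstanceAs (Module K(p, k) (BcrisF p k ⊗[ℤ_[p]] T))

instance : Module (WittVector p k) (BT p k T) :=
  inferInstanceAs (Module (WittVector p k) (BcrisF p k ⊗[ℤ_[p]] T))

instance : IsScalarTower K(p, k) (BcrisF p k) (BT p k T) :=
  inferInstanceAs (IsScalarTower K(p, k) (BcrisF p k) (BcrisF p k ⊗[ℤ_[p]] T))

instance : IsScalarTower (WittVector p k) K(p, k) (BT p k T) :=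
  inferInstanceAs (IsScalarTower (WittVector p k) K(p, k) (BcrisF p k ⊗[ℤ_[p]] T))

/-- `D_cris(V) = (B_cris ⊗ V)^{G_F}` for `V = ℚ_p ⊗ T`; note `B_cris ⊗_{ℚ_p} V = B_cris ⊗_{ℤ_p} T`. -/
def Dcris (ρ : Representation ℤ_[p] (GalF p k) T) : Submodule K(p, k) (BT p k T) where
  carrier := {x | ∀ g, galTensor p ρ g x = x}
  zero_mem' := fun _ => map_zero _
  add_mem' := fun hx hy g => (map_add (galTensor p ρ g) _ _).trans (congrArg₂ (· + ·) (hx g) (hy g))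
  smul_mem' := fun a x hx g => (galTensor_smul p ρ g a x).trans (congrArg (a • ·) (hx g))

/-- The semilinear Frobenius `φ` of `D_cris(V)`. -/
def phiD (ρ : Representation ℤ_[p] (GalF p k) T) : Dcris p ρ →ₛₗ[φ(p, k)] Dcris p ρ where
  toFun x := ⟨phiTensor p k T x.1,
    fun g => (galTensor_phiTensor p ρ g x.1).trans (congrArg (phiTensor p k T) (x.2 g))⟩
  map_add' x y := Subtype.ext (map_add (phiTensor p k T) x.1 y.1)
  map_smul' a x := Subtype.ext (phiTensor_smul p a x.1)

/-- `Fil^0 D_cris(V)`, the intersection of `D_cris(V)` with `Fil^0 B_cris ⊗ V`. -/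
def filZeroD (ρ : Representation ℤ_[p] (GalF p k) T) : Submodule K(p, k) (Dcris p ρ) :=
  (Submodule.span K(p, k) {z : BT p k T |
    ∃ b ∈ filZeroBcris p (OC p k), ∃ x : T, z = (b ⊗ₜ[ℤ_[p]] x : BcrisF p k ⊗[ℤ_[p]] T)}).comap (Dcris p ρ).subtype

/-- `V = ℚ_p ⊗ T` is crystalline: the comparison map `B_cris ⊗_F D_cris(V) → B_cris ⊗ V` is an
isomorphism. -/
def IsCrystalline (ρ : Representation ℤ_[p] (GalF p k) T) : Prop :=
  Function.Bijective ((Dcris p ρ).subtype.liftBaseChange (BcrisF p k))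

/-- The action of the Galois group on `T` is continuous for the `p`-adic topology of `T`. -/
def IsPadicContinuous (ρ : Representation ℤ_[p] (GalF p k) T) : Prop :=
  ∀ (x : T) (n : ℕ), ∃ U : Subgroup (GalF p k), IsOpen (U : Set (GalF p k)) ∧
    ∀ g ∈ U, ∃ y : T, ρ g x - x = (p : ℤ_[p]) ^ n • y

/-- None of the eigenvalues of `φ` on `D_cris(V)` is an integral power of `p`. -/
def HEigen (ρ : Representation ℤ_[p] (GalF p k) T) : Prop :=
  ∀ (m : ℤ) (x : Dcris p ρ), phiD p ρ x = (p : K(p, k)) ^ m • x → x = 0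

end Dcris

section PowerSeries

open PowerSeries

variable (p : ℕ) [Fact p.Prime] {k : Type*} [Field k] [Finite k] [CharP k p]

theorem hasSubst_phi (A : Type*) [CommRing A] :
    PowerSeries.HasSubst ((1 + X) ^ p - 1 : A⟦X⟧) :=
  PowerSeries.HasSubst.of_constantCoeff_zero' (by simp)

/-- The Frobenius of power series: `φ(∑ a_m π ^ m) = ∑ σ(a_m) ((1 + π) ^ p - 1) ^ m`. -/
def phiPS {A : Type*} [CommRing A] (σ : A →+* A) : A⟦X⟧ →+* A⟦X⟧ :=
  ((PowerSeries.substAlgHom (hasSubst_phi p A) : A⟦X⟧ →ₐ[A] A⟦X⟧) : A⟦X⟧ →+* A⟦X⟧).comp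
    (PowerSeries.map σ)

/-- `IsPsi f h` says that `ψ(f) = h` for the left inverse `ψ` of `φ` on `W(k)⟦π⟧`: in the unique
expansion `f = ∑ (1 + π) ^ i φ(c i)`, `0 ≤ i < p`, one has `c 0 = h`. So `ψ` sends `(1 + π) ^ i`
to `(1 + π) ^ (i / p)` if `p ∣ i`, and to `0` otherwise. -/
def IsPsi (f h : (WittVector p k)⟦X⟧) : Prop :=
  ∃ c : ℕ → (WittVector p k)⟦X⟧, c 0 = h ∧
    f = ∑ i ∈ Finset.range p, (1 + X) ^ i * phiPS p WittVector.frobenius (c i)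

/-- `f` converges on the open unit disk, i.e. `f` lies in `B^+_{F,rig}`: for every `j ≥ 1` the
valuations of the coefficients satisfy `v_p(a_m) ≥ - C - ⌊m / j⌋` for some constant `C`. -/
def IsRig (f : K(p, k)⟦X⟧) : Prop :=
  ∀ j : ℕ, 0 < j → ∃ C : ℕ, ∀ m : ℕ, ∃ b : WittVector p k,
    algebraMap (WittVector p k) K(p, k) b = (p : K(p, k)) ^ (C + m / j) * coeff m f

/-- `b` is integral over `W(k)`; for `b` in a finite extension `E` of `F` this says that `b` lies in
the ring of integers of `E`. -/
def IsInt {E : Type*} [Field E] [Algebra K(p, k) E] (b : E) : Prop :=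
  ((algebraMap K(p, k) E).comp (algebraMap (WittVector p k) K(p, k))).IsIntegralElem b

/-- The series `f(x)` converges `p`-adically to `y` in an extension `E` of `F`. -/
def HasValue {E : Type*} [Field E] [Algebra K(p, k) E] (f : K(p, k)⟦X⟧) (x y : E) : Prop :=
  ∀ N : ℕ, ∃ M₀ : ℕ, ∀ M ≥ M₀, ∃ b : E, IsInt p (k := k) b ∧
    y - ∑ m ∈ Finset.range M, algebraMap K(p, k) E (coeff m f) * x ^ m = (p : E) ^ N * b

variable {p}

theorem IsPsi.zero : IsPsi p (0 : (WittVector p k)⟦X⟧) 0 := ⟨fun _ => 0, rfl, by simp⟩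

theorem IsPsi.add {f g : (WittVector p k)⟦X⟧} (hf : IsPsi p f 0) (hg : IsPsi p g 0) :
    IsPsi p (f + g) 0 := by
  obtain ⟨c, h0, hc⟩ := hf
  obtain ⟨d, e0, hd⟩ := hg
  refine ⟨c + d, by simp [h0, e0], ?_⟩
  rw [hc, hd, ← Finset.sum_add_distrib]
  simp [mul_add]

theorem IsPsi.neg {f : (WittVector p k)⟦X⟧} (hf : IsPsi p f 0) : IsPsi p (-f) 0 := by
  obtain ⟨c, h0, hc⟩ := hf
  refine ⟨-c, by simp [h0], ?_⟩
  rw [hc, ← Finset.sum_neg_distrib]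
  simp

theorem IsRig.zero : IsRig p (0 : K(p, k)⟦X⟧) := fun _ _ => ⟨0, fun _ => ⟨0, by simp⟩⟩

theorem IsRig.add {f g : K(p, k)⟦X⟧} (hf : IsRig p f) (hg : IsRig p g) : IsRig p (f + g) := by
  intro j hj
  obtain ⟨C, hC⟩ := hf j hj
  obtain ⟨C', hC'⟩ := hg j hj
  refine ⟨C + C', fun m => ?_⟩
  obtain ⟨b, hb⟩ := hC m
  obtain ⟨b', hb'⟩ := hC' m
  refine ⟨p ^ C' * b + p ^ C * b', ?_⟩
  simp only [map_add, map_mul, map_pow, map_natCast, hb, hb']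
  ring

theorem IsRig.neg {f : K(p, k)⟦X⟧} (hf : IsRig p f) : IsRig p (-f) := by
  intro j hj
  obtain ⟨C, hC⟩ := hf j hj
  refine ⟨C, fun m => ?_⟩
  obtain ⟨b, hb⟩ := hC m
  exact ⟨-b, by simp [hb]⟩

section Value

variable {E : Type*} [Field E] [Algebra K(p, k) E]

theorem HasValue.zero (x : E) : HasValue p (0 : K(p, k)⟦X⟧) x 0 :=
  fun _ => ⟨0, fun _ _ => ⟨0, RingHom.isIntegralElem_zero _, by simp⟩⟩

theorem HasValue.add {f g : K(p, k)⟦X⟧} {x y z : E} (hf : HasValue p f x y)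
    (hg : HasValue p g x z) : HasValue p (f + g) x (y + z) := by
  intro N
  obtain ⟨M, hM⟩ := hf N
  obtain ⟨M', hM'⟩ := hg N
  refine ⟨max M M', fun L hL => ?_⟩
  obtain ⟨b, hb, e⟩ := hM L (le_of_max_le_left hL)
  obtain ⟨b', hb', e'⟩ := hM' L (le_of_max_le_right hL)
  refine ⟨b + b', RingHom.IsIntegralElem.add _ hb hb', ?_⟩
  rw [mul_add, ← e, ← e']
  simp only [map_add, add_mul, Finset.sum_add_distrib]
  ring

theorem HasValue.neg {f : K(p, k)⟦X⟧} {x y : E} (hf : HasValue p f x y) :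
    HasValue p (-f) x (-y) := by
  intro N
  obtain ⟨M, hM⟩ := hf N
  refine ⟨M, fun L hL => ?_⟩
  obtain ⟨b, hb, e⟩ := hM L hL
  refine ⟨-b, RingHom.IsIntegralElem.neg _ hb, ?_⟩
  rw [mul_neg, ← e]
  simp only [map_neg, neg_mul, Finset.sum_neg_distrib]
  ring

end Value

end PowerSeries

section Lattices

open PowerSeries

variable (p : ℕ) [Fact p.Prime] {k : Type*} [Field k] [Finite k] [CharP k p]
variable {T : Type*} [AddCommGroup T] [Module ℤ_[p] T]

/-- `F_n = F(μ_{p^n})`. -/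
abbrev Fn (k : Type*) [Field k] [Finite k] [CharP k p] (n : ℕ) : Type _ :=
  CyclotomicField (p ^ n) K(p, k)

/-- The tangent space `t_n(V) = F_n ⊗ D_cris(V) / Fil^0 D_cris(V)`. -/
abbrev tangent (ρ : Representation ℤ_[p] (GalF p k) T) (n : ℕ) : Type _ :=
  Fn p k n ⊗[K(p, k)] (Dcris p ρ ⧸ filZeroD p ρ)

variable {p}
variable {ρ : Representation ℤ_[p] (GalF p k) T}

/-- The lattice `L_n = O_{F_n} ⊗ D / Fil^0 D` in `t_n(V)`. -/
def latticeL (D : Submodule (WittVector p k) (Dcris p ρ)) (n : ℕ) : AddSubgroup (tangent p ρ n) :=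
  AddSubgroup.closure {z | ∃ a : Fn p k n, IsInt p (k := k) a ∧ ∃ x ∈ D, z = a ⊗ₜ (filZeroD p ρ).mkQ x}

variable {D : Submodule (WittVector p k) (Dcris p ρ)} {ι : Type*} [Fintype ι]

/-- `(1 - φ) G = g`, for `G = ∑ f i ⊗ v i` with `f i` in `B^+_{F,rig}` and `g = ∑ g i ⊗ v i` with
`g i` in `W(k)⟦π⟧`. Here `φ` acts diagonally. -/
def SolvesE (v : Module.Basis ι (WittVector p k) D) (g : ι → (WittVector p k)⟦X⟧)
    (f : ι → K(p, k)⟦X⟧) : Prop :=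
  (∀ i, IsRig p (f i)) ∧
    (∑ i, f i ⊗ₜ[K(p, k)] (v i : Dcris p ρ)) -
        ∑ i, phiPS p φ(p, k) (f i) ⊗ₜ[K(p, k)] phiD p ρ (v i : Dcris p ρ)
      = ∑ i, PowerSeries.map (algebraMap (WittVector p k) K(p, k)) (g i) ⊗ₜ[K(p, k)]
          (v i : Dcris p ρ)

/-- The graph of `Θ_{T,n}`: `x` is the class modulo `Fil^0` of `G^{σ^{-n}}(ζ - 1)`, where
`G = ∑ f i ⊗ v i` is the solution of `(1 - φ) G = g` for `g = ∑ g i ⊗ v i`, and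
`G^{σ^{-n}} = ∑ (f i)^{σ^{-n}} ⊗ v i`. -/
def IsTheta (v : Module.Basis ι (WittVector p k) D) (n : ℕ) (ζ : Fn p k n)
    (g : ι → (WittVector p k)⟦X⟧) (x : tangent p ρ n) : Prop :=
  ∃ f : ι → K(p, k)⟦X⟧, SolvesE v g f ∧ ∃ y : ι → Fn p k n,
    (∀ i, HasValue p
      (PowerSeries.map (((FractionRing.frobenius p k).symm : K(p, k) →+* K(p, k)) ^ n) (f i))
      (ζ - 1) (y i)) ∧
    x = ∑ i, y i ⊗ₜ[K(p, k)] (filZeroD p ρ).mkQ (v i : Dcris p ρ)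

theorem IsTheta.zero (v : Module.Basis ι (WittVector p k) D) (n : ℕ) (ζ : Fn p k n) :
    IsTheta v n ζ 0 0 :=
  ⟨0, ⟨fun _ => IsRig.zero, by simp⟩, 0, fun _ => by simpa using HasValue.zero _, by simp⟩

theorem IsTheta.add {v : Module.Basis ι (WittVector p k) D} {n : ℕ} {ζ : Fn p k n}
    {g g' : ι → (WittVector p k)⟦X⟧} {x x' : tangent p ρ n} (h : IsTheta v n ζ g x)
    (h' : IsTheta v n ζ g' x') : IsTheta v n ζ (g + g') (x + x') := by
  obtain ⟨f, ⟨hr, hs⟩, y, hy, rfl⟩ := h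
  obtain ⟨f', ⟨hr', hs'⟩, y', hy', rfl⟩ := h'
  refine ⟨f + f', ⟨fun i => (hr i).add (hr' i), ?_⟩, y + y', fun i => ?_, ?_⟩
  · simp only [Pi.add_apply, map_add, TensorProduct.add_tmul, Finset.sum_add_distrib]
    rw [add_sub_add_comm, hs, hs']
  · simpa only [Pi.add_apply, map_add] using (hy i).add (hy' i)
  · simp only [Pi.add_apply, TensorProduct.add_tmul, Finset.sum_add_distrib]

theorem IsTheta.neg {v : Module.Basis ι (WittVector p k) D} {n : ℕ} {ζ : Fn p k n}
    {g : ι → (WittVector p k)⟦X⟧} {x : tangent p ρ n} (h : IsTheta v n ζ g x) :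
    IsTheta v n ζ (-g) (-x) := by
  obtain ⟨f, ⟨hr, hs⟩, y, hy, rfl⟩ := h
  refine ⟨-f, ⟨fun i => (hr i).neg, ?_⟩, -y, fun i => ?_, ?_⟩
  · simp only [Pi.neg_apply, map_neg, TensorProduct.neg_tmul, Finset.sum_neg_distrib]
    rw [← neg_sub', hs]
  · simpa only [Pi.neg_apply, map_neg] using (hy i).neg
  · simp only [Pi.neg_apply, TensorProduct.neg_tmul, Finset.sum_neg_distrib]

/-- `A_n`, the image under `Θ_{T,n}` of `W(k)⟦π⟧^{ψ=0} ⊗ D`. -/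
def imageA (v : Module.Basis ι (WittVector p k) D) (n : ℕ) (ζ : Fn p k n) :
    AddSubgroup (tangent p ρ n) where
  carrier := {x | ∃ g : ι → (WittVector p k)⟦X⟧, (∀ i, IsPsi p (g i) 0) ∧ IsTheta v n ζ g x}
  zero_mem' := ⟨0, fun _ => IsPsi.zero, .zero v n ζ⟩
  add_mem' := by
    rintro x x' ⟨g, hg, h⟩ ⟨g', hg', h'⟩
    exact ⟨g + g', fun i => (hg i).add (hg' i), h.add h'⟩
  neg_mem' := by
    rintro x ⟨g, hg, h⟩
    exact ⟨-g, fun i => (hg i).neg, h.neg⟩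

/-- The generalized index `(A : L) = [A : A ∩ L] / [L : A ∩ L]` of commensurable subgroups. -/
def genIndex {G : Type*} [AddGroup G] (A L : AddSubgroup G) : ℚ :=
  (L.relIndex A : ℚ) / (A.relIndex L : ℚ)

/-- The `ℤ_p`-rank of a module over `W(k)`. -/
def zpRank (p : ℕ) [Fact p.Prime] (k : Type*) [Field k] [CharP k p] (M : Type*) [AddCommGroup M]
    [Module (WittVector p k) M] : ℕ :=
  letI : Module ℤ_[p] M := Module.compHom M (zpToWitt p k)
  Module.finrank ℤ_[p] M

/-- The `ℤ_p`-rank `d'` of `D / Fil^0 D`, the image of `D` in `D_cris(V) / Fil^0 D_cris(V)`. -/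
def dPrime (D : Submodule (WittVector p k) (Dcris p ρ)) : ℕ :=
  zpRank p k (D.map ((filZeroD p ρ).mkQ.restrictScalars (WittVector p k)))

end Lattices

end Crystalline

end

set_option linter.unusedSectionVars false

/-! Iterating G = g + φG gives G = ∑_{j<n} φ^j g + φ^n G, so no infinite sum is evaluated. Multiples
of (1+π)^{p^n} - 1 vanish at ζ - 1, hence φ^n G contributes only through its constant term, and (1 -
φ)G(0) = g(0). The value of G^{σ^{-n}} at ζ - 1 is therefore a finite sum of values of g at the
points ζ^{p^j} - 1, tensored with φ^j of lattice vectors, plus φ^n(G(0)), up to Frobenius twists of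
coefficients (`hasValue_solution`). The condition ψ(g) = 0 leaves only the powers of ζ with exponent
p^j (i + pb), 1 ≤ i < p (`exists_hasValue_of_isPsi`).

Bound for [A : A ∩ L]. Write n = N + 1. Applying φ^j costs the denominator p^{rj+s₁}, and G(0) costs
p^{s₂}. For j < N the relations between roots of unity leave (p-1)² p^{N-1-j} powers of ζ. The level
j = N and the constant term share the p - 1 powers ζ^{p^N i}, with denominator p^{r(N+1)+s₁+s₂},
because 1 = -∑_{0<i<p} ζ^{p^N i}. Thus A lies in a sum of (p-1)p^N = [F_n : F] copies of D/Fil⁰D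
with known denominators (`value_mem_valueSpan`). Their exponents add up to the coefficient of d' in
the bound (`sum_genDenom`, `relIndex_le_of_generators`). Once [L : A ∩ L] is known to be finite it
is at least 1, and dividing by it can only help.

Finiteness of [L : A ∩ L]. It suffices that each x in the tangent space has a p-power multiple in A.
The values for monomials w(1+π)^a with p ∤ a are explicit, and `mem_of_sum_mem` separates their
terms by comparing a with a + c p^{N-j}. This uses solutions G for all these g (`exists_solution`,
`isRig_of_solution`) and surjectivity of 1 - φ, pφ - 1 and φ. Injectivity of the first two is the
eigenvalue hypothesis and that of φ comes from the crystalline comparison (`phiD_injective`);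
`semi_surjective_of_injective` turns it into surjectivity. -/

namespace Crystalline

/-! ### Integral elements over W(k) in extensions of F. -/

section Integers

variable (p : ℕ) [Fact p.Prime] {k : Type*} [Field k] [Finite k] [CharP k p]

theorem charZero_fraction (k : Type*) [Field k] [Finite k] [CharP k p] : CharZero K(p, k) := by
  have : CharZero (WittVector p k) := by
    refine charZero_of_inj_zero fun n hn => ?_
    by_contra h0
    obtain ⟨v, u, hu, rfl⟩ :=
      Nat.exists_eq_pow_mul_and_not_dvd h0 p (Fact.out : p.Prime).ne_one
    have hcop : u.Coprime p := ((Nat.Prime.coprime_iff_not_dvd Fact.out).2 hu).symm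
    have hunit := isUnit_natCast_witt (p := p) (A := k) u hcop
    rw [Nat.cast_mul, Nat.cast_pow] at hn
    exact mul_ne_zero (pow_ne_zero v (WittVector.p_nonzero p k)) hunit.ne_zero hn
  exact charZero_of_injective_algebraMap (IsFractionRing.injective (WittVector p k) K(p, k))

theorem p_ne_zero (k E : Type*) [Field k] [Finite k] [CharP k p] [Field E] [Algebra K(p, k) E] :
    (p : E) ≠ 0 := by
  rw [← map_natCast (algebraMap K(p, k) E)]
  exact (map_ne_zero_iff _ (algebraMap K(p, k) E).injective).2 (FractionRing.p_nonzero p k)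

variable {p} {E : Type*} [Field E] [Algebra K(p, k) E]

theorem IsInt.of_witt (w : WittVector p k) :
    IsInt p (k := k) (algebraMap K(p, k) E (algebraMap (WittVector p k) K(p, k) w)) :=
  RingHom.isIntegralElem_map ((algebraMap K(p, k) E).comp (algebraMap (WittVector p k) K(p, k)))

theorem IsInt.natCast (n : ℕ) : IsInt p (k := k) (n : E) := by
  simpa using IsInt.of_witt (E := E) (n : WittVector p k)

theorem IsInt.zero : IsInt p (k := k) (0 : E) := RingHom.isIntegralElem_zero _

theorem IsInt.one : IsInt p (k := k) (1 : E) := RingHom.isIntegralElem_one _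

theorem IsInt.add {a b : E} (ha : IsInt p (k := k) a) (hb : IsInt p (k := k) b) :
    IsInt p (k := k) (a + b) := RingHom.IsIntegralElem.add _ ha hb

theorem IsInt.neg {a : E} (ha : IsInt p (k := k) a) :
    IsInt p (k := k) (-a) := RingHom.IsIntegralElem.neg _ ha

theorem IsInt.sub {a b : E} (ha : IsInt p (k := k) a) (hb : IsInt p (k := k) b) :
    IsInt p (k := k) (a - b) := RingHom.IsIntegralElem.sub _ ha hb

theorem IsInt.mul {a b : E} (ha : IsInt p (k := k) a) (hb : IsInt p (k := k) b) :
    IsInt p (k := k) (a * b) := RingHom.IsIntegralElem.mul _ ha hb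

theorem IsInt.pow {a : E} (ha : IsInt p (k := k) a) (n : ℕ) : IsInt p (k := k) (a ^ n) := by
  induction n with
  | zero => simpa using IsInt.one
  | succ n ih => rw [pow_succ]; exact ih.mul ha

theorem IsInt.sum {α : Type*} (s : Finset α) {f : α → E} (h : ∀ i ∈ s, IsInt p (k := k) (f i)) :
    IsInt p (k := k) (∑ i ∈ s, f i) := by
  classical
  induction s using Finset.induction_on with
  | empty => simpa using IsInt.zero
  | insert a s ha ih =>
    rw [Finset.sum_insert ha]
    exact (h a (Finset.mem_insert_self _ _)).add
      (ih fun i hi => h i (Finset.mem_insert_of_mem hi))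

theorem IsInt.of_pow_eq_one {z : E} {n : ℕ} (hn : 0 < n) (h : z ^ n = 1) :
    IsInt p (k := k) z :=
  ⟨Polynomial.X ^ n - 1, Polynomial.monic_X_pow_sub_C 1 hn.ne', by simp [h]⟩

theorem IsInt.exists_witt {a : K(p, k)} (h : IsInt p (k := k) (algebraMap K(p, k) E a)) :
    ∃ w : WittVector p k, algebraMap _ _ w = a := by
  let : Algebra (WittVector p k) E :=
    ((algebraMap K(p, k) E).comp (algebraMap (WittVector p k) K(p, k))).toAlgebra
  have : IsScalarTower (WittVector p k) K(p, k) E := IsScalarTower.of_algebraMap_eq fun _ => rfl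
  have h1 : IsIntegral (WittVector p k) (algebraMap K(p, k) E a) := h
  rw [isIntegral_algebraMap_iff (algebraMap K(p, k) E).injective] at h1
  exact IsIntegrallyClosed.algebraMap_eq_of_integral h1

theorem not_exists_witt_inv : ¬ ∃ w : WittVector p k,
    algebraMap (WittVector p k) K(p, k) w = (p : K(p, k))⁻¹ := by
  rintro ⟨w, hw⟩
  have h1 : (p : WittVector p k) * w = 1 := by
    apply IsFractionRing.injective (WittVector p k) K(p, k)
    rw [map_mul, map_natCast, hw, mul_inv_cancel₀ (FractionRing.p_nonzero p k), map_one]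
  have h2 := congrArg (constantCoeff : WittVector p k →+* k) h1
  rw [map_mul, map_natCast, CharP.cast_eq_zero, zero_mul, map_one] at h2
  exact zero_ne_one h2

/-- Algebraicity supplies some nonzero denominator in W(k); it is a unit times a power of p, and the
unit can be removed. -/
theorem exists_pow_mul_isInt [Algebra.IsAlgebraic K(p, k) E] (z : E) :
    ∃ m : ℕ, IsInt p (k := k) ((p : E) ^ m * z) := by
  let : Algebra (WittVector p k) E :=
    ((algebraMap K(p, k) E).comp (algebraMap (WittVector p k) K(p, k))).toAlgebra
  have : IsScalarTower (WittVector p k) K(p, k) E := IsScalarTower.of_algebraMap_eq fun _ => rfl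
  have halg : IsAlgebraic (WittVector p k) z :=
    (IsFractionRing.isAlgebraic_iff (WittVector p k) K(p, k) E).2 (Algebra.IsAlgebraic.isAlgebraic z)
  obtain ⟨c, hc0, hc⟩ := halg.exists_integral_multiple
  obtain ⟨m, u, rfl⟩ := exists_eq_pow_p_mul' (p := p) c hc0
  refine ⟨m, ?_⟩
  obtain ⟨u', hu'⟩ := u.isUnit.exists_left_inv
  have h3 := (IsInt.of_witt (E := E) u').mul (b := (((p : WittVector p k) ^ m * u) • z : E)) hc
  have h4 : algebraMap K(p, k) E (algebraMap (WittVector p k) K(p, k) u') *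
      (((p : WittVector p k) ^ m * (u : WittVector p k)) • z) = (p : E) ^ m * z := by
    rw [Algebra.smul_def, IsScalarTower.algebraMap_apply (WittVector p k) K(p, k) E, ← mul_assoc,
      ← map_mul, ← map_mul, mul_left_comm, hu', mul_one]
    simp
  rwa [h4] at h3

/-- If z ≠ 0, some p^m z⁻¹ is integral, and dividing z by p^{m+1} would make p⁻¹ integral over W(k).
This separatedness makes the values of a power series unique. -/
theorem eq_zero_of_forall_pow_mul [Algebra.IsAlgebraic K(p, k) E] {z : E}
    (h : ∀ N : ℕ, ∃ b : E, IsInt p (k := k) b ∧ z = (p : E) ^ N * b) : z = 0 := by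
  by_contra hz
  have hp0 := p_ne_zero p k E
  obtain ⟨m, hm⟩ := exists_pow_mul_isInt (p := p) (k := k) z⁻¹
  obtain ⟨b, hb, hzb⟩ := h (m + 1)
  have h1 := hm.mul hb
  have h2 : (p : E) ^ m * z⁻¹ * b = algebraMap K(p, k) E (p : K(p, k))⁻¹ := by
    have hb' : b = z / (p : E) ^ (m + 1) := by rw [hzb]; field_simp
    rw [hb', map_inv₀, map_natCast, pow_succ]
    field_simp
  rw [h2] at h1
  exact not_exists_witt_inv h1.exists_witt

end Integers

/-! ### Values of convergent power series. -/

section Values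

open PowerSeries

variable {p : ℕ} [Fact p.Prime] {k : Type*} [Field k] [Finite k] [CharP k p]
variable {E : Type*} [Field E] [Algebra K(p, k) E]

theorem HasValue.unique [Algebra.IsAlgebraic K(p, k) E] {f : K(p, k)⟦X⟧} {x y z : E}
    (hy : HasValue p f x y) (hz : HasValue p f x z) : y = z := by
  refine sub_eq_zero.1 (eq_zero_of_forall_pow_mul (p := p) (k := k) fun N => ?_)
  obtain ⟨M, hM⟩ := hy N
  obtain ⟨M', hM'⟩ := hz N
  obtain ⟨b, hb, e⟩ := hM (max M M') (le_max_left _ _)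
  obtain ⟨b', hb', e'⟩ := hM' (max M M') (le_max_right _ _)
  exact ⟨b - b', hb.sub hb', by rw [mul_sub, ← e, ← e']; ring⟩

theorem HasValue.sum {α : Type*} (s : Finset α) {f : α → K(p, k)⟦X⟧} {x : E} {y : α → E}
    (h : ∀ i ∈ s, HasValue p (f i) x (y i)) : HasValue p (∑ i ∈ s, f i) x (∑ i ∈ s, y i) := by
  classical
  induction s using Finset.induction_on with
  | empty => simpa using HasValue.zero x
  | insert a s ha ih =>
    rw [Finset.sum_insert ha, Finset.sum_insert ha]
    exact (h a (Finset.mem_insert_self _ _)).add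
      (ih fun i hi => h i (Finset.mem_insert_of_mem hi))

theorem exists_pow_mul_witt (a : K(p, k)) : ∃ (c : ℕ) (w : WittVector p k),
    algebraMap (WittVector p k) K(p, k) w = (p : K(p, k)) ^ c * a := by
  obtain ⟨m, hm⟩ := exists_pow_mul_isInt (p := p) (k := k) (E := K(p, k)) a
  obtain ⟨w, hw⟩ := IsInt.exists_witt (E := K(p, k)) hm
  exact ⟨m, w, hw⟩

theorem HasValue.const_mul (a : K(p, k)) {f : K(p, k)⟦X⟧} {x y : E} (hf : HasValue p f x y) :
    HasValue p (C a * f) x (algebraMap _ _ a * y) := by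
  intro N
  obtain ⟨c, w, hw⟩ := exists_pow_mul_witt a
  obtain ⟨M, hM⟩ := hf (N + c)
  refine ⟨M, fun L hL => ?_⟩
  obtain ⟨b, hb, e⟩ := hM L hL
  refine ⟨algebraMap K(p, k) E (algebraMap _ _ w) * b, (IsInt.of_witt w).mul hb, ?_⟩
  have h1 : ∑ m ∈ Finset.range L, algebraMap K(p, k) E (coeff m (C a * f)) * x ^ m
      = algebraMap K(p, k) E a *
        ∑ m ∈ Finset.range L, algebraMap K(p, k) E (coeff m f) * x ^ m := by
    rw [Finset.mul_sum]
    refine Finset.sum_congr rfl fun m _ => ?_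
    rw [coeff_C_mul, map_mul, mul_assoc]
  rw [h1, ← mul_sub, e, hw, map_mul, map_pow, map_natCast]
  ring

theorem hasValue_polynomial (P : Polynomial K(p, k)) (x : E) :
    HasValue p (P : K(p, k)⟦X⟧) x (Polynomial.aeval x P) := by
  refine fun N => ⟨P.natDegree + 1, fun M hM => ⟨0, IsInt.zero, ?_⟩⟩
  rw [mul_zero, sub_eq_zero, Polynomial.aeval_eq_sum_range' (Nat.lt_of_succ_le hM)]
  refine Finset.sum_congr rfl fun m _ => ?_
  rw [Polynomial.coeff_coe, Algebra.smul_def]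

theorem IsRig.eventually_small {f : K(p, k)⟦X⟧} (hf : IsRig p f) {x : E}
    (hx : IsInt p (k := k) x) {e : ℕ} (he : 0 < e) {b : E} (hb : IsInt p (k := k) b)
    (hxb : x ^ e = p * b) (N : ℕ) : ∃ M₀, ∀ m ≥ M₀, ∃ z : E, IsInt p (k := k) z ∧
      algebraMap K(p, k) E (coeff m f) * x ^ m = (p : E) ^ N * z := by
  -- With slope 2e the coefficient costs at most p^{c + m/(2e)}, while x^m supplies p^{m/e}; the
  -- surplus tends to infinity with m.
  obtain ⟨c, hc⟩ := hf (2 * e) (by omega)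
  refine ⟨2 * e * (c + N), fun m hm => ?_⟩
  obtain ⟨w, hw⟩ := hc m
  have h1 : c + N ≤ m / (2 * e) := (Nat.le_div_iff_mul_le (by omega)).2 (by rw [mul_comm]; exact hm)
  have h2 : 2 * (m / (2 * e)) ≤ m / e := by
    rw [Nat.le_div_iff_mul_le he]
    calc 2 * (m / (2 * e)) * e = (m / (2 * e)) * (2 * e) := by ring
      _ ≤ m := Nat.div_mul_le_self _ _
  obtain ⟨d, hd⟩ : ∃ d, m / e = c + m / (2 * e) + N + d := ⟨m / e - (c + m / (2 * e) + N), by omega⟩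
  refine ⟨algebraMap K(p, k) E (algebraMap _ _ w) * ((p : E) ^ d * (b ^ (m / e) * x ^ (m % e))),
    (IsInt.of_witt w).mul (((IsInt.natCast p).pow d).mul ((hb.pow _).mul (hx.pow _))), ?_⟩
  have h3 : x ^ m = (p : E) ^ (m / e) * (b ^ (m / e) * x ^ (m % e)) := by
    conv_lhs => rw [← Nat.div_add_mod m e, pow_add, pow_mul, hxb, mul_pow, mul_assoc]
  rw [hw, map_mul, map_pow, map_natCast, h3, hd, pow_add, pow_add]
  ring

theorem IsInt.aeval (Q : Polynomial (WittVector p k)) {x : E} (hx : IsInt p (k := k) x) (M : ℕ) :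
    IsInt p (k := k) (∑ i ∈ Finset.range M,
      algebraMap K(p, k) E (algebraMap _ _ (Q.coeff i)) * x ^ i) :=
  IsInt.sum _ fun _ _ => (IsInt.of_witt _).mul (hx.pow _)

/-- Multiples of a polynomial that vanishes at `x` have the value zero at `x`. -/
theorem hasValue_mul_of_root {f : K(p, k)⟦X⟧} (hf : IsRig p f) {x : E}
    (hx : IsInt p (k := k) x) {e : ℕ} (he : 0 < e) {b : E} (hb : IsInt p (k := k) b)
    (hxb : x ^ e = p * b) (Q : Polynomial (WittVector p k))
    (hQ : Polynomial.aeval x (Q.map (algebraMap (WittVector p k) K(p, k))) = 0) :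
    HasValue p (f * ((Q.map (algebraMap (WittVector p k) K(p, k)) : Polynomial K(p, k)) : K(p, k)⟦X⟧)) x 0 := by
  intro N
  obtain ⟨M₀, hM₀⟩ := hf.eventually_small hx he hb hxb N
  refine ⟨M₀ + (Q.natDegree + 1), fun M hM => ?_⟩
  -- The truncated Cauchy product is grouped by the coefficients of f, so that each one multiplies a
  -- truncation of Q(x).
  have key : ∑ m ∈ Finset.range M, algebraMap K(p, k) E (coeff m
      (f * ((Q.map (algebraMap (WittVector p k) K(p, k)) : Polynomial K(p, k)) : K(p, k)⟦X⟧))) * x ^ m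
      = ∑ l ∈ Finset.range M, (algebraMap K(p, k) E (coeff l f) * x ^ l) *
        ∑ i ∈ Finset.range (M - l), algebraMap K(p, k) E (algebraMap _ _ (Q.coeff i)) * x ^ i := by
    simp_rw [Finset.mul_sum]
    rw [← Finset.sum_range_diag_flip M (fun l i => algebraMap K(p, k) E (coeff l f) * x ^ l *
      (algebraMap K(p, k) E (algebraMap _ _ (Q.coeff i)) * x ^ i))]
    refine Finset.sum_congr rfl fun m _ => ?_
    rw [coeff_mul, Finset.Nat.sum_antidiagonal_eq_sum_range_succ
      (fun i j => coeff i f * coeff j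
        ((Q.map (algebraMap (WittVector p k) K(p, k)) : Polynomial K(p, k)) : K(p, k)⟦X⟧)),
      map_sum, Finset.sum_mul]
    refine Finset.sum_congr rfl fun l hl => ?_
    have hlm : l ≤ m := Nat.lt_succ_iff.1 (Finset.mem_range.1 hl)
    rw [Polynomial.coeff_coe, Polynomial.coeff_map, map_mul,
      show x ^ m = x ^ l * x ^ (m - l) by rw [← pow_add, Nat.add_sub_cancel' hlm]]
    ring
  -- For l < M₀ the truncation contains all of Q and is Q(x) = 0; for l ≥ M₀ the factor from f is
  -- already small.
  have hterm : ∀ l ∈ Finset.range M, ∃ z : E, IsInt p (k := k) z ∧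
      (algebraMap K(p, k) E (coeff l f) * x ^ l) *
        ∑ i ∈ Finset.range (M - l), algebraMap K(p, k) E (algebraMap _ _ (Q.coeff i)) * x ^ i
        = (p : E) ^ N * z := by
    intro l _
    by_cases hl : l < M₀
    · refine ⟨0, IsInt.zero, ?_⟩
      have h1 : ∑ i ∈ Finset.range (M - l),
          algebraMap K(p, k) E (algebraMap _ _ (Q.coeff i)) * x ^ i = 0 := by
        rw [← hQ, Polynomial.aeval_eq_sum_range' (n := M - l)
          (lt_of_le_of_lt (Polynomial.natDegree_map_le) (by omega))]
        refine Finset.sum_congr rfl fun m _ => ?_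
        rw [Polynomial.coeff_map, Algebra.smul_def]
      rw [h1, mul_zero, mul_zero]
    · obtain ⟨z, hz, e'⟩ := hM₀ l (not_lt.1 hl)
      exact ⟨z * _, hz.mul (IsInt.aeval Q hx (M - l)), by rw [e', mul_assoc]⟩
  choose! z hz hze using hterm
  refine ⟨-∑ l ∈ Finset.range M, z l, (IsInt.sum _ hz).neg, ?_⟩
  rw [key, Finset.sum_congr rfl hze, ← Finset.mul_sum]
  ring

end Values

/-! ### The Frobenius of power series. -/

section PhiPS

open PowerSeries

variable (p : ℕ) [Fact p.Prime] {A B : Type*} [CommRing A] [CommRing B]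

theorem phiPS_C (σ : A →+* A) (a : A) : phiPS p σ (C a) = C (σ a) := by
  change (PowerSeries.substAlgHom (hasSubst_phi p A)) (PowerSeries.map σ (C a)) = _
  rw [PowerSeries.map_C]
  exact AlgHom.commutes (PowerSeries.substAlgHom (hasSubst_phi p A)) (σ a)

theorem phiPS_X (σ : A →+* A) : phiPS p σ (X : A⟦X⟧) = (1 + X) ^ p - 1 := by
  change (PowerSeries.substAlgHom (hasSubst_phi p A)) (PowerSeries.map σ X) = _
  rw [PowerSeries.map_X, PowerSeries.coe_substAlgHom, PowerSeries.subst_X (hasSubst_phi p A)]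

theorem phiPS_one_add_X_pow (σ : A →+* A) (m : ℕ) :
    phiPS p σ ((1 + X : A⟦X⟧) ^ m) = (1 + X) ^ (p * m) := by
  rw [map_pow, map_add, map_one, phiPS_X, add_sub_cancel, pow_mul]

theorem phiPS_iterate_C (σ : A →+* A) (a : A) (j : ℕ) :
    (phiPS p σ)^[j] (C a) = C (σ^[j] a) := by
  induction j with
  | zero => rfl
  | succ j ih => rw [Function.iterate_succ_apply', ih, phiPS_C, Function.iterate_succ_apply']

theorem phiPS_iterate_one_add_X_pow (σ : A →+* A) (m j : ℕ) :
    (phiPS p σ)^[j] ((1 + X : A⟦X⟧) ^ m) = (1 + X) ^ (p ^ j * m) := by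
  induction j with
  | zero => simp
  | succ j ih =>
    rw [Function.iterate_succ_apply', ih, phiPS_one_add_X_pow, ← mul_assoc, pow_succ']

theorem phiPS_iterate_X (σ : A →+* A) (j : ℕ) :
    (phiPS p σ)^[j] (X : A⟦X⟧) = (1 + X) ^ p ^ j - 1 := by
  have h := phiPS_iterate_one_add_X_pow p σ 1 j
  rw [mul_one, pow_one, iterate_map_add, iterate_map_one] at h
  rw [← h, add_sub_cancel_left]

theorem coeff_phiPS (σ : A →+* A) (f : A⟦X⟧) (m : ℕ) :
    coeff m (phiPS p σ f) = ∑ l ∈ Finset.range (m + 1),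
      σ (coeff l f) * coeff m (((1 + X : A⟦X⟧) ^ p - 1) ^ l) := by
  change coeff m ((PowerSeries.substAlgHom (hasSubst_phi p A)) (PowerSeries.map σ f)) = _
  rw [PowerSeries.coe_substAlgHom, PowerSeries.coeff_subst' (hasSubst_phi p A)]
  rw [finsum_eq_sum_of_support_subset (s := Finset.range (m + 1))]
  · simp only [PowerSeries.coeff_map, smul_eq_mul]
  · intro l hl
    rw [Finset.coe_range, Set.mem_Iio, Nat.lt_succ_iff]
    by_contra hlt
    apply hl
    have h1 : (X : A⟦X⟧) ^ l ∣ ((1 + X : A⟦X⟧) ^ p - 1) ^ l :=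
      pow_dvd_pow_of_dvd (PowerSeries.X_dvd_iff.2 (by simp)) l
    simp only [smul_eq_mul]
    rw [PowerSeries.X_pow_dvd_iff.1 h1 m (not_le.1 hlt), mul_zero]

theorem map_phiPS (τ : A →+* B) (σ : A →+* A) (σ' : B →+* B) (h : ∀ a, τ (σ a) = σ' (τ a))
    (f : A⟦X⟧) : PowerSeries.map τ (phiPS p σ f) = phiPS p σ' (PowerSeries.map τ f) := by
  ext m
  rw [PowerSeries.coeff_map, coeff_phiPS, coeff_phiPS, map_sum]
  refine Finset.sum_congr rfl fun l _ => ?_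
  have h1 : PowerSeries.map τ (((1 + X : A⟦X⟧) ^ p - 1) ^ l) = ((1 + X) ^ p - 1) ^ l := by simp
  rw [map_mul, h, PowerSeries.coeff_map, ← PowerSeries.coeff_map τ m (_ ^ l), h1]

theorem map_phiPS_iterate (τ : A →+* B) (σ : A →+* A) (σ' : B →+* B)
    (h : ∀ a, τ (σ a) = σ' (τ a)) (j : ℕ) (f : A⟦X⟧) :
    PowerSeries.map τ ((phiPS p σ)^[j] f) = (phiPS p σ')^[j] (PowerSeries.map τ f) := by
  induction j with
  | zero => rfl
  | succ j ih => rw [Function.iterate_succ_apply', Function.iterate_succ_apply', map_phiPS p τ σ σ' h, ih]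

/-- Elements of the `a`-th power of the ideal `(p, X)`. -/
theorem pow_dvd_coeff_mul {f g : A⟦X⟧} {a b : ℕ} (hf : ∀ m, (p : A) ^ (a - m) ∣ coeff m f)
    (hg : ∀ m, (p : A) ^ (b - m) ∣ coeff m g) (m : ℕ) :
    (p : A) ^ (a + b - m) ∣ coeff m (f * g) := by
  rw [coeff_mul]
  refine Finset.dvd_sum fun ⟨i, l⟩ hil => ?_
  have hil' : i + l = m := Finset.HasAntidiagonal.mem_antidiagonal.1 hil
  refine dvd_trans (pow_dvd_pow _ ?_) (pow_add (p : A) (a - i) (b - l) ▸ mul_dvd_mul (hf i) (hg l))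
  omega

/-- The series (1+X)^p - 1 begins with pX, so it lies in (p, X)², and its s-th power lies in (p,
X)^{2s}. This decay is what makes solutions converge in `isRig_of_solution`. -/
theorem pow_dvd_coeff_pow (s m : ℕ) :
    (p : A) ^ (2 * s - m) ∣ coeff m (((1 + X : A⟦X⟧) ^ p - 1) ^ s) := by
  induction s generalizing m with
  | zero => simp
  | succ s ih =>
    rw [pow_succ, mul_add, mul_one]
    refine pow_dvd_coeff_mul p ih (fun i => ?_) m
    match i with
    | 0 => simp
    | 1 =>
      rw [map_sub, show (1 + X : A⟦X⟧) ^ p = ((1 + Polynomial.X : Polynomial A) ^ p : Polynomial A) by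
        simp, Polynomial.coeff_coe, Polynomial.coeff_one_add_X_pow]
      simp [PowerSeries.coeff_one]
    | i + 2 => simp

/-- Write (1+X)^p - 1 = Xu with u(0) = p. These are the diagonal entries of φ in degree m, so the
equation (1 - φ)f = g has the operator 1 - p^m φ on its diagonal. -/
theorem coeff_pow_self (m : ℕ) :
    coeff m (((1 + X : A⟦X⟧) ^ p - 1) ^ m) = (p : A) ^ m := by
  obtain ⟨u, hu⟩ : (X : A⟦X⟧) ∣ (1 + X : A⟦X⟧) ^ p - 1 := PowerSeries.X_dvd_iff.2 (by simp)
  have h1 : constantCoeff u = (p : A) := by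
    have h2 : coeff 1 ((1 + X : A⟦X⟧) ^ p - 1) = (p : A) := by
      rw [map_sub, show (1 + X : A⟦X⟧) ^ p = ((1 + Polynomial.X : Polynomial A) ^ p : Polynomial A) by
        simp, Polynomial.coeff_coe, Polynomial.coeff_one_add_X_pow]
      simp [PowerSeries.coeff_one]
    rw [← h2, hu, ← zero_add 1, PowerSeries.coeff_succ_X_mul, PowerSeries.coeff_zero_eq_constantCoeff]
  rw [hu, mul_pow]
  have := PowerSeries.coeff_X_pow_mul (u ^ m) m 0
  rw [zero_add] at this
  rw [this, PowerSeries.coeff_zero_eq_constantCoeff, map_pow, h1]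

end PhiPS

/-! ### Stability of integrality and convergence under Frobenius. -/

section Frob

variable {p : ℕ} [Fact p.Prime] {k : Type*} [Field k] [Finite k] [CharP k p]

theorem frobenius_algebraMap (w : WittVector p k) :
    φ(p, k) (algebraMap (WittVector p k) K(p, k) w)
      = algebraMap (WittVector p k) K(p, k) (WittVector.frobenius w) :=
  IsFractionRing.ringEquivOfRingEquiv_algebraMap _ _

theorem frobenius_symm_algebraMap (w : WittVector p k) :
    (FractionRing.frobenius p k).symm (algebraMap (WittVector p k) K(p, k) w)
      = algebraMap (WittVector p k) K(p, k) ((WittVector.frobeniusEquiv p k).symm w) := by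
  rw [RingEquiv.symm_apply_eq]
  refine ((frobenius_algebraMap _).trans ?_).symm
  congr 1
  exact (WittVector.frobeniusEquiv p k).apply_symm_apply w

/-- The ring of integers of `K(p, k)`. -/
noncomputable abbrev wittRange (p : ℕ) [Fact p.Prime] (k : Type*) [Field k] [CharP k p] : Subring K(p, k) :=
  (algebraMap (WittVector p k) K(p, k)).range

theorem frobenius_mem_wittRange {a : K(p, k)} (h : a ∈ wittRange p k) :
    φ(p, k) a ∈ wittRange p k := by
  obtain ⟨w, rfl⟩ := h
  exact ⟨_, (frobenius_algebraMap w).symm⟩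

theorem frobenius_symm_mem_wittRange {a : K(p, k)} (h : a ∈ wittRange p k) :
    (FractionRing.frobenius p k).symm a ∈ wittRange p k := by
  obtain ⟨w, rfl⟩ := h
  exact ⟨_, (frobenius_symm_algebraMap w).symm⟩

theorem pow_mul_mem_wittRange_of_le {a : K(p, k)} {c d : ℕ} (hcd : c ≤ d)
    (h : (p : K(p, k)) ^ c * a ∈ wittRange p k) : (p : K(p, k)) ^ d * a ∈ wittRange p k := by
  obtain ⟨i, rfl⟩ := Nat.exists_eq_add_of_le hcd
  rw [pow_add, mul_comm (_ ^ c), mul_assoc]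
  exact mul_mem (pow_mem (natCast_mem _ p) i) h

open PowerSeries

theorem IsRig.of_witt (f : (WittVector p k)⟦X⟧) :
    IsRig p (PowerSeries.map (algebraMap (WittVector p k) K(p, k)) f) := fun j _ =>
  ⟨0, fun m => ⟨p ^ (0 + m / j) * coeff m f, by simp⟩⟩

theorem coeff_phi_pow_mem (m s : ℕ) :
    coeff m (((1 + X : K(p, k)⟦X⟧) ^ p - 1) ^ s) ∈ wittRange p k := by
  refine ⟨coeff m (((1 + X : (WittVector p k)⟦X⟧) ^ p - 1) ^ s), ?_⟩
  rw [← PowerSeries.coeff_map]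
  simp

theorem IsRig.phiPS {f : K(p, k)⟦X⟧} (hf : IsRig p f) : IsRig p (phiPS p φ(p, k) f) := by
  intro j hj
  obtain ⟨c, hc⟩ := hf j hj
  refine ⟨c, fun m => ?_⟩
  change _ ∈ wittRange p k
  rw [coeff_phiPS, Finset.mul_sum]
  refine Subring.sum_mem _ fun l hl => ?_
  rw [← mul_assoc]
  refine mul_mem ?_ (coeff_phi_pow_mem m l)
  have h1 := frobenius_mem_wittRange (hc l)
  rw [map_mul, map_pow, map_natCast] at h1
  refine pow_mul_mem_wittRange_of_le ?_ h1
  have := Nat.div_le_div_right (c := j) (Nat.lt_succ_iff.1 (Finset.mem_range.1 hl))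
  omega

theorem IsRig.phiPS_iterate {f : K(p, k)⟦X⟧} (hf : IsRig p f) (n : ℕ) :
    IsRig p ((Crystalline.phiPS p φ(p, k))^[n] f) := by
  induction n with
  | zero => exact hf
  | succ n ih => rw [Function.iterate_succ_apply']; exact ih.phiPS

theorem IsRig.map_symm {f : K(p, k)⟦X⟧} (hf : IsRig p f) :
    IsRig p (PowerSeries.map ((FractionRing.frobenius p k).symm : K(p, k) →+* K(p, k)) f) := by
  intro j hj
  obtain ⟨c, hc⟩ := hf j hj
  refine ⟨c, fun m => ?_⟩
  have h1 := frobenius_symm_mem_wittRange (hc m)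
  rw [map_mul, map_pow, map_natCast] at h1
  rw [PowerSeries.coeff_map]
  exact h1

theorem IsRig.exists_eq_C_add {f : K(p, k)⟦X⟧} (hf : IsRig p f) :
    ∃ h, IsRig p h ∧ f = C (constantCoeff f) + h * X := by
  refine ⟨PowerSeries.mk fun m => coeff (m + 1) f, fun j hj => ?_, ?_⟩
  · obtain ⟨c, hc⟩ := hf j hj
    -- Shifting the index by one can raise the quotient m / j by at most one.
    refine ⟨c + 1, fun m => ?_⟩
    rw [PowerSeries.coeff_mk]
    refine pow_mul_mem_wittRange_of_le ?_ (hc (m + 1))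
    have : (m + 1) / j ≤ (m + j) / j := Nat.div_le_div_right (by omega)
    rw [Nat.add_div_right _ hj] at this
    omega
  · rw [add_comm, mul_comm]
    exact PowerSeries.eq_X_mul_shift_add_const f

end Frob

/-! ### Division by (1+X)^{p^m} - 1. -/

section Weierstrass

open PowerSeries

variable {p : ℕ} [Fact p.Prime] {k : Type*} [Field k] [Finite k] [CharP k p]

/-- Substituting X - 1 and back does not raise the degree. Powers of 1 + X are preferred because
they become powers of ζ at ζ - 1. -/
theorem exists_polynomial_eq_sum {R : Type*} [CommRing R] (P : Polynomial R) {N : ℕ}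
    (h : P.degree < N) : ∃ r : ℕ → R,
      P = ∑ b ∈ Finset.range N, Polynomial.C (r b) * (1 + Polynomial.X) ^ b := by
  nontriviality R
  set P' := P.comp (Polynomial.X - 1) with hP'
  have hd : P'.natDegree < N ∨ P' = 0 := by
    by_cases h0 : P = 0
    · right; simp [hP', h0]
    · left
      have h1 : P.natDegree < N := (Polynomial.natDegree_lt_iff_degree_lt h0).2 h
      refine lt_of_le_of_lt (Polynomial.natDegree_comp_le) ?_
      rwa [← Polynomial.C_1, Polynomial.natDegree_X_sub_C, mul_one]
  have hs : P' = ∑ b ∈ Finset.range N, Polynomial.C (P'.coeff b) * Polynomial.X ^ b := by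
    rcases hd with hd | hd
    · exact P'.as_sum_range_C_mul_X_pow' hd
    · simp [hd]
  refine ⟨P'.coeff, ?_⟩
  have h2 : P'.comp (1 + Polynomial.X) = P := by
    rw [hP', Polynomial.comp_assoc]
    simp
  conv_lhs => rw [← h2, hs]
  simp [Polynomial.sum_comp]

/-- Modulo p the divisor is X^{p^m}, so Weierstrass division over the complete ring W(k) leaves a
remainder of degree less than p^m. -/
theorem exists_weierstrass (c : (WittVector p k)⟦X⟧) (m : ℕ) :
    ∃ (h : (WittVector p k)⟦X⟧) (r : ℕ → WittVector p k),
      c = h * ((1 + X) ^ p ^ m - 1) + ∑ b ∈ Finset.range (p ^ m), C (r b) * (1 + X) ^ b := by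
  set Q : (WittVector p k)⟦X⟧ := (1 + X) ^ p ^ m - 1 with hQ
  set I := Ideal.span {(p : WittVector p k)} with hI
  have hp1 : I ≠ ⊤ := by
    rw [hI, Ne, Ideal.span_singleton_eq_top]
    exact fun h => WittVector.irreducible p |>.not_isUnit h
  have hnt : Nontrivial (WittVector p k ⧸ I) := Ideal.Quotient.nontrivial_iff.2 hp1
  have hpm : 0 < p ^ m := pow_pos (Fact.out : p.Prime).pos m
  have hmap : Q.map (Ideal.Quotient.mk I) = X ^ p ^ m := by
    obtain ⟨r, hr⟩ := exists_add_pow_prime_pow_eq (Fact.out : p.Prime) (1 : (WittVector p k)⟦X⟧) X m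
    have hp0 : Ideal.Quotient.mk I (p : WittVector p k) = 0 :=
      Ideal.Quotient.eq_zero_iff_mem.2 (Ideal.mem_span_singleton_self _)
    have hp0' : (p : (WittVector p k ⧸ I)⟦X⟧) = 0 := by
      rw [← map_natCast (C (R := WittVector p k ⧸ I)), ← map_natCast (Ideal.Quotient.mk I), hp0,
        map_zero]
    rw [hQ, hr]
    simp [hp0']
  have hord : (Q.map (Ideal.Quotient.mk I)).order.toNat = p ^ m := by
    rw [hmap, PowerSeries.order_X_pow, ENat.toNat_natCast]
  have hdivr : Q.IsWeierstrassDivisorAt I := by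
    rw [PowerSeries.IsWeierstrassDivisorAt, hord, hQ, map_sub,
      show (1 + X : (WittVector p k)⟦X⟧) ^ p ^ m
        = ((1 + Polynomial.X : Polynomial (WittVector p k)) ^ p ^ m :
          Polynomial (WittVector p k)) by simp,
      Polynomial.coeff_coe, Polynomial.coeff_one_add_X_pow]
    rw [Nat.choose_self, PowerSeries.coeff_one, if_neg hpm.ne']
    simp
  have hW := hdivr.isWeierstrassDivisionAt_div_mod c
  have hdeg := hW.degree_lt
  rw [hord] at hdeg
  obtain ⟨r, hr⟩ := exists_polynomial_eq_sum _ hdeg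
  refine ⟨hdivr.div c, r, ?_⟩
  rw [mul_comm]
  conv_lhs => rw [hW.eq_mul_add, hr]
  congr 1
  rw [← Polynomial.coeToPowerSeries.ringHom_apply, map_sum]
  simp

end Weierstrass

/-! ### Evaluation at ζ - 1. -/

section Evaluate

open PowerSeries

variable {p : ℕ} [Fact p.Prime] {k : Type*} [Field k] [Finite k] [CharP k p]
variable {E : Type*} [Field E] [Algebra K(p, k) E] {n : ℕ} {ζ : E}

/-- Modulo p, (ζ-1)^{p^n} agrees with ζ^{p^n} - 1 = 0. This is the topological nilpotence of ζ - 1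
that evaluation requires. -/
theorem exists_sub_one_pow_eq (hζ : ζ ^ p ^ n = 1) :
    ∃ b : E, IsInt p (k := k) b ∧ (ζ - 1) ^ p ^ n = p * b := by
  have hint : IsInt p (k := k) ζ := IsInt.of_pow_eq_one (pow_pos (Fact.out : p.Prime).pos n) hζ
  obtain ⟨r, hr⟩ := exists_add_pow_prime_pow_eq (Fact.out : p.Prime) (1 : Polynomial ℤ)
    (Polynomial.X - 1) n
  have h1 := congrArg (Polynomial.aeval ζ) hr
  simp only [add_sub_cancel, map_pow, Polynomial.aeval_X, one_pow, mul_one, map_add, map_one,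
    map_sub, map_mul, map_natCast, hζ] at h1
  refine ⟨-((ζ - 1) * Polynomial.aeval ζ r), ((hint.sub IsInt.one).mul ?_).neg, ?_⟩
  · rw [Polynomial.aeval_eq_sum_range]
    refine IsInt.sum _ fun i _ => ?_
    rw [Algebra.smul_def]
    refine IsInt.mul ?_ (hint.pow i)
    simpa using IsInt.of_witt (E := E) (r.coeff i : WittVector p k)
  · linear_combination -h1

/-- The value at `ζ - 1` of a series that is a combination of powers of `1 + X` modulo
`(1 + X) ^ p ^ n - 1`. -/
theorem hasValue_of_eq (hζ : ζ ^ p ^ n = 1) {α : Type*} {s : Finset α} {f h : K(p, k)⟦X⟧}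
    (hh : IsRig p h) {a : α → K(p, k)} {e : α → ℕ}
    (hf : f = h * ((1 + X) ^ p ^ n - 1) + ∑ i ∈ s, C (a i) * (1 + X) ^ e i) :
    HasValue p f (ζ - 1) (∑ i ∈ s, algebraMap K(p, k) E (a i) * ζ ^ e i) := by
  have hpos := pow_pos (Fact.out : p.Prime).pos n
  have hint : IsInt p (k := k) ζ := IsInt.of_pow_eq_one hpos hζ
  obtain ⟨b, hb, hxb⟩ := exists_sub_one_pow_eq (k := k) hζ
  have h1 := hasValue_mul_of_root hh (hint.sub IsInt.one) hpos hb hxb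
    ((1 + Polynomial.X) ^ p ^ n - 1) (by simp [hζ])
  have h2 := HasValue.sum (p := p) (x := ζ - 1) s fun i _ =>
    hasValue_polynomial (Polynomial.C (a i) * (1 + Polynomial.X) ^ e i) (ζ - 1)
  have h3 := h1.add h2
  simp only [zero_add] at h3
  convert h3 using 1
  · rw [hf]; simp
  · simp

/-- Write f = f(0) + hX. Then φ^n(hX) is a multiple of φ^n(X) = (1+X)^{p^n} - 1, which is zero at ζ
- 1, and only the constant term survives. -/
theorem hasValue_phi_iterate (hζ : ζ ^ p ^ n = 1) {f : K(p, k)⟦X⟧} (hf : IsRig p f) :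
    HasValue p ((phiPS p φ(p, k))^[n] f) (ζ - 1)
      (algebraMap K(p, k) E (φ(p, k)^[n] (constantCoeff f))) := by
  obtain ⟨h, hh, hfh⟩ := hf.exists_eq_C_add
  have h1 := hasValue_of_eq (s := {()}) hζ (hh.phiPS_iterate n)
    (a := fun _ => φ(p, k)^[n] (constantCoeff f)) (e := fun _ => 0) (f := (phiPS p φ(p, k))^[n] f)
    (by
      conv_lhs => rw [hfh]
      rw [iterate_map_add, iterate_map_mul, phiPS_iterate_X, phiPS_iterate_C]
      simp [add_comm])
  simpa using h1

/-- Since ψ(g) = 0, g = ∑_{0<i<p} (1+X)^i φ(c_i), and the range of i starts at 1. Each c_i matters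
only modulo a series whose image under φ^{j+1} vanishes at ζ - 1. -/
theorem exists_hasValue_of_isPsi (hζ : ζ ^ p ^ n = 1) {g : (WittVector p k)⟦X⟧} (hg : IsPsi p g 0)
    {j : ℕ} (hj : j < n) : ∃ r : ℕ → ℕ → WittVector p k,
      HasValue p ((phiPS p φ(p, k))^[j] (PowerSeries.map (algebraMap (WittVector p k) K(p, k)) g))
        (ζ - 1) (∑ i ∈ Finset.Ico 1 p, ∑ b ∈ Finset.range (p ^ (n - 1 - j)),
          algebraMap K(p, k) E (algebraMap _ _ (r i b)) * ζ ^ (p ^ j * (i + p * b))) := by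
  obtain ⟨c, hc0, hc⟩ := hg
  -- The exponent n - 1 - j is chosen so that φ^{j+1} carries the divisor to (1+X)^{p^n} - 1.
  choose h r hcr using fun i => exists_weierstrass (c i) (n - 1 - j)
  refine ⟨fun i b => WittVector.frobenius^[j + 1] (r i b), ?_⟩
  have hpn : p ^ (j + 1) * p ^ (n - 1 - j) = p ^ n := by
    rw [← pow_add]; congr 1; omega
  have h1 : (phiPS p φ(p, k))^[j] (PowerSeries.map (algebraMap (WittVector p k) K(p, k)) g)
      = ∑ i ∈ Finset.Ico 1 p, PowerSeries.map (algebraMap (WittVector p k) K(p, k))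
        ((1 + X) ^ (p ^ j * i) * (phiPS p WittVector.frobenius)^[j + 1] (c i)) := by
    rw [← map_phiPS_iterate p _ WittVector.frobenius _ (fun a => (frobenius_algebraMap a).symm),
      ← map_sum]
    congr 1
    rw [hc, Finset.range_eq_Ico, Finset.sum_eq_sum_Ico_succ_bot (Fact.out : p.Prime).pos, hc0,
      map_zero, mul_zero, zero_add, ← RingHom.coe_pow, map_sum]
    refine Finset.sum_congr rfl fun i _ => ?_
    rw [map_mul, RingHom.coe_pow, phiPS_iterate_one_add_X_pow, Function.iterate_succ_apply]
  rw [h1]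
  refine HasValue.sum _ fun i _ => ?_
  refine hasValue_of_eq (n := n) hζ (IsRig.of_witt
    ((1 + X) ^ (p ^ j * i) * (phiPS p WittVector.frobenius)^[j + 1] (h i)))
    (a := fun b => algebraMap (WittVector p k) K(p, k) (WittVector.frobenius^[j + 1] (r i b)))
    (e := fun b => p ^ j * (i + p * b)) ?_
  conv_lhs => rw [hcr i]
  have h2 : (phiPS p WittVector.frobenius)^[j + 1] (h i * ((1 + X) ^ p ^ (n - 1 - j) - 1) +
      ∑ b ∈ Finset.range (p ^ (n - 1 - j)), C (r i b) * (1 + X) ^ b)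
      = (phiPS p WittVector.frobenius)^[j + 1] (h i) * ((1 + X) ^ p ^ n - 1) +
        ∑ b ∈ Finset.range (p ^ (n - 1 - j)), C (WittVector.frobenius^[j + 1] (r i b)) *
          (1 + X) ^ (p ^ (j + 1) * b) := by
    rw [← RingHom.coe_pow, map_add, map_mul, map_sub, map_one, map_sum, RingHom.coe_pow,
      phiPS_iterate_one_add_X_pow, hpn]
    congr 1
    refine Finset.sum_congr rfl fun b _ => ?_
    rw [iterate_map_mul, phiPS_iterate_C, phiPS_iterate_one_add_X_pow]
  rw [h2, mul_add, map_add, Finset.mul_sum, map_sum, ← mul_assoc, map_mul]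
  congr 1
  · simp
  · refine Finset.sum_congr rfl fun b _ => ?_
    simp only [map_mul, map_pow, map_add, map_one, PowerSeries.map_X, PowerSeries.map_C]
    ring

end Evaluate

/-! ### Semilinear operators in coordinates and the iterated equation. -/

section Semilinear

open PowerSeries

variable {p : ℕ} [Fact p.Prime] {k : Type*} [Field k] [Finite k] [CharP k p]
variable {ι : Type*} [Fintype ι]

/-- The semilinear operator with matrix `B`, on vectors. -/
noncomputable def semi (B : ι → ι → K(p, k)) (u : ι → K(p, k)) : ι → K(p, k) :=
  fun i => ∑ l, B i l * φ(p, k) (u l)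

/-- The semilinear operator with matrix `B`, on vectors of power series. -/
noncomputable def semiPS (B : ι → ι → K(p, k)) (f : ι → K(p, k)⟦X⟧) : ι → K(p, k)⟦X⟧ :=
  fun i => ∑ l, C (B i l) * phiPS p φ(p, k) (f l)

open Classical in
/-- The matrix of the `j`-th iterate of the semilinear operator with matrix `B`. -/
noncomputable def iterMatrix (B : ι → ι → K(p, k)) (j : ℕ) : ι → ι → K(p, k) :=
  fun i l => (semi B)^[j] (Pi.single l 1) i

theorem semi_add (B : ι → ι → K(p, k)) (u v : ι → K(p, k)) :
    semi B (u + v) = semi B u + semi B v := by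
  ext i
  simp [semi, mul_add, Finset.sum_add_distrib]

theorem semi_smul (B : ι → ι → K(p, k)) (a : K(p, k)) (u : ι → K(p, k)) :
    semi B (a • u) = φ(p, k) a • semi B u := by
  ext i
  simp [semi, Finset.mul_sum, mul_left_comm]

theorem semi_iterate_apply (B : ι → ι → K(p, k)) (j : ℕ) (u : ι → K(p, k)) (i : ι) :
    (semi B)^[j] u i = ∑ l, iterMatrix B j i l * φ(p, k)^[j] (u l) := by
  induction j generalizing i with
  | zero =>
    classical
    simp [iterMatrix, Pi.single_apply]
  | succ j ih =>
    rw [Function.iterate_succ_apply']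
    simp only [semi, ih, map_sum, map_mul, Finset.mul_sum]
    rw [Finset.sum_comm]
    refine Finset.sum_congr rfl fun l _ => ?_
    simp only [iterMatrix, Function.iterate_succ_apply']
    simp only [semi, Finset.sum_mul, mul_assoc]

theorem iterMatrix_succ (B : ι → ι → K(p, k)) (j : ℕ) (i l : ι) :
    iterMatrix B (j + 1) i l = ∑ m, B i m * φ(p, k) (iterMatrix B j m l) := by
  simp only [iterMatrix, Function.iterate_succ_apply']
  rfl

theorem semiPS_add (B : ι → ι → K(p, k)) (f g : ι → K(p, k)⟦X⟧) :
    semiPS B (f + g) = semiPS B f + semiPS B g := by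
  ext1 i
  simp [semiPS, mul_add, Finset.sum_add_distrib]

theorem semiPS_iterate_apply (B : ι → ι → K(p, k)) (j : ℕ) (f : ι → K(p, k)⟦X⟧) (i : ι) :
    (semiPS B)^[j] f i = ∑ l, C (iterMatrix B j i l) * (phiPS p φ(p, k))^[j] (f l) := by
  induction j generalizing i with
  | zero =>
    classical
    simp [iterMatrix, Pi.single_apply]
  | succ j ih =>
    rw [Function.iterate_succ_apply']
    simp only [semiPS, ih, map_sum, map_mul, Finset.mul_sum, phiPS_C]
    rw [Finset.sum_comm]
    refine Finset.sum_congr rfl fun l _ => ?_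
    rw [iterMatrix_succ, map_sum, Finset.sum_mul]
    refine Finset.sum_congr rfl fun m _ => ?_
    rw [map_mul, Function.iterate_succ_apply', mul_assoc]

/-- The truncated geometric series for (1 - φ)⁻¹; the remainder φ^n f is kept, so no convergence is
involved. -/
theorem eq_sum_iterate_add {B : ι → ι → K(p, k)} {f g : ι → K(p, k)⟦X⟧}
    (h : ∀ i, f i - semiPS B f i = g i) (n : ℕ) :
    f = ∑ j ∈ Finset.range n, (semiPS B)^[j] g + (semiPS B)^[n] f := by
  have h' : f = g + semiPS B f := by
    ext1 i
    rw [Pi.add_apply, ← h i, sub_add_cancel]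
  have hit : ∀ n, ∀ a b : ι → K(p, k)⟦X⟧, (semiPS B)^[n] (a + b) =
      (semiPS B)^[n] a + (semiPS B)^[n] b := by
    intro n
    induction n with
    | zero => intros; rfl
    | succ n ih => intro a b; rw [Function.iterate_succ_apply, semiPS_add, ih]; rfl
  induction n with
  | zero => simp
  | succ n ih =>
    rw [Finset.sum_range_succ, add_assoc, Function.iterate_succ_apply, ← hit, ← h']
    exact ih

variable {E : Type*} [Field E] [Algebra K(p, k) E] {n : ℕ} {ζ : E}

/-- The map `σ ^ (- n)` on `K(p, k)`. -/
noncomputable abbrev frobInvPow (p : ℕ) [Fact p.Prime] (k : Type*) [Field k] [Finite k] [CharP k p]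
    (n : ℕ) : K(p, k) →+* K(p, k) :=
  ((FractionRing.frobenius p k).symm : K(p, k) →+* K(p, k)) ^ n

theorem frobInvPow_comm (n : ℕ) (a : K(p, k)) :
    frobInvPow p k n (φ(p, k) a) = φ(p, k) (frobInvPow p k n a) := by
  have h1 : Function.Commute ((FractionRing.frobenius p k).symm) (φ(p, k)) := fun a => by
    change (FractionRing.frobenius p k).symm (FractionRing.frobenius p k a)
      = FractionRing.frobenius p k ((FractionRing.frobenius p k).symm a)
    simp
  rw [RingHom.coe_pow]
  exact (h1.iterate_left n) a

theorem frobenius_iterate_frobInvPow (n : ℕ) (a : K(p, k)) :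
    φ(p, k)^[n] (frobInvPow p k n a) = a := by
  rw [RingHom.coe_pow]
  exact (Function.RightInverse.iterate (f := φ(p, k))
    (g := ((FractionRing.frobenius p k).symm)) (fun a =>
      (FractionRing.frobenius p k).apply_symm_apply a) n) a

theorem frobInvPow_mem {a : K(p, k)} (n : ℕ) (h : a ∈ wittRange p k) :
    frobInvPow p k n a ∈ wittRange p k := by
  rw [RingHom.coe_pow]
  induction n with
  | zero => exact h
  | succ n ih => rw [Function.iterate_succ_apply']; exact frobenius_symm_mem_wittRange ih

theorem IsRig.map_frobInvPow {f : K(p, k)⟦X⟧} (hf : IsRig p f) (n : ℕ) :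
    IsRig p (PowerSeries.map (frobInvPow p k n) f) := by
  induction n with
  | zero =>
    have : frobInvPow p k 0 = RingHom.id _ := pow_zero _
    rw [this, PowerSeries.map_id]
    exact hf
  | succ n ih =>
    have : frobInvPow p k (n + 1) =
      ((FractionRing.frobenius p k).symm : K(p, k) →+* K(p, k)).comp (frobInvPow p k n) :=
      pow_succ' _ _
    rw [this, PowerSeries.map_comp]
    exact ih.map_symm

/-- The truncated series is evaluated term by term. In the last sum the twist σ^{-n} cancels against
φ^n on the constant terms, which therefore appear untwisted. -/
theorem hasValue_solution (hζ : ζ ^ p ^ n = 1) {B : ι → ι → K(p, k)} {f g : ι → K(p, k)⟦X⟧}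
    (hf : ∀ i, IsRig p (f i)) (h : ∀ i, f i - semiPS B f i = g i) {w : ℕ → ι → E}
    (hw : ∀ j < n, ∀ l, HasValue p
      ((phiPS p φ(p, k))^[j] (PowerSeries.map (frobInvPow p k n) (g l))) (ζ - 1) (w j l)) (i : ι) :
    HasValue p (PowerSeries.map (frobInvPow p k n) (f i)) (ζ - 1)
      (∑ j ∈ Finset.range n, ∑ l, algebraMap K(p, k) E (frobInvPow p k n (iterMatrix B j i l)) * w j l
        + ∑ l, algebraMap K(p, k) E (frobInvPow p k n (iterMatrix B n i l)) *
          algebraMap K(p, k) E (constantCoeff (f l))) := by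
  have h1 := congrFun (eq_sum_iterate_add h n) i
  rw [Pi.add_apply, Finset.sum_apply] at h1
  simp only [semiPS_iterate_apply] at h1
  rw [h1, map_add, map_sum]
  simp only [map_sum, map_mul, PowerSeries.map_C,
    map_phiPS_iterate p (frobInvPow p k n) _ _ (frobInvPow_comm n)]
  refine HasValue.add (HasValue.sum _ fun j hj => HasValue.sum _ fun l _ => ?_)
    (HasValue.sum _ fun l _ => ?_)
  · exact (hw j (Finset.mem_range.1 hj) l).const_mul _
  · refine HasValue.const_mul _ ?_
    have h2 := hasValue_phi_iterate hζ ((hf l).map_frobInvPow n)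
    rw [← PowerSeries.coeff_zero_eq_constantCoeff_apply, PowerSeries.coeff_map,
      frobenius_iterate_frobInvPow] at h2
    simpa using h2

end Semilinear

/-! ### Existence and convergence of solutions of (1 - φ)f = g. -/

section Solve

open PowerSeries

variable {p : ℕ} [Fact p.Prime] {k : Type*} [Field k] [Finite k] [CharP k p]
variable {ι : Type*} [Fintype ι]

/-- The coefficient of `X ^ m` in `((1 + X) ^ p - 1) ^ s`. -/
noncomputable abbrev phiCoeff (p : ℕ) [Fact p.Prime] (k : Type*) [Field k] [CharP k p]
    (m s : ℕ) : K(p, k) :=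
  coeff m (((1 + X : K(p, k)⟦X⟧) ^ p - 1) ^ s)

theorem coeff_semiPS (B : ι → ι → K(p, k)) (f : ι → K(p, k)⟦X⟧) (m : ℕ) (i : ι) :
    coeff m (semiPS B f i) = ∑ s ∈ Finset.range (m + 1),
      phiCoeff p k m s * semi B (fun l => coeff s (f l)) i := by
  simp only [semiPS, map_sum, coeff_C_mul, coeff_phiPS, Finset.mul_sum, semi]
  rw [Finset.sum_comm]
  refine Finset.sum_congr rfl fun s _ => Finset.sum_congr rfl fun l _ => ?_
  ring

/-- The coefficients of the solution of `f - φ f = g`, for a right inverse `S m` of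
`1 - p ^ m φ`. -/
noncomputable def solveCoeff (B : ι → ι → K(p, k)) (S : ℕ → (ι → K(p, k)) → (ι → K(p, k)))
    (g : ℕ → ι → K(p, k)) : ℕ → (ι → K(p, k))
  | m => S m (g m + ∑ s : Fin m, phiCoeff p k m s • semi B (solveCoeff B S g s))
termination_by m => m
decreasing_by exact s.2

/-- The system for the coefficients is triangular: in degree m the unknown enters through 1 - p^m φ
by `coeff_pow_self`, and the other terms involve lower degrees only. -/
theorem exists_solution {B : ι → ι → K(p, k)}
    (hB : ∀ (m : ℕ) (y : ι → K(p, k)), ∃ u, u - (p : K(p, k)) ^ m • semi B u = y)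
    (g : ι → K(p, k)⟦X⟧) : ∃ f : ι → K(p, k)⟦X⟧, ∀ i, f i - semiPS B f i = g i := by
  choose S hS using hB
  let F := solveCoeff B S (fun m i => coeff m (g i))
  have hF : ∀ m, F m - (p : K(p, k)) ^ m • semi B (F m) = (fun i => coeff m (g i)) +
      ∑ s ∈ Finset.range m, phiCoeff p k m s • semi B (F s) := by
    intro m
    have h1 : F m = S m ((fun i => coeff m (g i)) +
        ∑ s ∈ Finset.range m, phiCoeff p k m s • semi B (F s)) := by
      rw [Finset.sum_range]
      change solveCoeff B S (fun m i => coeff m (g i)) m = _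
      rw [solveCoeff]
    rw [h1]
    exact hS _ _
  refine ⟨fun i => PowerSeries.mk fun m => F m i, fun i => ?_⟩
  ext m
  rw [map_sub, coeff_semiPS, Finset.sum_range_succ]
  simp only [PowerSeries.coeff_mk]
  have h2 := congrFun (hF m) i
  simp only [Pi.sub_apply, Pi.add_apply, Pi.smul_apply, smul_eq_mul, Finset.sum_apply] at h2
  rw [phiCoeff, coeff_pow_self]
  have h3 : ∀ s, (fun l => F s l) = F s := fun _ => rfl
  simp only [h3]
  linear_combination h2

theorem exists_pow_mul_mem (a : K(p, k)) : ∃ c : ℕ, (p : K(p, k)) ^ c * a ∈ wittRange p k := by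
  obtain ⟨c, w, hw⟩ := exists_pow_mul_witt a
  exact ⟨c, w, hw⟩

theorem exists_pow_mul_mem_forall {α : Type*} [Finite α] (a : α → K(p, k)) :
    ∃ c : ℕ, ∀ i, (p : K(p, k)) ^ c * a i ∈ wittRange p k := by
  have := Fintype.ofFinite α
  choose c hc using fun i => exists_pow_mul_mem (a i)
  exact ⟨∑ i, c i, fun i => pow_mul_mem_wittRange_of_le
    (Finset.single_le_sum (fun _ _ => Nat.zero_le _) (Finset.mem_univ i)) (hc i)⟩

theorem semi_mem {B : ι → ι → K(p, k)} {c : ℕ}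
    (hc : ∀ i l, (p : K(p, k)) ^ c * B i l ∈ wittRange p k) {u : ι → K(p, k)} {a : ℕ}
    (hu : ∀ i, (p : K(p, k)) ^ a * u i ∈ wittRange p k) (i : ι) :
    (p : K(p, k)) ^ (c + a) * semi B u i ∈ wittRange p k := by
  rw [semi, Finset.mul_sum]
  refine Subring.sum_mem _ fun l _ => ?_
  have h1 := mul_mem (hc i l) (frobenius_mem_wittRange (hu l))
  rw [map_mul, map_pow, map_natCast] at h1
  convert h1 using 1
  ring

/-- `1 - p ^ m φ` does not increase denominators if `m` is large. -/
theorem mem_of_sub_semi_mem {B : ι → ι → K(p, k)} {c : ℕ}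
    (hc : ∀ i l, (p : K(p, k)) ^ c * B i l ∈ wittRange p k) {m : ℕ} (hm : c < m)
    {u y : ι → K(p, k)} (h : u - (p : K(p, k)) ^ m • semi B u = y) {M : ℕ}
    (hy : ∀ i, (p : K(p, k)) ^ M * y i ∈ wittRange p k) (i : ι) :
    (p : K(p, k)) ^ M * u i ∈ wittRange p k := by
  obtain ⟨a₀, ha₀⟩ := exists_pow_mul_mem_forall u
  -- In u = y + p^m φ(u) the operator φ costs p^c with c < m. Each substitution thus removes at
  -- least one power of p from any excess denominator.
  have key : ∀ a, (∀ i, (p : K(p, k)) ^ (M + a) * u i ∈ wittRange p k) →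
      ∀ i, (p : K(p, k)) ^ M * u i ∈ wittRange p k := by
    intro a
    induction a with
    | zero => exact id
    | succ a ih =>
      intro ha
      refine ih fun i => ?_
      have h1 := congrFun h i
      rw [Pi.sub_apply, Pi.smul_apply, smul_eq_mul, sub_eq_iff_eq_add] at h1
      rw [h1, mul_add]
      refine add_mem (pow_mul_mem_wittRange_of_le (Nat.le_add_right M a) (hy i)) ?_
      rw [← mul_assoc, ← pow_add]
      exact pow_mul_mem_wittRange_of_le (by omega) (semi_mem hc ha i)
  exact key a₀ (fun i => pow_mul_mem_wittRange_of_le (Nat.le_add_left _ _) (ha₀ i)) i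

theorem exists_phiCoeff_eq (m s : ℕ) :
    ∃ w ∈ wittRange p k, phiCoeff p k m s = (p : K(p, k)) ^ (2 * s - m) * w := by
  obtain ⟨w, hw⟩ := pow_dvd_coeff_pow p (A := WittVector p k) s m
  refine ⟨algebraMap _ _ w, ⟨w, rfl⟩, ?_⟩
  have h1 : PowerSeries.map (algebraMap (WittVector p k) K(p, k)) (((1 + X) ^ p - 1) ^ s)
      = ((1 + X) ^ p - 1) ^ s := by simp
  rw [phiCoeff, ← h1, PowerSeries.coeff_map, hw]
  simp

/-- For a given slope j, finitely many initial coefficients fix the constant a, and the recursion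
preserves the bound a + m / j beyond them. -/
theorem isRig_of_solution {B : ι → ι → K(p, k)} {f : ι → K(p, k)⟦X⟧}
    {g : ι → (WittVector p k)⟦X⟧} (h : ∀ i, f i - semiPS B f i =
      PowerSeries.map (algebraMap (WittVector p k) K(p, k)) (g i)) (i : ι) : IsRig p (f i) := by
  intro j hj
  obtain ⟨c, hc⟩ : ∃ c : ℕ, ∀ i l, (p : K(p, k)) ^ c * B i l ∈ wittRange p k := by
    obtain ⟨c, hc⟩ := exists_pow_mul_mem_forall (fun x : ι × ι => B x.1 x.2)
    exact ⟨c, fun i l => hc (i, l)⟩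
  -- For m ≥ m₁ one has m ≥ 4jc and m > 2c, which the two cases at the end need; m > c lets
  -- `mem_of_sub_semi_mem` apply.
  set m₁ := 4 * (j * c) + 2 * c + c + 1 with hm₁
  obtain ⟨a, ha⟩ := exists_pow_mul_mem_forall (fun x : Fin m₁ × ι => coeff x.1 (f x.2))
  suffices key : ∀ m, ∀ i, (p : K(p, k)) ^ (a + m / j) * coeff m (f i) ∈ wittRange p k from
    ⟨a, fun m => key m i⟩
  intro m
  induction m using Nat.strong_induction_on with
  | _ m ih =>
    by_cases hm : m < m₁
    · exact fun i => pow_mul_mem_wittRange_of_le (Nat.le_add_right _ _) (ha (⟨m, hm⟩, i))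
    refine mem_of_sub_semi_mem (m := m) hc (by omega) rfl fun i => ?_
    have h1 := congrArg (PowerSeries.coeff m) (h i)
    rw [map_sub, coeff_semiPS, Finset.sum_range_succ, phiCoeff, coeff_pow_self,
      PowerSeries.coeff_map] at h1
    have h2 : ((fun l => coeff m (f l)) - (p : K(p, k)) ^ m • semi B fun l => coeff m (f l)) i
        = algebraMap _ _ (coeff m (g i)) +
          ∑ s ∈ Finset.range m, phiCoeff p k m s * semi B (fun l => coeff s (f l)) i := by
      rw [Pi.sub_apply, Pi.smul_apply, smul_eq_mul]
      linear_combination h1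
    rw [h2, mul_add, Finset.mul_sum]
    refine add_mem (mul_mem (pow_mem (natCast_mem _ p) _) ⟨_, rfl⟩)
      (Subring.sum_mem _ fun s hs => ?_)
    have hsm := Finset.mem_range.1 hs
    obtain ⟨w, hw, hwe⟩ := exists_phiCoeff_eq (p := p) (k := k) m s
    have h3 : (p : K(p, k)) ^ (a + m / j) * (phiCoeff p k m s * semi B (fun l => coeff s (f l)) i)
        = w * ((p : K(p, k)) ^ (a + m / j + (2 * s - m)) * semi B (fun l => coeff s (f l)) i) := by
      rw [hwe, pow_add _ (a + m / j)]; ring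
    rw [h3]
    refine mul_mem hw (pow_mul_mem_wittRange_of_le ?_ (semi_mem hc (ih s hsm) i))
    -- The cost p^c of one φ must be recovered. If s ≤ 3m/4, the gap m - s ≥ cj raises the permitted
    -- denominator by c; otherwise the factor p^{2s-m} is at least p^{m/2}.
    rcases le_or_gt (4 * s) (3 * m) with h4 | h4
    · have h5 : s + c * j ≤ m := by rw [mul_comm c j]; omega
      have h6 := Nat.div_le_div_right (c := j) h5
      rw [Nat.add_mul_div_right _ _ hj] at h6
      omega
    · have h6 := Nat.div_le_div_right (c := j) hsm.le
      omega

end Solve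

/-! ### W(k)-modules as finite ℤ_p-modules. -/

section Finiteness

variable (p : ℕ) [Fact p.Prime] (k : Type*) [Field k] [Finite k] [CharP k p]

theorem frobenius_zpToWitt (z : ℤ_[p]) :
    WittVector.frobenius (zpToWitt p k z) = zpToWitt p k z := by
  rw [frobenius_eq_map_frobenius]
  ext i
  simp only [zpToWitt, RingHom.comp_apply, map_coeff]
  exact RingHom.congr_fun (Subsingleton.elim ((_root_.frobenius k p).comp (ZMod.castHom dvd_rfl k))
    (ZMod.castHom dvd_rfl k)) _

theorem isPrecomplete_pi (α : Type*) [Finite α] :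
    IsPrecomplete (Ideal.span {(p : ℤ_[p])}) (α → ℤ_[p]) := by
  have hprec : IsPrecomplete (Ideal.span {(p : ℤ_[p])}) ℤ_[p] := by
    rw [← PadicInt.maximalIdeal_eq_span_p]
    infer_instance
  have hmem : ∀ (n : ℕ) (x : α → ℤ_[p]),
      x ∈ (Ideal.span {(p : ℤ_[p])} ^ n • ⊤ : Submodule ℤ_[p] (α → ℤ_[p])) ↔
        ∀ i, x i ∈ (Ideal.span {(p : ℤ_[p])} ^ n • ⊤ : Submodule ℤ_[p] ℤ_[p]) := by
    intro n x
    simp only [Ideal.span_singleton_pow, Submodule.ideal_span_singleton_smul,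
      Submodule.mem_smul_pointwise_iff_exists, Submodule.mem_top, true_and]
    constructor
    · rintro ⟨y, rfl⟩ i
      exact ⟨y i, rfl⟩
    · intro h
      choose y hy using h
      exact ⟨y, funext hy⟩
  refine ⟨fun f hf => ?_⟩
  have h1 : ∀ i, ∃ L : ℤ_[p], ∀ n, f n i ≡ L
      [SMOD (Ideal.span {(p : ℤ_[p])} ^ n • ⊤ : Submodule ℤ_[p] ℤ_[p])] := fun i =>
    hprec.prec fun {m n} hmn => by
      have := hf hmn
      rw [SModEq.sub_mem] at this ⊢
      exact (hmem m _).1 this i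
  choose L hL using h1
  refine ⟨L, fun n => ?_⟩
  rw [SModEq.sub_mem, hmem]
  intro i
  have := hL i n
  rwa [SModEq.sub_mem] at this

/-- Teichmüller representatives of the finite field k generate W(k) modulo p. Completeness of the
free source and separatedness of W(k) lift this to surjectivity. -/
theorem zpToWitt_finite : (zpToWitt p k).Finite := by
  let _ : Algebra ℤ_[p] (WittVector p k) := (zpToWitt p k).toAlgebra
  change Module.Finite ℤ_[p] (WittVector p k)
  have := Fintype.ofFinite k
  have := isPrecomplete_pi p k
  have hmap : (Ideal.span {(p : ℤ_[p])}).map (algebraMap ℤ_[p] (WittVector p k))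
      = Ideal.span {(p : WittVector p k)} := by
    rw [Ideal.map_span, Set.image_singleton, map_natCast]
  have haus : IsHausdorff (Ideal.span {(p : ℤ_[p])}) (WittVector p k) := by
    rw [← IsHausdorff.map_algebraMap_iff (S := WittVector p k), hmap]
    infer_instance
  let f : (k → ℤ_[p]) →ₗ[ℤ_[p]] WittVector p k :=
    Fintype.linearCombination ℤ_[p] (fun a => teichmuller p a)
  have hf : Function.Surjective f := by
    refine surjective_of_mkQ_comp_surjective (I := Ideal.span {(p : ℤ_[p])}) ?_
    intro y
    obtain ⟨w, rfl⟩ := Submodule.mkQ_surjective _ y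
    classical
    refine ⟨Pi.single (w.coeff 0) 1, ?_⟩
    rw [LinearMap.comp_apply, Submodule.mkQ_apply, Submodule.mkQ_apply, Submodule.Quotient.eq,
      Ideal.smul_top_eq_map, hmap]
    change _ ∈ Ideal.span {(p : WittVector p k)}
    rw [mem_span_p_iff_coeff_zero_eq_zero]
    have h1 : f (Pi.single (w.coeff 0) 1) = teichmuller p (w.coeff 0) := by
      simp [f, Fintype.linearCombination_apply_single]
    rw [h1]
    have h2 : constantCoeff (teichmuller p (w.coeff 0) - w) = 0 := by
      rw [map_sub]
      simp [constantCoeff_apply, teichmuller_coeff_zero]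
    exact h2
  exact Module.Finite.of_surjective f hf

variable {k} in
theorem finite_compHom (M : Type*) [AddCommGroup M] [Module (WittVector p k) M]
    [Module.Finite (WittVector p k) M] :
    letI : Module ℤ_[p] M := Module.compHom M (zpToWitt p k)
    Module.Finite ℤ_[p] M := by
  let _ : Algebra ℤ_[p] (WittVector p k) := (zpToWitt p k).toAlgebra
  let _ : Module ℤ_[p] M := Module.compHom M (zpToWitt p k)
  have : IsScalarTower ℤ_[p] (WittVector p k) M := ⟨fun a b m => by
    rw [Algebra.smul_def, mul_smul]; rfl⟩
  have : Module.Finite ℤ_[p] (WittVector p k) := zpToWitt_finite p k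
  exact Module.Finite.trans (WittVector p k) M

theorem zpToWitt_injective : Function.Injective (zpToWitt p k) := by
  rw [zpToWitt, RingHom.coe_comp]
  exact (WittVector.map_injective _ (ZMod.castHom dvd_rfl k).injective).comp
    (RingEquiv.injective _)

variable {p} in
-- By ranks the cokernel of f is torsion, so y has a nonzero ℤ_p-multiple in the image, and its unit
-- factor can be divided out.
theorem exists_pow_smul_mem_range {M : Type*} [AddCommGroup M] [Module ℤ_[p] M]
    [Module.Finite ℤ_[p] M] (f : M →ₗ[ℤ_[p]] M) (hf : Function.Injective f) (y : M) :
    ∃ (m : ℕ) (x : M), f x = (p : ℤ_[p]) ^ m • y := by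
  have h1 : Module.finrank ℤ_[p] (M ⧸ LinearMap.range f) = 0 := by
    have h2 := Submodule.finrank_quotient_add_finrank (LinearMap.range f)
    rw [LinearMap.finrank_range_of_inj hf] at h2
    omega
  rw [Module.finrank_eq_zero_iff_isTorsion] at h1
  obtain ⟨z, hz⟩ := @h1 (Submodule.Quotient.mk y)
  have hz0 : (z : ℤ_[p]) ≠ 0 := nonZeroDivisors.ne_zero z.2
  have hz' : (z : ℤ_[p]) • y ∈ LinearMap.range f := by
    rw [← Submodule.Quotient.mk_eq_zero, Submodule.Quotient.mk_smul]
    exact hz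
  obtain ⟨x, hx⟩ := hz'
  refine ⟨(z : ℤ_[p]).valuation, ((PadicInt.unitCoeff hz0)⁻¹ : ℤ_[p]ˣ) • x, ?_⟩
  rw [Units.smul_def, map_smul, hx, smul_smul]
  congr 1
  refine (congrArg _ (PadicInt.unitCoeff_spec hz0)).trans ?_
  rw [← mul_assoc, Units.inv_mul, one_mul]

end Finiteness

/-! ### Injective semilinear operators are surjective. -/

section Surjectivity

variable {p : ℕ} [Fact p.Prime] {k : Type*} [Field k] [Finite k] [CharP k p]
variable {ι : Type*} [Fintype ι]

/-- The operator a + bφ is not linear over F, but it is ℤ_p-linear. After multiplication by p^c it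
preserves W(k)^ι, a finite ℤ_p-module, so its image there contains a p-power multiple of any lattice
vector. The two coefficients cover both 1 - p^m φ and φ. -/
theorem semi_surjective_of_injective {B : ι → ι → K(p, k)} (a b : ℤ)
    (hinj : ∀ u, (a : K(p, k)) • u + (b : K(p, k)) • semi B u = 0 → u = 0) (y : ι → K(p, k)) :
    ∃ u, (a : K(p, k)) • u + (b : K(p, k)) • semi B u = y := by
  obtain ⟨c, hc⟩ := exists_pow_mul_mem_forall (fun x : ι × ι => B x.1 x.2)
  choose B' hB' using hc
  have hp0 : (p : K(p, k)) ≠ 0 := FractionRing.p_nonzero p k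
  let up : (ι → WittVector p k) → (ι → K(p, k)) := fun w i => algebraMap _ _ (w i)
  let _ : Module ℤ_[p] (ι → WittVector p k) := Module.compHom _ (zpToWitt p k)
  have hfin : Module.Finite ℤ_[p] (ι → WittVector p k) := finite_compHom p _
  have hsmul : ∀ (z : ℤ_[p]) (w : ι → WittVector p k) i, (z • w) i = zpToWitt p k z * w i :=
    fun _ _ _ => rfl
  let f : (ι → WittVector p k) →ₗ[ℤ_[p]] (ι → WittVector p k) :=
    { toFun := fun w i => (p : WittVector p k) ^ c * (a * w i) +
        b * ∑ l, B' (i, l) * WittVector.frobenius (w l)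
      map_add' := fun v w => by
        ext1 i
        simp only [Pi.add_apply, map_add, mul_add, Finset.sum_add_distrib]
        ring
      map_smul' := fun z w => by
        ext1 i
        simp only [hsmul, map_mul, frobenius_zpToWitt, RingHom.id_apply, mul_add, Finset.mul_sum]
        congr 1
        · ring
        · exact Finset.sum_congr rfl fun l _ => by ring }
  have hf : ∀ w, up (f w) = (p : K(p, k)) ^ c •
      ((a : K(p, k)) • up w + (b : K(p, k)) • semi B (up w)) := by
    intro w
    ext1 i
    simp only [f, up, LinearMap.coe_mk, AddHom.coe_mk, map_add, map_mul, map_pow, map_natCast,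
      map_intCast, map_sum, hB', Pi.smul_apply, Pi.add_apply, smul_eq_mul, semi,
      frobenius_algebraMap, mul_add, Finset.mul_sum]
    congr 1
    exact Finset.sum_congr rfl fun l _ => by ring
  have hup : Function.Injective up := fun v w h => by
    ext1 i
    exact IsFractionRing.injective (WittVector p k) K(p, k) (congrFun h i)
  have hfinj : Function.Injective f := by
    rw [injective_iff_map_eq_zero]
    intro w hw
    have h1 := hf w
    rw [hw] at h1
    have h0 : up 0 = 0 := by ext1 i; simp [up]
    rw [h0, eq_comm, smul_eq_zero_iff_right (pow_ne_zero c hp0)] at h1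
    exact hup ((hinj _ h1).trans h0.symm)
  obtain ⟨d, hd⟩ := exists_pow_mul_mem_forall y
  choose y' hy' using hd
  obtain ⟨m, x, hx⟩ := exists_pow_smul_mem_range f hfinj y'
  have h2 := hf x
  have h3 : up (f x) = (p : K(p, k)) ^ (m + d) • y := by
    rw [hx]
    ext1 i
    simp only [up, hsmul, map_mul, map_pow, map_natCast, hy', Pi.smul_apply, smul_eq_mul]
    ring
  rw [h3] at h2
  have hφ : ∀ e : ℤ, φ(p, k) ((p : K(p, k)) ^ e) = (p : K(p, k)) ^ e := fun e => by
    rw [map_zpow₀, map_natCast]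
  -- The denominators accumulated are p^c from the matrix, p^d from y and p^m from the cokernel. The
  -- scalar p^e is fixed by φ, so it passes through the operator.
  refine ⟨((p : K(p, k)) ^ ((c : ℤ) - (m + d : ℕ))) • up x, ?_⟩
  rw [semi_smul, hφ, smul_comm (a : K(p, k)), smul_comm (b : K(p, k)), ← smul_add,
    zpow_sub₀ hp0, div_eq_inv_mul, mul_smul, zpow_natCast, zpow_natCast, ← h2, smul_smul,
    inv_mul_cancel₀ (pow_ne_zero _ hp0), one_smul]

end Surjectivity

/-! ### Indices of subgroups in finite ℤ_p-modules. -/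

section Index

variable {p : ℕ} [Fact p.Prime]

/-- The subgroup is p^c M, realised as the kernel of reduction of coordinates modulo p^c. -/
theorem exists_subgroup_index_le (M : Type*) [AddCommGroup M] [Module ℤ_[p] M]
    [Module.Finite ℤ_[p] M] [Module.Free ℤ_[p] M] (c : ℕ) :
    ∃ H : AddSubgroup M, H.index ≠ 0 ∧ H.index ≤ p ^ (c * Module.finrank ℤ_[p] M) ∧
      ∀ x ∈ H, ∃ y : M, x = (p ^ c : ℕ) • y := by
  let b := Module.finBasis ℤ_[p] M
  let f : M →+ (Fin (Module.finrank ℤ_[p] M) → ZMod (p ^ c)) :=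
    { toFun := fun x i => PadicInt.toZModPow c (b.repr x i)
      map_zero' := by ext1 i; simp
      map_add' := fun x y => by ext1 i; simp }
  have : NeZero (p ^ c) := ⟨pow_ne_zero c (Fact.out : p.Prime).ne_zero⟩
  have hidx : f.ker.index = Nat.card f.range := AddSubgroup.index_ker f
  refine ⟨f.ker, ?_, ?_, fun x hx => ?_⟩
  · rw [hidx]
    exact Nat.card_pos.ne'
  · rw [hidx]
    refine (Nat.card_le_card_of_injective (Subtype.val : f.range → _)
      Subtype.val_injective).trans ?_
    rw [Nat.card_fun, Nat.card_zmod, Nat.card_fin, ← pow_mul]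
  · have h1 : ∀ i, ∃ z : ℤ_[p], b.repr x i = z * (p : ℤ_[p]) ^ c := fun i => by
      have h2 : b.repr x i ∈ RingHom.ker (PadicInt.toZModPow (p := p) c) := congrFun hx i
      rw [PadicInt.ker_toZModPow, Ideal.mem_span_singleton'] at h2
      obtain ⟨z, hz⟩ := h2
      exact ⟨z, hz.symm⟩
    choose z hz using h1
    refine ⟨∑ i, z i • b i, ?_⟩
    refine (b.sum_repr x).symm.trans ?_
    rw [← Nat.cast_smul_eq_nsmul ℤ_[p], Finset.smul_sum]
    refine Finset.sum_congr rfl fun i _ => ?_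
    rw [hz, smul_smul, mul_comm]
    simp

/-- A bound for `[A : A ∩ L]`, if `A` is contained in the sum of the images of copies of `M` and
if `L` contains the images of the multiples of `p ^ c j`. -/
theorem relIndex_le_of_generators {t M J : Type*} [AddCommGroup t] [AddCommGroup M]
    [Module ℤ_[p] M] [Module.Finite ℤ_[p] M] [Module.Free ℤ_[p] M] [Fintype J]
    (u : J → M →+ t) (c : J → ℕ) {A L : AddSubgroup t} (hL : ∀ j x, u j ((p ^ c j : ℕ) • x) ∈ L)
    (hA : ∀ a ∈ A, ∃ x : J → M, a = ∑ j, u j (x j)) :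
    L.relIndex A ≠ 0 ∧ L.relIndex A ≤ p ^ ((∑ j, c j) * Module.finrank ℤ_[p] M) := by
  choose H hH0 hHle hH using fun j => exists_subgroup_index_le (p := p) M (c j)
  let Ψ : (J → M) →+ t := ∑ j, (u j).comp (Pi.evalAddMonoidHom (fun _ => M) j)
  have hΨ : ∀ x, Ψ x = ∑ j, u j (x j) := fun x => by
    simp [Ψ, AddMonoidHom.finsetSum_apply]
  -- The preimage of L contains a product of subgroups of known index. Replacing the range of Ψ by
  -- the smaller group A can then only lower the index.
  have h1 : AddSubgroup.pi Set.univ H ≤ L.comap Ψ := by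
    intro x hx
    rw [AddSubgroup.mem_comap, hΨ]
    refine AddSubgroup.sum_mem _ fun j _ => ?_
    obtain ⟨y, hy⟩ := hH j _ ((AddSubgroup.mem_pi _).1 hx j (Set.mem_univ j))
    rw [hy]
    exact hL j y
  have h2 : (AddSubgroup.pi Set.univ H).index = ∏ j, (H j).index := AddSubgroup.index_pi H
  have h3 : (AddSubgroup.pi Set.univ H).index ≠ 0 := by
    rw [h2]
    exact Finset.prod_ne_zero_iff.2 fun j _ => hH0 j
  have h4 : L.relIndex Ψ.range = (L.comap Ψ).index := (AddSubgroup.index_comap L Ψ).symm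
  have h5 : (L.comap Ψ).index ∣ (AddSubgroup.pi Set.univ H).index :=
    AddSubgroup.index_dvd_of_le h1
  have h6 : L.relIndex Ψ.range ≠ 0 := by
    rw [h4]
    exact ne_zero_of_dvd_ne_zero h3 h5
  have h7 : A ≤ Ψ.range := fun a ha => by
    obtain ⟨x, hx⟩ := hA a ha
    exact ⟨x, (hΨ x).trans hx.symm⟩
  refine ⟨mt (AddSubgroup.relIndex_eq_zero_of_le_right h7) h6, ?_⟩
  calc L.relIndex A ≤ L.relIndex Ψ.range := AddSubgroup.relIndex_le_of_le_right h7 h6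
    _ ≤ ∏ j, (H j).index := by
      rw [h4, ← h2]
      exact Nat.le_of_dvd (Nat.pos_of_ne_zero h3) h5
    _ ≤ ∏ j, p ^ (c j * Module.finrank ℤ_[p] M) := Finset.prod_le_prod' fun j _ => hHle j
    _ = _ := by rw [Finset.prod_pow_eq_pow_sum, Finset.sum_mul]

/-- One power of p carries all of the finitely many generators of S into A, hence S itself because A
is stable under ℤ_p. The index is then controlled by `relIndex_le_of_generators` with a single copy
of a free module. -/
theorem relIndex_ne_zero_of_fg {t : Type*} [AddCommGroup t] [Module ℤ_[p] t]
    {S : Submodule ℤ_[p] t} (hS : S.FG) {A L : AddSubgroup t} (hLS : ∀ x ∈ L, x ∈ S)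
    (hsmul : ∀ (z : ℤ_[p]), ∀ a ∈ A, z • a ∈ A)
    (hA : ∀ x : t, ∃ N : ℕ, (p ^ N : ℕ) • x ∈ A) : A.relIndex L ≠ 0 := by
  have : Module.Finite ℤ_[p] S := Module.Finite.iff_fg.2 hS
  obtain ⟨s, f, hf⟩ := Module.Finite.exists_fin' ℤ_[p] S
  choose N hN using hA
  let l : Fin s → t := fun i => (f (Pi.single i 1) : t)
  have hfl : ∀ z, (f z : t) = ∑ i, z i • l i := fun z => by
    have h1 : z = ∑ i, z i • (Pi.single i 1 : Fin s → ℤ_[p]) := by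
      ext1 i
      simp [Finset.sum_apply, Pi.single_apply]
    conv_lhs => rw [h1]
    simp [l]
  let u : Unit → (Fin s → ℤ_[p]) →+ t := fun _ => (S.subtype.comp f).toAddMonoidHom
  refine (relIndex_le_of_generators (p := p) u (fun _ => ∑ i, N (l i)) ?_ ?_).1
  · intro _ z
    change ((f ((p ^ _ : ℕ) • z) : S) : t) ∈ A
    rw [map_nsmul, Submodule.coe_smul_of_tower, hfl, Finset.smul_sum]
    refine AddSubgroup.sum_mem _ fun i _ => ?_
    rw [smul_comm]
    refine hsmul _ _ ?_
    obtain ⟨d, hd⟩ := Nat.exists_eq_add_of_le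
      (Finset.single_le_sum (f := fun i => N (l i)) (fun _ _ => Nat.zero_le _) (Finset.mem_univ i))
    rw [hd, pow_add, mul_comm, mul_smul]
    exact A.nsmul_mem (hN (l i)) _
  · intro a ha
    obtain ⟨z, hz⟩ := hf ⟨a, hLS a ha⟩
    refine ⟨fun _ => z, ?_⟩
    rw [Fintype.sum_unique]
    exact (congrArg Subtype.val hz).symm

end Index

/-! ### Counting generators and adding their denominators. -/

section Generators

variable (p : ℕ) [Fact p.Prime]

/-- An index set for generators of the values at `ζ_{p ^ (N + 1)} - 1`. -/
abbrev GenIdx (N : ℕ) : Type :=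
  (Σ j : Fin N, Fin (p - 1) × Fin ((p - 1) * p ^ (N - 1 - j))) ⊕ Fin (p - 1)

variable {p}

/-- The exponents of the roots of unity that generate the values. -/
def genExp {N : ℕ} : GenIdx p N → ℕ
  | .inl ⟨j, i, b⟩ => p ^ (j : ℕ) * ((i + 1) + p * b)
  | .inr i => p ^ N * (i + 1)

/-- The denominators of the values. -/
def genDenom (r s₁ s₂ : ℕ) {N : ℕ} : GenIdx p N → ℕ
  | .inl ⟨j, _, _⟩ => r * j + s₁
  | .inr _ => r * (N + 1) + s₁ + s₂

/-- Multiplied by p - 1, this counts the elements of `GenIdx`: the summand 1 stands for the last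
group, and the total is (p-1)p^N = [F_n : F]. -/
theorem sum_pow_range (N : ℕ) :
    ∑ j ∈ Finset.range N, (p - 1) * p ^ (N - 1 - j) + 1 = p ^ N := by
  have hp := (Fact.out : p.Prime).pos
  rw [← Finset.mul_sum, Finset.sum_range_reflect (fun j => p ^ j)]
  have h := Nat.geomSum_eq (Fact.out : p.Prime).two_le N
  rw [h, Nat.mul_div_cancel' (Nat.sub_one_dvd_pow_sub_one p N)]
  exact Nat.sub_add_cancel (Nat.one_le_pow _ _ hp)

/-- The same count weighted by the level j, which measures the total contribution of r; passing from
N to N + 1 multiplies the earlier terms by p. -/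
theorem sum_mul_pow_range (N : ℕ) :
    ∑ j ∈ Finset.range N, j * ((p - 1) * ((p - 1) * p ^ (N - 1 - j))) + (1 + N * (p - 1)) =
      p ^ N := by
  have hp := (Fact.out : p.Prime).pos
  obtain ⟨q, hq⟩ : ∃ q, p = q + 1 := ⟨p - 1, by omega⟩
  rw [hq, Nat.add_sub_cancel]
  induction N with
  | zero => simp
  | succ N ih =>
    rw [Finset.sum_range_succ]
    have h1 : ∑ j ∈ Finset.range N, j * (q * (q * (q + 1) ^ (N + 1 - 1 - j)))
        = (q + 1) * ∑ j ∈ Finset.range N, j * (q * (q * (q + 1) ^ (N - 1 - j))) := by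
      rw [Finset.mul_sum]
      refine Finset.sum_congr rfl fun j hj => ?_
      have : N + 1 - 1 - j = (N - 1 - j) + 1 := by have := Finset.mem_range.1 hj; omega
      rw [this, pow_succ]
      ring
    rw [h1, pow_succ, ← ih]
    simp only [Nat.add_sub_cancel, Nat.sub_self, pow_zero]
    ring

/-- The levels below N contribute r(p^N - 1 - N(p-1)) and the last group r(N+1)(p-1), whose sum is
r(p^N + p - 2). Every generator carries s₁, but only the last p - 1 carry s₂. -/
theorem sum_genDenom (r s₁ s₂ N : ℕ) :
    ∑ x : GenIdx p N, genDenom r s₁ s₂ x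
      = r * (p ^ N + p - 2) + s₂ * (p - 1) + s₁ * (p ^ N * (p - 1)) := by
  have hp := (Fact.out : p.Prime).two_le
  have hpN : 1 ≤ p ^ N := Nat.one_le_pow _ _ (by omega)
  rw [Fintype.sum_sum_type, Fintype.sum_sigma]
  simp only [genDenom, Finset.sum_const, Finset.card_univ, Fintype.card_prod, Fintype.card_fin,
    smul_eq_mul]
  rw [← Finset.sum_range (fun j => (p - 1) * ((p - 1) * p ^ (N - 1 - j)) * (r * j + s₁))]
  have h1 := sum_pow_range (p := p) N
  have h2 := sum_mul_pow_range (p := p) N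
  have h3 : ∑ j ∈ Finset.range N, (p - 1) * ((p - 1) * p ^ (N - 1 - j)) * (r * j + s₁)
      = r * ∑ j ∈ Finset.range N, j * ((p - 1) * ((p - 1) * p ^ (N - 1 - j))) +
        s₁ * ((p - 1) * ∑ j ∈ Finset.range N, (p - 1) * p ^ (N - 1 - j)) := by
    simp only [Finset.mul_sum, ← Finset.sum_add_distrib]
    exact Finset.sum_congr rfl fun j _ => by ring
  rw [h3]
  generalize ∑ j ∈ Finset.range N, j * ((p - 1) * ((p - 1) * p ^ (N - 1 - j))) = S₁ at *
  generalize ∑ j ∈ Finset.range N, (p - 1) * p ^ (N - 1 - j) = S₂ at *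
  obtain ⟨q, rfl⟩ : ∃ q, p = q + 1 := ⟨p - 1, by omega⟩
  rw [Nat.add_sub_cancel] at *
  have h4 : (q + 1) ^ N + (q + 1) - 2 = S₁ + N * q + q := by omega
  rw [h4, ← h1]
  ring

end Generators

/-! ### Reducing powers of ζ to the generators. -/

section Span

variable {p : ℕ} [Fact p.Prime] {k : Type*} [Field k] [Finite k] [CharP k p]
variable {E : Type*} [Field E] [Algebra K(p, k) E] [Algebra (WittVector p k) E]
variable [IsScalarTower (WittVector p k) K(p, k) E]

/-- The relation expresses η^{qM} by lower powers with coefficients -1, so exponents descend below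
qM without denominators. -/
theorem pow_mem_span_of_sum_eq_zero {R A : Type*} [CommRing R] [CommRing A] [Algebra R A] {η : A}
    {q M : ℕ} (hM : 0 < M) (h : ∑ c ∈ Finset.range (q + 1), η ^ (c * M) = 0)
    (b : ℕ) : η ^ b ∈ Submodule.span R (Set.range fun i : Fin (q * M) => η ^ (i : ℕ)) := by
  induction b using Nat.strong_induction_on with
  | _ b ih =>
    rcases lt_or_ge b (q * M) with hb | hb
    · exact Submodule.subset_span ⟨⟨b, hb⟩, rfl⟩
    · obtain ⟨d, rfl⟩ := Nat.exists_eq_add_of_le hb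
      rw [Finset.sum_range_succ] at h
      have h1 : η ^ (q * M + d) = -∑ c ∈ Finset.range q, η ^ (c * M + d) := by
        rw [pow_add, eq_neg_of_add_eq_zero_right h, neg_mul, Finset.sum_mul]
        simp only [pow_add]
      rw [h1]
      refine Submodule.neg_mem _ (Submodule.sum_mem _ fun c hc => ih _ ?_)
      have := Nat.mul_lt_mul_of_pos_right (Finset.mem_range.1 hc) hM
      omega

theorem sum_pow_mul_eq_zero {N : ℕ} {ζ : E} (hζ : IsPrimitiveRoot ζ (p ^ (N + 1))) :
    ∑ i ∈ Finset.range p, ζ ^ (p ^ N * i) = 0 := by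
  have h1 : IsPrimitiveRoot (ζ ^ p ^ N) p := hζ.pow (pow_pos (Fact.out : p.Prime).pos _) (pow_succ _ _)
  simpa only [pow_mul] using h1.geom_sum_eq_zero (Fact.out : p.Prime).one_lt

/-- The `W(k)`-module that contains the values. -/
noncomputable def valueSpan (k : Type*) [Field k] [Finite k] [CharP k p] [Algebra K(p, k) E]
    [Algebra (WittVector p k) E] (r s₁ s₂ N : ℕ) (ζ : E) :
    Submodule (WittVector p k) E :=
  Submodule.span _ (Set.range fun x : GenIdx p N =>
    ((p : E) ^ genDenom r s₁ s₂ x)⁻¹ * ζ ^ genExp x)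

variable {r s₁ s₂ N : ℕ} {ζ : E}

/-- The element η = ζ^{p^{j+1}} has order p^{N-j} and satisfies ∑_{c<p} η^{c p^{N-1-j}} = 0, so b
can be reduced below (p-1)p^{N-1-j} while i is kept. -/
theorem inv_pow_mul_pow_mem_valueSpan (hζ : IsPrimitiveRoot ζ (p ^ (N + 1))) {j : ℕ} (hj : j < N)
    {i : ℕ} (hi : i ∈ Finset.Ico 1 p) (b : ℕ) :
    ((p : E) ^ (r * j + s₁))⁻¹ * ζ ^ (p ^ j * (i + p * b)) ∈ valueSpan k r s₁ s₂ N ζ := by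
  have hp := (Fact.out : p.Prime).pos
  rw [Finset.mem_Ico] at hi
  have h1 : ∑ c ∈ Finset.range (p - 1 + 1), (ζ ^ p ^ (j + 1)) ^ (c * p ^ (N - 1 - j)) = 0 := by
    rw [Nat.sub_add_cancel hp, ← sum_pow_mul_eq_zero hζ]
    refine Finset.sum_congr rfl fun c _ => ?_
    rw [← pow_mul]
    congr 1
    rw [mul_comm c, ← mul_assoc, ← pow_add]
    congr 2
    omega
  have h2 := pow_mem_span_of_sum_eq_zero (R := WittVector p k) (pow_pos hp _) h1 b
  have h3 := Submodule.mem_map_of_mem (f := LinearMap.mulLeft (WittVector p k)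
    (((p : E) ^ (r * j + s₁))⁻¹ * ζ ^ (p ^ j * i))) h2
  rw [Submodule.map_span, LinearMap.mulLeft_apply] at h3
  have h4 : ((p : E) ^ (r * j + s₁))⁻¹ * ζ ^ (p ^ j * (i + p * b))
      = ((p : E) ^ (r * j + s₁))⁻¹ * ζ ^ (p ^ j * i) * (ζ ^ p ^ (j + 1)) ^ b := by
    rw [mul_assoc, ← pow_mul, ← pow_add]
    congr 2
    ring
  rw [h4]
  refine Submodule.span_mono ?_ h3
  rintro _ ⟨_, ⟨b', rfl⟩, rfl⟩
  refine ⟨.inl ⟨⟨j, hj⟩, ⟨i - 1, by omega⟩, b'⟩, ?_⟩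
  simp only [genDenom, genExp, LinearMap.mulLeft_apply]
  rw [mul_assoc, ← pow_mul, ← pow_add, Nat.sub_add_cancel hi.1]
  congr 2
  ring

theorem inv_pow_mul_pow_mem_valueSpan_last (hζ : IsPrimitiveRoot ζ (p ^ (N + 1)))
    {i : ℕ} (hi : i ∈ Finset.Ico 1 p) (b : ℕ) :
    ((p : E) ^ (r * (N + 1) + s₁ + s₂))⁻¹ * ζ ^ (p ^ N * (i + p * b)) ∈
      valueSpan k r s₁ s₂ N ζ := by
  rw [Finset.mem_Ico] at hi
  refine Submodule.subset_span ⟨.inr ⟨i - 1, by omega⟩, ?_⟩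
  simp only [genDenom, genExp]
  rw [Nat.sub_add_cancel hi.1, mul_add (p ^ N) i, ← mul_assoc, ← pow_succ, pow_add ζ, pow_mul ζ (p ^ (N + 1)),
    hζ.pow_eq_one, one_pow, mul_one]

/-- Since 1 = -∑_{0<i<p} ζ^{p^N i}, the constant term needs no generator of its own; this saving is
what gives the constant p - 2 in the bound. -/
theorem inv_pow_mem_valueSpan (hζ : IsPrimitiveRoot ζ (p ^ (N + 1))) :
    ((p : E) ^ (r * (N + 1) + s₁ + s₂))⁻¹ ∈ valueSpan k r s₁ s₂ N ζ := by
  have h1 := sum_pow_mul_eq_zero hζ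
  rw [Finset.range_eq_Ico, Finset.sum_eq_sum_Ico_succ_bot (Fact.out : p.Prime).pos, mul_zero,
    pow_zero, add_eq_zero_iff_eq_neg] at h1
  rw [← mul_one (_⁻¹), h1, mul_neg, Finset.mul_sum]
  refine Submodule.neg_mem _ (Submodule.sum_mem _ fun i hi => ?_)
  simpa using inv_pow_mul_pow_mem_valueSpan_last hζ hi 0

theorem mul_mem_valueSpan_of_pow_mul_mem {a : K(p, k)} {c : ℕ} {z : E}
    (ha : (p : K(p, k)) ^ c * a ∈ wittRange p k)
    (hz : ((p : E) ^ c)⁻¹ * z ∈ valueSpan k r s₁ s₂ N ζ) :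
    algebraMap K(p, k) E a * z ∈ valueSpan k r s₁ s₂ N ζ := by
  obtain ⟨w, hw⟩ := ha
  have hp0 := p_ne_zero p k E
  have h1 : algebraMap K(p, k) E a * z = w • (((p : E) ^ c)⁻¹ * z) := by
    rw [Algebra.smul_def, IsScalarTower.algebraMap_apply (WittVector p k) K(p, k) E, hw, map_mul,
      map_pow, map_natCast]
    field_simp
  rw [h1]
  exact Submodule.smul_mem _ _ hz

end Span

/-! ### All values lie in the span of the generators. -/

section UpperBound

open PowerSeries

variable {p : ℕ} [Fact p.Prime] {k : Type*} [Field k] [Finite k] [CharP k p]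
variable {ι : Type*} [Fintype ι]
variable {E : Type*} [Field E] [Algebra K(p, k) E]

/-- The map `σ ^ (- n)` on `W(k)`. -/
noncomputable abbrev wittFrobInvPow (p : ℕ) [Fact p.Prime] (k : Type*) [Field k] [Finite k]
    [CharP k p] (n : ℕ) : WittVector p k →+* WittVector p k :=
  ((WittVector.frobeniusEquiv p k).symm : WittVector p k →+* WittVector p k) ^ n

theorem frobInvPow_algebraMap (n : ℕ) (w : WittVector p k) :
    frobInvPow p k n (algebraMap _ _ w) = algebraMap _ _ (wittFrobInvPow p k n w) := by
  rw [RingHom.coe_pow, RingHom.coe_pow]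
  induction n with
  | zero => rfl
  | succ n ih =>
    rw [Function.iterate_succ_apply', Function.iterate_succ_apply', ih]
    exact frobenius_symm_algebraMap _

theorem wittFrobInvPow_comm (n : ℕ) (w : WittVector p k) :
    wittFrobInvPow p k n (WittVector.frobenius w)
      = WittVector.frobenius (wittFrobInvPow p k n w) := by
  apply IsFractionRing.injective (WittVector p k) K(p, k)
  rw [← frobInvPow_algebraMap, ← frobenius_algebraMap, ← frobenius_algebraMap, frobInvPow_comm,
    frobInvPow_algebraMap]

theorem map_frobInvPow_map (n : ℕ) (g : (WittVector p k)⟦X⟧) :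
    PowerSeries.map (frobInvPow p k n) (PowerSeries.map (algebraMap (WittVector p k) K(p, k)) g)
      = PowerSeries.map (algebraMap (WittVector p k) K(p, k))
        (PowerSeries.map (wittFrobInvPow p k n) g) := by
  ext m
  simp only [PowerSeries.coeff_map]
  exact frobInvPow_algebraMap n _

theorem IsPsi.map_wittFrobInvPow {g : (WittVector p k)⟦X⟧} (hg : IsPsi p g 0) (n : ℕ) :
    IsPsi p (PowerSeries.map (wittFrobInvPow p k n) g) 0 := by
  obtain ⟨c, h0, hc⟩ := hg
  refine ⟨fun i => PowerSeries.map (wittFrobInvPow p k n) (c i), by simp [h0], ?_⟩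
  rw [hc, map_sum]
  refine Finset.sum_congr rfl fun i _ => ?_
  rw [map_mul, map_phiPS p _ _ _ (wittFrobInvPow_comm n)]
  simp

theorem constantCoeff_sub_semi {B : ι → ι → K(p, k)} {f g : ι → K(p, k)⟦X⟧}
    (h : ∀ i, f i - semiPS B f i = g i) (i : ι) :
    constantCoeff (f i) - semi B (fun l => constantCoeff (f l)) i = constantCoeff (g i) := by
  rw [← h i, map_sub, ← PowerSeries.coeff_zero_eq_constantCoeff_apply (semiPS B f i), coeff_semiPS]
  simp [phiCoeff]

/-- By uniqueness of values, y is the expression of `hasValue_solution`. Its matrices have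
denominators rj + s₁, unchanged by σ^{-n}, and the vector f(0) has denominator s₂ because its image
under 1 - φ is the integral vector g(0). -/
theorem value_mem_valueSpan [Algebra (WittVector p k) E] [IsScalarTower (WittVector p k) K(p, k) E]
    [Algebra.IsAlgebraic K(p, k) E] {B : ι → ι → K(p, k)} {r s₁ s₂ N : ℕ} {ζ : E}
    (hs₁ : ∀ j i l, (p : K(p, k)) ^ (r * j + s₁) * iterMatrix B j i l ∈ wittRange p k)
    (hs₂ : ∀ u : ι → K(p, k), (∀ i, u i - semi B u i ∈ wittRange p k) →
      ∀ i, (p : K(p, k)) ^ s₂ * u i ∈ wittRange p k)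
    (hζ : IsPrimitiveRoot ζ (p ^ (N + 1)))
    {f : ι → K(p, k)⟦X⟧} {g : ι → (WittVector p k)⟦X⟧} (hf : ∀ i, IsRig p (f i))
    (hg : ∀ i, IsPsi p (g i) 0)
    (h : ∀ i, f i - semiPS B f i = PowerSeries.map (algebraMap (WittVector p k) K(p, k)) (g i))
    {y : ι → E} (hy : ∀ i, HasValue p (PowerSeries.map (frobInvPow p k (N + 1)) (f i)) (ζ - 1) (y i))
    (i : ι) : y i ∈ valueSpan k r s₁ s₂ N ζ := by
  have hex : ∀ j l, ∃ c : ℕ → ℕ → WittVector p k, j < N + 1 →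
      HasValue p ((phiPS p φ(p, k))^[j] (PowerSeries.map (frobInvPow p k (N + 1))
        (PowerSeries.map (algebraMap (WittVector p k) K(p, k)) (g l))))
        (ζ - 1) (∑ i ∈ Finset.Ico 1 p, ∑ b ∈ Finset.range (p ^ (N + 1 - 1 - j)),
          algebraMap K(p, k) E (algebraMap _ _ (c i b)) * ζ ^ (p ^ j * (i + p * b))) := by
    intro j l
    by_cases hj : j < N + 1
    · obtain ⟨c, hc⟩ := exists_hasValue_of_isPsi hζ.pow_eq_one
        ((hg l).map_wittFrobInvPow (N + 1)) hj
      exact ⟨c, fun _ => by rw [map_frobInvPow_map]; exact hc⟩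
    · exact ⟨0, fun h => absurd h hj⟩
  choose c hc using hex
  have h1 := hasValue_solution hζ.pow_eq_one hf h (fun j hj l => hc j l hj) i
  rw [(hy i).unique h1]
  have hτ : ∀ {a : K(p, k)} {m : ℕ}, (p : K(p, k)) ^ m * a ∈ wittRange p k →
      (p : K(p, k)) ^ m * frobInvPow p k (N + 1) a ∈ wittRange p k := fun {a m} ha => by
    have := frobInvPow_mem (N + 1) ha
    rwa [map_mul, map_pow, map_natCast] at this
  refine add_mem (Submodule.sum_mem _ fun j hj => Submodule.sum_mem _ fun l _ => ?_)
    (Submodule.sum_mem _ fun l _ => ?_)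
  · rw [Finset.mul_sum]
    refine Submodule.sum_mem _ fun i' hi' => ?_
    rw [Finset.mul_sum]
    refine Submodule.sum_mem _ fun b _ => ?_
    rw [← mul_assoc, ← map_mul]
    have h2 : (p : K(p, k)) ^ (r * j + s₁) * (frobInvPow p k (N + 1) (iterMatrix B j i l) *
        algebraMap _ _ (c j l i' b)) ∈ wittRange p k := by
      rw [← mul_assoc]
      exact mul_mem (hτ (hs₁ j i l)) ⟨_, rfl⟩
    rcases lt_or_ge j N with hjN | hjN
    · exact mul_mem_valueSpan_of_pow_mul_mem h2 (inv_pow_mul_pow_mem_valueSpan hζ hjN hi' b)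
    -- The level j = N joins the group of the constant term, whose denominator exponent r(N+1) + s₁
    -- + s₂ exceeds the required rN + s₁.
    · have hjN' : j = N := by have := Finset.mem_range.1 hj; omega
      subst hjN'
      refine mul_mem_valueSpan_of_pow_mul_mem (pow_mul_mem_wittRange_of_le ?_ h2)
        (inv_pow_mul_pow_mem_valueSpan_last hζ hi' b)
      nlinarith
  · have h3 : (p : K(p, k)) ^ s₂ * constantCoeff (f l) ∈ wittRange p k := by
      refine hs₂ (fun l => constantCoeff (f l)) (fun i => ?_) l
      rw [constantCoeff_sub_semi h]
      exact ⟨constantCoeff (g i), by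
        rw [← PowerSeries.coeff_zero_eq_constantCoeff_apply,
          ← PowerSeries.coeff_zero_eq_constantCoeff_apply, PowerSeries.coeff_map]⟩
    rw [← map_mul, ← mul_one (algebraMap K(p, k) E _)]
    refine mul_mem_valueSpan_of_pow_mul_mem (c := r * (N + 1) + s₁ + s₂) ?_
      (by rw [mul_one]; exact inv_pow_mem_valueSpan hζ)
    have h4 := mul_mem (hτ (hs₁ (N + 1) i l)) h3
    convert h4 using 1
    ring

end UpperBound

/-! ### Separating the terms of the monomial values. -/

section Saturation

variable {p : ℕ} [Fact p.Prime] {N : ℕ} {t U : Type*} [AddCommGroup t] [AddCommGroup U]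

theorem periodic_add_mul {e : ℕ → U →+ t} (hper : ∀ b u, e (b + p ^ (N + 1)) u = e b u) (b c : ℕ)
    (u : U) : e (b + c * p ^ (N + 1)) u = e b u := by
  induction c with
  | zero => simp
  | succ c ih => rw [Nat.succ_mul, ← add_assoc, hper, ih]

theorem mem_of_sum_mem_of_lt {Q : AddSubgroup t} (hQ : ∀ x, p • x ∈ Q → x ∈ Q) {F : U →+ U}
    {e : ℕ → U →+ t} (hper : ∀ b u, e (b + p ^ (N + 1)) u = e b u)
    (hsum : ∀ b u, ∑ c ∈ Finset.range p, e (b + c * p ^ N) u = 0)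
    (hP : ∀ a, ¬p ∣ a → ∀ u, ∑ j ∈ Finset.range (N + 1), e (p ^ j * a) (F^[j] (u - F u)) +
      e 0 (F^[N + 1] u) ∈ Q)
    (hF : ∀ y, ∃ u, u - F u = y) {j : ℕ} (hj : j < N) {a : ℕ} (ha : ¬p ∣ a) (u : U) :
    e (p ^ j * a) (F^[j] u) ∈ Q := by
  induction j using Nat.strong_induction_on generalizing a u with
  | _ j ih =>
    obtain ⟨u, rfl⟩ := hF u
    have hd : ∀ c, ¬p ∣ a + c * p ^ (N - j) := fun c h => ha <| by
      rwa [Nat.dvd_add_left ((dvd_pow_self p (by omega)).mul_left c)] at h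
    have key : ∀ c, e (p ^ j * a) (F^[j] (u - F u)) -
        e (p ^ j * a + c * p ^ N) (F^[j] (u - F u)) ∈ Q := by
      intro c
      have h1 := Q.sub_mem (hP a ha u) (hP _ (hd c) u)
      rw [add_sub_add_right_eq_sub, ← Finset.sum_sub_distrib,
        ← Finset.add_sum_erase _ _ (Finset.mem_range.2 (show j < N + 1 by omega))] at h1
      have h2 : p ^ j * (a + c * p ^ (N - j)) = p ^ j * a + c * p ^ N := by
        rw [mul_add, mul_left_comm, ← pow_add]
        congr 3
        omega
      rw [h2] at h1
      refine (Q.add_mem_cancel_right (Q.sum_mem fun i hi => ?_)).1 h1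
      rw [Finset.mem_erase, Finset.mem_range] at hi
      rcases lt_or_gt_of_ne hi.1 with hij | hij
      · exact Q.sub_mem (ih i hij (by omega) ha _) (ih i hij (by omega) (hd c) _)
      · obtain ⟨d, rfl⟩ := Nat.exists_eq_add_of_lt hij
        have h3 : p ^ (j + d + 1) * (a + c * p ^ (N - j))
            = p ^ (j + d + 1) * a + (c * p ^ d) * p ^ (N + 1) := by
          have : p ^ (N + 1) = p ^ j * p * p ^ (N - j) := by
            rw [← pow_succ, ← pow_add]; congr 1; omega
          rw [this]
          ring
        rw [h3, periodic_add_mul hper, sub_self]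
        exact Q.zero_mem
    refine hQ _ ?_
    -- Summing over c kills the shifted terms and leaves p times the unshifted one; Q is saturated.
    have h4 := Q.sum_mem (t := Finset.range p) fun c _ => key c
    rwa [Finset.sum_sub_distrib, hsum, sub_zero, Finset.sum_const, Finset.card_range] at h4

/-- A saturated subgroup that contains the values of the Perrin-Riou map at all monomials contains
everything. -/
theorem mem_of_sum_mem {Q : AddSubgroup t} (hQ : ∀ x, p • x ∈ Q → x ∈ Q) {F : U →+ U}
    {e : ℕ → U →+ t} (hper : ∀ b u, e (b + p ^ (N + 1)) u = e b u)
    (hsum : ∀ b u, ∑ c ∈ Finset.range p, e (b + c * p ^ N) u = 0)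
    (hP : ∀ a, ¬p ∣ a → ∀ u, ∑ j ∈ Finset.range (N + 1), e (p ^ j * a) (F^[j] (u - F u)) +
      e 0 (F^[N + 1] u) ∈ Q)
    (hF : ∀ y, ∃ u, u - F u = y) (hF' : ∀ y, ∃ u, p • F u - u = y)
    (hsurj : Function.Surjective F) (b : ℕ) (u : U) : e b u ∈ Q := by
  have hp := (Fact.out : p.Prime).pos
  have hlt := @mem_of_sum_mem_of_lt p _ N t U _ _ Q hQ F e hper hsum hP hF
  -- At level N the shift by c p^{N-j} = c may make a divisible by p, so the comparison stops; the
  -- lower levels are removed and two terms are left.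
  have h1 : ∀ a, ¬p ∣ a → ∀ u, e (p ^ N * a) (F^[N] (u - F u)) + e 0 (F^[N + 1] u) ∈ Q := by
    intro a ha u
    have h2 := hP a ha u
    rw [Finset.sum_range_succ, add_assoc] at h2
    exact (Q.add_mem_cancel_left
      (Q.sum_mem fun i hi => hlt (Finset.mem_range.1 hi) ha _)).1 h2
  have hsurjN : ∀ j, Function.Surjective (F^[j]) := fun j => hsurj.iterate j
  have h0 : ∀ u, e 0 u ∈ Q := by
    intro u
    obtain ⟨u, rfl⟩ := hsurjN N u
    obtain ⟨u, rfl⟩ := hF' u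
    -- Summing over 1 ≤ a < p gives -e₀(F^N(u - Fu)) + (p-1) e₀(F^{N+1}u) = e₀(F^N(pFu - u)), where
    -- e₀ is `e 0`. Every vector has the form F^N(pFu - u), so e₀ takes its values in Q.
    have h2 : ∑ a ∈ Finset.Ico 1 p,
        (e (p ^ N * a) (F^[N] (u - F u)) + e 0 (F^[N + 1] u)) ∈ Q :=
      Q.sum_mem fun a ha => h1 a (Nat.not_dvd_of_pos_of_lt (Finset.mem_Ico.1 ha).1
        (Finset.mem_Ico.1 ha).2) u
    have h3 := hsum 0 (F^[N] (u - F u))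
    rw [Finset.range_eq_Ico, Finset.sum_eq_sum_Ico_succ_bot hp, zero_mul, zero_add,
      add_eq_zero_iff_eq_neg] at h3
    rw [Finset.sum_add_distrib, Finset.sum_const, Nat.card_Ico] at h2
    have h4 : ∑ a ∈ Finset.Ico 1 p, e (p ^ N * a) (F^[N] (u - F u))
        = -e 0 (F^[N] (u - F u)) := by
      rw [h3, neg_neg]
      exact Finset.sum_congr rfl fun a _ => by rw [zero_add, mul_comm]
    rw [h4] at h2
    have h5 : ∀ x y, F^[N] (x - y) = F^[N] x - F^[N] y := fun x y => iterate_map_sub F N x y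
    have h6 : ∀ x, F^[N] (p • x) = p • F^[N] x := fun x => iterate_map_nsmul F N x p
    rw [h5] at h2 ⊢
    rw [h6, ← Function.iterate_succ_apply, map_sub, map_nsmul]
    rw [map_sub, ← Function.iterate_succ_apply] at h2
    convert h2 using 1
    obtain ⟨q, hq⟩ : ∃ q, p = q + 1 := ⟨p - 1, by omega⟩
    rw [hq, Nat.add_sub_cancel, add_smul, one_smul]
    abel
  rcases Nat.eq_zero_or_pos b with rfl | hb
  · exact h0 u
  obtain ⟨j, a, ha, rfl⟩ := Nat.exists_eq_pow_mul_and_not_dvd hb.ne' p (Fact.out : p.Prime).ne_one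
  obtain ⟨u, rfl⟩ := hsurjN j u
  -- Write b = p^j a with p ∤ a. For j = N the term e₀ can now be subtracted, and for j > N
  -- periodicity reduces to exponent 0.
  rcases lt_trichotomy j N with hj | rfl | hj
  · exact hlt hj ha u
  · obtain ⟨u, rfl⟩ := hF u
    exact (Q.add_mem_cancel_right (h0 _)).1 (h1 a ha u)
  · obtain ⟨d, rfl⟩ := Nat.exists_eq_add_of_lt hj
    have h7 : p ^ (N + d + 1) * a = 0 + (p ^ d * a) * p ^ (N + 1) := by ring
    rw [h7, periodic_add_mul hper]
    exact h0 _

end Saturation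

/-! ### Values of the solutions for monomials. -/

section MonomialValues

open PowerSeries

variable {p : ℕ} [Fact p.Prime] {k : Type*} [Field k] [Finite k] [CharP k p]
variable {ι : Type*} [Fintype ι]
variable {E : Type*} [Field E] [Algebra K(p, k) E]

/-- Division of a by p puts the monomial in the component indexed by a mod p, which is nonzero; the
coefficient w is a Frobenius image because k is perfect. -/
theorem isPsi_monomial (w : WittVector p k) {a : ℕ} (ha : ¬p ∣ a) :
    IsPsi p (C w * (1 + X) ^ a) 0 := by
  have hp := (Fact.out : p.Prime).pos
  classical
  refine ⟨fun i => if i = a % p then C ((WittVector.frobeniusEquiv p k).symm w) * (1 + X) ^ (a / p)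
    else 0, if_neg fun h => ha (Nat.dvd_of_mod_eq_zero h.symm), ?_⟩
  rw [Finset.sum_eq_single (a % p)]
  · dsimp only
    rw [if_pos rfl, map_mul, phiPS_C, phiPS_one_add_X_pow]
    have h1 : WittVector.frobenius ((WittVector.frobeniusEquiv p k).symm w) = w :=
      (WittVector.frobeniusEquiv p k).apply_symm_apply w
    rw [h1, mul_left_comm, ← pow_add, Nat.mod_add_div]
  · intro i _ hi
    dsimp only
    rw [if_neg hi, map_zero, mul_zero]
  · intro h
    exact absurd (Finset.mem_range.2 (Nat.mod_lt a hp)) h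

theorem frobInvPow_iterate (n j : ℕ) (a : K(p, k)) :
    frobInvPow p k n (φ(p, k)^[j] a) = φ(p, k)^[j] (frobInvPow p k n a) :=
  (Function.Commute.iterate_right (f := frobInvPow p k n) (g := φ(p, k)) (frobInvPow_comm n) j) a

/-- The value at `ζ - 1` of the solution for a monomial. -/
theorem exists_monomial_value {n : ℕ} {ζ : E} (hζ : ζ ^ p ^ n = 1) {B : ι → ι → K(p, k)}
    (hB : ∀ (m : ℕ) (y : ι → K(p, k)), ∃ u, u - (p : K(p, k)) ^ m • semi B u = y)
    (hB0 : ∀ u, semi B u = u → u = 0) {a : ℕ} (ha : ¬p ∣ a) (u : ι → K(p, k))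
    (w : ι → WittVector p k) (hu : ∀ i, algebraMap _ _ (w i) = u i - semi B u i) :
    ∃ (g : ι → (WittVector p k)⟦X⟧) (f : ι → K(p, k)⟦X⟧), (∀ i, IsPsi p (g i) 0) ∧
      (∀ i, IsRig p (f i)) ∧
      (∀ i, f i - semiPS B f i = PowerSeries.map (algebraMap (WittVector p k) K(p, k)) (g i)) ∧
      ∀ i, HasValue p (PowerSeries.map (frobInvPow p k n) (f i)) (ζ - 1)
        (∑ j ∈ Finset.range n, algebraMap K(p, k) E
            (frobInvPow p k n ((semi B)^[j] (u - semi B u) i)) * ζ ^ (p ^ j * a) +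
          algebraMap K(p, k) E (frobInvPow p k n ((semi B)^[n] u i))) := by
  set g : ι → (WittVector p k)⟦X⟧ := fun i => C (w i) * (1 + X) ^ a with hg
  obtain ⟨f, hf⟩ := exists_solution hB
    (fun i => PowerSeries.map (algebraMap (WittVector p k) K(p, k)) (g i))
  have hrig := isRig_of_solution hf
  refine ⟨g, f, fun i => isPsi_monomial _ ha, hrig, hf, fun i => ?_⟩
  -- Both vectors have the same image under 1 - φ, which is injective; so u can be prescribed in
  -- advance as the constant term.
  have hf0 : (fun l => constantCoeff (f l)) = u := by
    have h1 := constantCoeff_sub_semi hf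
    set u' : ι → K(p, k) := fun l => constantCoeff (f l) with hu'
    have h2 : ∀ i, constantCoeff (PowerSeries.map (algebraMap (WittVector p k) K(p, k)) (g i))
        = u i - semi B u i := fun i => by
      rw [← hu i]
      simp [hg]
    have h3 : semi B (u' - u) = u' - u := by
      have h4 : semi B u' = semi B (u' - u) + semi B u := by rw [← semi_add, sub_add_cancel]
      ext1 i
      have h5 := (h1 i).trans (h2 i)
      rw [h4, Pi.add_apply] at h5
      rw [Pi.sub_apply]
      linear_combination -h5
    exact sub_eq_zero.1 (hB0 _ h3)
  have hval : ∀ j < n, ∀ l, HasValue p ((phiPS p φ(p, k))^[j] (PowerSeries.map (frobInvPow p k n)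
      (PowerSeries.map (algebraMap (WittVector p k) K(p, k)) (g l)))) (ζ - 1)
      (algebraMap K(p, k) E (φ(p, k)^[j] (frobInvPow p k n (algebraMap _ _ (w l)))) *
        ζ ^ (p ^ j * a)) := by
    intro j _ l
    have h1 := hasValue_of_eq (s := {()}) hζ (IsRig.zero (p := p) (k := k))
      (a := fun _ => φ(p, k)^[j] (frobInvPow p k n (algebraMap _ _ (w l))))
      (e := fun _ => p ^ j * a) (f := (phiPS p φ(p, k))^[j] (PowerSeries.map (frobInvPow p k n)
      (PowerSeries.map (algebraMap (WittVector p k) K(p, k)) (g l)))) (by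
        simp only [hg, map_mul, PowerSeries.map_C, map_pow, map_add, map_one, PowerSeries.map_X,
          zero_mul, zero_add, Finset.sum_singleton]
        rw [iterate_map_mul, phiPS_iterate_C, phiPS_iterate_one_add_X_pow])
    simpa using h1
  have h1 := hasValue_solution hζ hrig hf hval i
  convert h1 using 1
  congr 1
  · refine Finset.sum_congr rfl fun j _ => ?_
    rw [semi_iterate_apply, map_sum, map_sum, Finset.sum_mul]
    refine Finset.sum_congr rfl fun l _ => ?_
    rw [map_mul, map_mul, frobInvPow_iterate, Pi.sub_apply, hu, mul_assoc]
  · rw [semi_iterate_apply, map_sum, map_sum]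
    refine Finset.sum_congr rfl fun l _ => ?_
    rw [map_mul, map_mul, frobInvPow_iterate, frobenius_iterate_frobInvPow, ← hf0]

end MonomialValues

/-! ### The image A in coordinates absorbs multiplication by some power of p. -/

section Coordinates

open PowerSeries

variable {p : ℕ} [Fact p.Prime] {k : Type*} [Field k] [Finite k] [CharP k p]
variable {ι : Type*} [Fintype ι]
variable {E : Type*} [Field E] [Algebra K(p, k) E]
variable {V' : Type*} [AddCommGroup V'] [Module K(p, k) V']

/-- `x` is the value of the solution of `(1 - φ) f = g` for some `g` with `ψ(g) = 0`. Here `φ` has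
the matrix `B`. -/
def IsSolutionValue (B : ι → ι → K(p, k)) (n : ℕ) (ζ : E) (v' : ι → V') (x : E ⊗[K(p, k)] V') :
    Prop :=
  ∃ (g : ι → (WittVector p k)⟦X⟧) (f : ι → K(p, k)⟦X⟧) (y : ι → E), (∀ i, IsPsi p (g i) 0) ∧
    (∀ i, IsRig p (f i)) ∧
    (∀ i, f i - semiPS B f i = PowerSeries.map (algebraMap (WittVector p k) K(p, k)) (g i)) ∧
    (∀ i, HasValue p (PowerSeries.map (frobInvPow p k n) (f i)) (ζ - 1) (y i)) ∧
    x = ∑ i, y i ⊗ₜ[K(p, k)] v' i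

theorem frobInvPow_zpToWitt (n : ℕ) (z : ℤ_[p]) :
    frobInvPow p k n (algebraMap _ _ (zpToWitt p k z)) = algebraMap _ _ (zpToWitt p k z) := by
  rw [RingHom.coe_pow]
  refine Function.iterate_fixed ?_ n
  change (FractionRing.frobenius p k).symm _ = _
  rw [RingEquiv.symm_apply_eq]
  have := frobenius_algebraMap (zpToWitt p k z)
  rw [frobenius_zpToWitt] at this
  exact this.symm

/-- Scalars from ℤ_p are fixed by σ, so they commute with φ and with the twist σ^{-n}; all data of a
solution can be multiplied by them. -/
theorem IsSolutionValue.zp_smul {B : ι → ι → K(p, k)} {n : ℕ} {ζ : E} {v' : ι → V'}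
    {x : E ⊗[K(p, k)] V'} (h : IsSolutionValue B n ζ v' x) (z : ℤ_[p]) :
    IsSolutionValue B n ζ v' ((algebraMap (WittVector p k) K(p, k) (zpToWitt p k z)) • x) := by
  obtain ⟨g, f, y, hg, hf, hfg, hy, rfl⟩ := h
  set w := zpToWitt p k z with hw
  set a := algebraMap (WittVector p k) K(p, k) w with ha
  have hσ : φ(p, k) a = a := by
    rw [ha, frobenius_algebraMap, hw, frobenius_zpToWitt]
  refine ⟨fun i => C w * g i, fun i => C a * f i, fun i => algebraMap _ _ a * y i, fun i => ?_,
    fun i j hj => ?_, fun i => ?_, fun i => ?_, ?_⟩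
  · obtain ⟨c, hc0, hc⟩ := hg i
    refine ⟨fun i => C w * c i, by simp [hc0], ?_⟩
    dsimp only
    rw [hc, Finset.mul_sum]
    refine Finset.sum_congr rfl fun i _ => ?_
    rw [map_mul, phiPS_C, hw, frobenius_zpToWitt, mul_left_comm]
  · obtain ⟨c, hc⟩ := hf i j hj
    refine ⟨c, fun m => ?_⟩
    obtain ⟨b, hb⟩ := hc m
    exact ⟨w * b, by rw [coeff_C_mul, map_mul, hb]; ring⟩
  · have h1 : semiPS B (fun i => C a * f i) i = C a * semiPS B f i := by
      simp only [semiPS, map_mul, phiPS_C, hσ, Finset.mul_sum]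
      exact Finset.sum_congr rfl fun l _ => by ring
    rw [h1, ← mul_sub, hfg, map_mul, PowerSeries.map_C]
  · have h1 := (hy i).const_mul a
    rwa [map_mul, PowerSeries.map_C, ha, hw, frobInvPow_zpToWitt]
  · rw [Finset.smul_sum]
    refine Finset.sum_congr rfl fun i _ => ?_
    rw [TensorProduct.smul_tmul', Algebra.smul_def]

theorem sum_values_tmul {α : Type*} (s : Finset α) (c : α → ι → K(p, k)) (d : ι → K(p, k))
    (z : α → E) (v' : ι → V') :
    ∑ i, (∑ j ∈ s, algebraMap K(p, k) E (c j i) * z j + algebraMap K(p, k) E (d i))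
        ⊗ₜ[K(p, k)] v' i
      = ∑ j ∈ s, z j ⊗ₜ[K(p, k)] (∑ i, c j i • v' i) + 1 ⊗ₜ[K(p, k)] (∑ i, d i • v' i) := by
  simp only [TensorProduct.add_tmul, TensorProduct.sum_tmul, TensorProduct.tmul_sum,
    Finset.sum_add_distrib, TensorProduct.tmul_smul, TensorProduct.smul_tmul', Algebra.smul_def,
    mul_one]
  rw [Finset.sum_comm]

/-- The map `u ↦ ζ ^ b ⊗ ∑ σ ^ (-n) (u i) v i`. -/
noncomputable def twistedTmul (n : ℕ) (ζ : E) (v' : ι → V') (b : ℕ) :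
    (ι → K(p, k)) →+ E ⊗[K(p, k)] V' where
  toFun u := (ζ ^ b) ⊗ₜ[K(p, k)] (∑ i, frobInvPow p k n (u i) • v' i)
  map_zero' := by simp
  map_add' u v := by
    simp only [Pi.add_apply, map_add, add_smul, Finset.sum_add_distrib, TensorProduct.tmul_add]

/-- The saturation Q of A contains the monomial values for arbitrary u, so `mem_of_sum_mem` gives
every element ζ^b ⊗ m, and these generate the tensor product. -/
theorem exists_pow_smul_isSolutionValue {B : ι → ι → K(p, k)} {N : ℕ} {ζ : E}
    (hζ : IsPrimitiveRoot ζ (p ^ (N + 1)))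
    (hB : ∀ (m : ℕ) (y : ι → K(p, k)), ∃ u, u - (p : K(p, k)) ^ m • semi B u = y)
    (hB0 : ∀ u, semi B u = u → u = 0)
    (hB' : ∀ y : ι → K(p, k), ∃ u, (p : K(p, k)) • semi B u - u = y)
    (hsurj : Function.Surjective (semi B))
    (hgen : Algebra.adjoin K(p, k) {ζ} = ⊤)
    {v' : ι → V'} (hv' : Submodule.span K(p, k) (Set.range v') = ⊤)
    {A : AddSubgroup (E ⊗[K(p, k)] V')}
    (hA : ∀ x, x ∈ A ↔ IsSolutionValue B (N + 1) ζ v' x) (x : E ⊗[K(p, k)] V') :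
    ∃ M : ℕ, (p ^ M : ℕ) • x ∈ A := by
  let Q : AddSubgroup (E ⊗[K(p, k)] V') :=
    { carrier := {x | ∃ M : ℕ, (p ^ M : ℕ) • x ∈ A}
      zero_mem' := ⟨0, by simp⟩
      add_mem' := by
        rintro x y ⟨M, hM⟩ ⟨M', hM'⟩
        refine ⟨M + M', ?_⟩
        rw [smul_add]
        refine A.add_mem ?_ ?_
        · rw [pow_add, mul_comm, mul_smul]; exact A.nsmul_mem hM _
        · rw [pow_add, mul_smul]; exact A.nsmul_mem hM' _
      neg_mem' := by
        rintro x ⟨M, hM⟩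
        exact ⟨M, by rw [smul_neg]; exact A.neg_mem hM⟩ }
  have hQ : ∀ x, p • x ∈ Q → x ∈ Q := by
    rintro x ⟨M, hM⟩
    exact ⟨M + 1, by rwa [pow_succ, mul_smul]⟩
  let F : (ι → K(p, k)) →+ (ι → K(p, k)) := AddMonoidHom.mk' (semi B) (semi_add B)
  let e := twistedTmul (p := p) (k := k) (N + 1) ζ v'
  have he : ∀ b u, e b u = (ζ ^ b) ⊗ₜ[K(p, k)] (∑ i, frobInvPow p k (N + 1) (u i) • v' i) :=
    fun _ _ => rfl
  have hQe : ∀ b u, e b u ∈ Q := by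
    refine mem_of_sum_mem (N := N) hQ (F := F) (e := e) (fun b u => ?_) (fun b u => ?_)
      (fun a ha u => ?_) (fun y => ?_) (fun y => ?_) hsurj
    · rw [he, he, pow_add, hζ.pow_eq_one, mul_one]
    · simp only [he]
      rw [← TensorProduct.sum_tmul]
      simp only [pow_add, ← Finset.mul_sum]
      have := sum_pow_mul_eq_zero hζ
      simp only [mul_comm (p ^ N)] at this
      rw [this, mul_zero, TensorProduct.zero_tmul]
    -- Scaling by p^M makes u - F u integral, hence the coefficient vector of an admissible
    -- monomial. Since φ fixes p^M, the value is scaled by the same power, which Q ignores.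
    · obtain ⟨M, hM⟩ := exists_pow_mul_mem_forall (u - F u)
      choose w hw using hM
      set s := (p : K(p, k)) ^ M with hs
      have hσ : φ(p, k) s = s := by rw [hs, map_pow, map_natCast]
      have hF : ∀ x, F (s • x) = s • F x := fun x => by
        have := semi_smul B s x
        rwa [hσ] at this
      have hit : ∀ j x, F^[j] (s • x) = s • F^[j] x := fun j x =>
        (Function.Commute.iterate_left (f := F) (g := fun y => s • y) hF j) x
      have hes : ∀ b x, e b (s • x) = (p ^ M : ℕ) • e b x := fun b x => by
        rw [he, he, ← Nat.cast_smul_eq_nsmul K(p, k), Nat.cast_pow, ← hs,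
          ← TensorProduct.tmul_smul, Finset.smul_sum]
        simp only [Pi.smul_apply, smul_eq_mul, map_mul, mul_smul]
        rw [hs, map_pow, map_natCast]
      have hsub : s • (u - F u) = s • u - F (s • u) := by rw [smul_sub, hF]
      have hw' : ∀ i, algebraMap _ _ (w i) = (s • u) i - semi B (s • u) i := fun i => by
        rw [hw i]
        exact congrFun hsub i
      obtain ⟨g, f, hg, hf, hfg, hy⟩ :=
        exists_monomial_value hζ.pow_eq_one hB hB0 ha _ w hw'
      refine ⟨M, (hA _).2 ⟨g, f, _, hg, hf, hfg, hy, ?_⟩⟩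
      rw [sum_values_tmul (Finset.range (N + 1)) (fun j i => frobInvPow p k (N + 1)
        ((semi B)^[j] (s • u - semi B (s • u)) i))
        (fun i => frobInvPow p k (N + 1) ((semi B)^[N + 1] (s • u) i))]
      rw [smul_add, Finset.smul_sum]
      congr 1
      · refine Finset.sum_congr rfl fun j _ => ?_
        rw [← hes, ← hit, hsub]
        rfl
      · rw [← hes, ← hit, he, pow_zero]
        rfl
    · obtain ⟨u, hu⟩ := hB 0 y
      exact ⟨u, by rw [← hu, pow_zero, one_smul]; rfl⟩
    · obtain ⟨u, hu⟩ := hB' y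
      exact ⟨u, by rw [← hu, Nat.cast_smul_eq_nsmul]; rfl⟩
  change x ∈ Q
  induction x using TensorProduct.induction_on with
  | zero => exact Q.zero_mem
  | add x y hx hy => exact Q.add_mem hx hy
  | tmul z m =>
    have hz : z ∈ Algebra.adjoin K(p, k) {ζ} := hgen ▸ Algebra.mem_top
    rw [Algebra.adjoin_singleton_eq_range_aeval] at hz
    obtain ⟨P, rfl⟩ := hz
    rw [AlgHom.toRingHom_eq_coe, RingHom.coe_coe, Polynomial.aeval_eq_sum_range,
      TensorProduct.sum_tmul]
    refine Q.sum_mem fun b _ => ?_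
    rw [TensorProduct.smul_tmul]
    obtain ⟨c, hc⟩ := (Submodule.mem_span_range_iff_exists_fun K(p, k)).1
      (hv' ▸ Submodule.mem_top : P.coeff b • m ∈ Submodule.span K(p, k) (Set.range v'))
    -- Applying φ^{N+1} to the coordinates undoes the twist built into e.
    have h1 := hQe b (fun i => φ(p, k)^[N + 1] (c i))
    rw [he] at h1
    simp only [frobInvPow_iterate, frobenius_iterate_frobInvPow] at h1
    rwa [hc] at h1

end Coordinates

/-! ### The two relative indices in coordinates. -/

section CoordinateIndex

variable {p : ℕ} [Fact p.Prime] {k : Type*} [Field k] [Finite k] [CharP k p]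
variable {ι : Type*} [Fintype ι]
variable {E : Type*} [Field E] [Algebra K(p, k) E]
variable {V' : Type*} [AddCommGroup V'] [Module K(p, k) V'] [Module (WittVector p k) V']
variable [IsScalarTower (WittVector p k) K(p, k) V']

theorem finrank_eq_zpRank (M : Type*) [AddCommGroup M] [Module (WittVector p k) M]
    [Module.Finite (WittVector p k) M] [Module.IsTorsionFree (WittVector p k) M] :
    letI : Module ℤ_[p] M := Module.compHom M (zpToWitt p k)
    Module.Finite ℤ_[p] M ∧ Module.Free ℤ_[p] M ∧ Module.finrank ℤ_[p] M = zpRank p k M := by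
  let _ : Module ℤ_[p] M := Module.compHom M (zpToWitt p k)
  have hfin : Module.Finite ℤ_[p] M := finite_compHom p M
  have htf : Module.IsTorsionFree ℤ_[p] M := by
    refine Module.IsTorsionFree.of_smul_eq_zero fun z m h => ?_
    have h1 : zpToWitt p k z • m = 0 := h
    rcases smul_eq_zero.1 h1 with h2 | h2
    · exact Or.inl (zpToWitt_injective p k (h2.trans (map_zero _).symm))
    · exact Or.inr h2
  exact ⟨hfin, inferInstance, rfl⟩

/-- The bound for `[A : A ∩ L]`. -/
theorem relIndex_le_of_mem_valueSpan [Algebra (WittVector p k) E]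
    [IsScalarTower (WittVector p k) K(p, k) E] {N r s₁ s₂ : ℕ} {ζ : E}
    (hζ : IsPrimitiveRoot ζ (p ^ (N + 1))) {v' : ι → V'}
    {A L : AddSubgroup (E ⊗[K(p, k)] V')} {M : Submodule (WittVector p k) V'}
    (hM : M = Submodule.span _ (Set.range v'))
    (hL : L = AddSubgroup.closure
      {z | ∃ a : E, IsInt p (k := k) a ∧ ∃ m ∈ M, z = a ⊗ₜ[K(p, k)] m})
    (hA : ∀ x ∈ A, ∃ y : ι → E, (∀ i, y i ∈ valueSpan k r s₁ s₂ N ζ) ∧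
      x = ∑ i, y i ⊗ₜ[K(p, k)] v' i) :
    L.relIndex A ≠ 0 ∧ L.relIndex A ≤
      p ^ ((r * (p ^ N + p - 2) + s₂ * (p - 1) + s₁ * (p ^ N * (p - 1))) * zpRank p k M) := by
  have hMfin : Module.Finite (WittVector p k) M := by
    rw [Module.Finite.iff_fg, hM]
    exact Submodule.fg_span (Set.finite_range v')
  have hVtf : Module.IsTorsionFree (WittVector p k) V' := by
    refine Module.IsTorsionFree.of_smul_eq_zero fun w m h => ?_
    rw [← algebraMap_smul K(p, k) w m] at h
    rcases smul_eq_zero.1 h with h2 | h2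
    · exact Or.inl (IsFractionRing.injective (WittVector p k) K(p, k) (h2.trans (map_zero _).symm))
    · exact Or.inr h2
  let _ : Module ℤ_[p] M := Module.compHom M (zpToWitt p k)
  obtain ⟨hfin, hfree, hrank⟩ := finrank_eq_zpRank (p := p) (k := k) M
  have hp0 := p_ne_zero p k E
  let u : GenIdx p N → M →+ E ⊗[K(p, k)] V' := fun x =>
    { toFun := fun m => (((p : E) ^ genDenom r s₁ s₂ x)⁻¹ * ζ ^ genExp x) ⊗ₜ[K(p, k)] (m : V')
      map_zero' := by simp
      map_add' := fun m m' => by rw [Submodule.coe_add, TensorProduct.tmul_add] }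
  rw [← sum_genDenom, ← hrank]
  refine relIndex_le_of_generators u (genDenom r s₁ s₂) (fun x m => ?_) (fun a ha => ?_)
  · have h1 : u x ((p ^ genDenom r s₁ s₂ x : ℕ) • m) = (ζ ^ genExp x) ⊗ₜ[K(p, k)] (m : V') := by
      rw [map_nsmul]
      change (p ^ genDenom r s₁ s₂ x : ℕ) • ((_ * _) ⊗ₜ[K(p, k)] (m : V')) = _
      rw [TensorProduct.smul_tmul']
      congr 1
      rw [nsmul_eq_mul, Nat.cast_pow, ← mul_assoc, mul_inv_cancel₀ (pow_ne_zero _ hp0), one_mul]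
    rw [h1, hL]
    exact AddSubgroup.subset_closure ⟨_, (IsInt.of_pow_eq_one
      (pow_pos (Fact.out : p.Prime).pos _) hζ.pow_eq_one).pow _, m, m.2, rfl⟩
  · obtain ⟨y, hy, rfl⟩ := hA a ha
    have hvM : ∀ i, v' i ∈ M := fun i => hM ▸ Submodule.subset_span ⟨i, rfl⟩
    choose w hw using fun i => (Submodule.mem_span_range_iff_exists_fun _).1 (hy i)
    -- The W(k)-coefficients of the generators move across the tensor sign into M, so one copy of M
    -- per generator suffices and the index involves only the rank of M.
    refine ⟨fun x => ∑ i, w i x • ⟨v' i, hvM i⟩, ?_⟩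
    have h1 : ∀ x, u x (∑ i, w i x • (⟨v' i, hvM i⟩ : M)) = ∑ i,
        (w i x • (((p : E) ^ genDenom r s₁ s₂ x)⁻¹ * ζ ^ genExp x)) ⊗ₜ[K(p, k)] v' i := by
      intro x
      rw [map_sum]
      refine Finset.sum_congr rfl fun i _ => ?_
      change (_ * _) ⊗ₜ[K(p, k)] (w i x • v' i) = _
      rw [← algebraMap_smul K(p, k) (w i x) (v' i), ← TensorProduct.smul_tmul, algebraMap_smul]
    simp only [h1]
    rw [Finset.sum_comm]
    refine Finset.sum_congr rfl fun i _ => ?_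
    rw [← TensorProduct.sum_tmul, hw]

/-- The lattice L is contained in the image of O_E × M under a ℤ_p-bilinear map. Both factors are
finite over ℤ_p: characteristic 0 makes E separable over F, so O_E is finite over W(k). -/
theorem relIndex_ne_zero_of_forall_pow_smul [FiniteDimensional K(p, k) E] {v' : ι → V'}
    {A L : AddSubgroup (E ⊗[K(p, k)] V')} {M : Submodule (WittVector p k) V'}
    (hM : M = Submodule.span _ (Set.range v'))
    (hL : L = AddSubgroup.closure
      {z | ∃ a : E, IsInt p (k := k) a ∧ ∃ m ∈ M, z = a ⊗ₜ[K(p, k)] m})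
    (hsmul : ∀ (z : ℤ_[p]), ∀ a ∈ A,
      (algebraMap (WittVector p k) K(p, k) (zpToWitt p k z)) • a ∈ A)
    (hA : ∀ x : E ⊗[K(p, k)] V', ∃ m : ℕ, (p ^ m : ℕ) • x ∈ A) : A.relIndex L ≠ 0 := by
  let _ : Algebra (WittVector p k) E :=
    ((algebraMap K(p, k) E).comp (algebraMap (WittVector p k) K(p, k))).toAlgebra
  have : IsScalarTower (WittVector p k) K(p, k) E := IsScalarTower.of_algebraMap_eq fun _ => rfl
  have := charZero_fraction p k
  have hOfin : Module.Finite (WittVector p k) (integralClosure (WittVector p k) E) :=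
    IsIntegralClosure.finite (WittVector p k) K(p, k) E _
  have hMfin : Module.Finite (WittVector p k) M := by
    rw [Module.Finite.iff_fg, hM]
    exact Submodule.fg_span (Set.finite_range v')
  let _ : Module ℤ_[p] M := Module.compHom M (zpToWitt p k)
  let _ : Module ℤ_[p] (integralClosure (WittVector p k) E) :=
    Module.compHom _ (zpToWitt p k)
  let _ : Module ℤ_[p] (E ⊗[K(p, k)] V') :=
    Module.compHom _ ((algebraMap (WittVector p k) K(p, k)).comp (zpToWitt p k))
  have h1 : Module.Finite ℤ_[p] M := finite_compHom p M
  have h2 : Module.Finite ℤ_[p] (integralClosure (WittVector p k) E) := finite_compHom p _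
  have hM_smul : ∀ (z : ℤ_[p]) (m : M), ((z • m : M) : V')
      = algebraMap (WittVector p k) K(p, k) (zpToWitt p k z) • (m : V') := fun z m => by
    rw [algebraMap_smul]; rfl
  have hO_smul : ∀ (z : ℤ_[p]) (a : integralClosure (WittVector p k) E), ((z • a :
      integralClosure (WittVector p k) E) : E)
      = algebraMap (WittVector p k) K(p, k) (zpToWitt p k z) • (a : E) := fun z m => by
    rw [algebraMap_smul]; rfl
  have ht_smul : ∀ (z : ℤ_[p]) (x : E ⊗[K(p, k)] V'), z • x
      = algebraMap (WittVector p k) K(p, k) (zpToWitt p k z) • x := fun _ _ => rfl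
  let f : integralClosure (WittVector p k) E →ₗ[ℤ_[p]] M →ₗ[ℤ_[p]] (E ⊗[K(p, k)] V') :=
    LinearMap.mk₂ ℤ_[p] (fun a m => (a : E) ⊗ₜ[K(p, k)] (m : V'))
      (fun a a' m => TensorProduct.add_tmul _ _ _)
      (fun z a m => by rw [hO_smul, ht_smul, TensorProduct.smul_tmul'])
      (fun a m m' => TensorProduct.tmul_add _ _ _)
      (fun z a m => by rw [hM_smul, ht_smul, TensorProduct.tmul_smul])
  have hS : (Submodule.map₂ f ⊤ ⊤).FG := Submodule.FG.map₂ f Module.Finite.fg_top Module.Finite.fg_top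
  refine relIndex_ne_zero_of_fg hS (fun x hx => ?_) hsmul hA
  have hle : L ≤ (Submodule.map₂ f ⊤ ⊤).toAddSubgroup := by
    rw [hL, AddSubgroup.closure_le]
    rintro _ ⟨a, ha, m, hm, rfl⟩
    exact Submodule.apply_mem_map₂ f (m := ⟨a, ha⟩) (n := ⟨m, hm⟩) Submodule.mem_top
      Submodule.mem_top
  exact hle hx

end CoordinateIndex

/-! ### The degree of F_n over F. -/

section Cyclotomic

open Polynomial

variable (p : ℕ) [Fact p.Prime] (k : Type*) [Field k] [Finite k] [CharP k p]

/-- The Eisenstein condition passes from ℤ to W(k) because p is still a uniformizer there; the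
constant term is exactly p. -/
theorem isEisensteinAt_cyclotomic (n : ℕ) :
    ((cyclotomic (p ^ (n + 1)) (WittVector p k)).comp (X + 1)).IsEisensteinAt
      (Ideal.span {(p : WittVector p k)}) := by
  have hZ := cyclotomic_prime_pow_comp_X_add_one_isEisensteinAt p n
  have hmap : (cyclotomic (p ^ (n + 1)) (WittVector p k)).comp (X + 1)
      = ((cyclotomic (p ^ (n + 1)) ℤ).comp (X + 1)).map (Int.castRingHom (WittVector p k)) := by
    rw [Polynomial.map_comp, map_cyclotomic_int]
    simp
  have hmonicZ : ((cyclotomic (p ^ (n + 1)) ℤ).comp (X + 1)).Monic := by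
    have := (cyclotomic.monic (p ^ (n + 1)) ℤ).comp_X_add_C 1
    simpa using this
  have hp_irr := WittVector.irreducible (k := k) p
  have hmem : ∀ {i : ℕ}, i < ((cyclotomic (p ^ (n + 1)) ℤ).comp (X + 1)).natDegree →
      ((cyclotomic (p ^ (n + 1)) (WittVector p k)).comp (X + 1)).coeff i ∈
        Ideal.span {(p : WittVector p k)} := by
    intro i hi
    have h1 := hZ.mem hi
    rw [hmap, coeff_map]
    rw [Ideal.submodule_span_eq, Ideal.mem_span_singleton] at h1
    rw [Ideal.mem_span_singleton]
    have := map_dvd (Int.castRingHom (WittVector p k)) h1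
    simpa using this
  refine ⟨?_, fun {i} hi => hmem (by rwa [hmap, hmonicZ.natDegree_map] at hi), ?_⟩
  · rw [hmap, (hmonicZ.map _).leadingCoeff]
    intro h
    rw [Ideal.mem_span_singleton] at h
    exact hp_irr.not_isUnit (isUnit_of_dvd_one h)
  · rw [coeff_zero_eq_eval_zero, eval_comp]
    simp only [eval_add, eval_X, eval_one, zero_add]
    rw [eval_one_cyclotomic_prime_pow, Ideal.span_singleton_pow, Ideal.mem_span_singleton]
    rintro ⟨c, hc⟩
    rw [sq, mul_assoc] at hc
    have h1 : (p : WittVector p k) * c = 1 :=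
      mul_left_cancel₀ hp_irr.ne_zero (by rw [← hc, mul_one])
    exact hp_irr.not_isUnit (isUnit_of_dvd_one ⟨c, h1.symm⟩)

theorem irreducible_cyclotomic (n : ℕ) :
    Irreducible (cyclotomic (p ^ (n + 1)) K(p, k)) := by
  have hmonic : ((cyclotomic (p ^ (n + 1)) (WittVector p k)).comp (X + 1)).Monic := by
    have := (cyclotomic.monic (p ^ (n + 1)) (WittVector p k)).comp_X_add_C 1
    simpa using this
  have hprime : (Ideal.span {(p : WittVector p k)}).IsPrime :=
    (Ideal.span_singleton_prime (WittVector.irreducible p).ne_zero).2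
      (WittVector.irreducible p).prime
  have hdeg : 0 < ((cyclotomic (p ^ (n + 1)) (WittVector p k)).comp (X + 1)).natDegree := by
    rw [← C_1, natDegree_comp, natDegree_X_add_C, mul_one, natDegree_cyclotomic]
    exact Nat.totient_pos.2 (pow_pos (Fact.out : p.Prime).pos _)
  have h1 := (isEisensteinAt_cyclotomic p k n).irreducible hprime hmonic.isPrimitive hdeg
  rw [hmonic.irreducible_iff_irreducible_map_fraction_map (K := K(p, k))] at h1
  have h2 : ((cyclotomic (p ^ (n + 1)) (WittVector p k)).comp (X + 1)).map
      (algebraMap (WittVector p k) K(p, k))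
      = algEquivAevalXAddC (1 : K(p, k)) (cyclotomic (p ^ (n + 1)) K(p, k)) := by
    rw [Polynomial.map_comp, map_cyclotomic, algEquivAevalXAddC_apply]
    simp [comp, aeval_def]
  rw [h2] at h1
  exact (MulEquiv.irreducible_iff (algEquivAevalXAddC (1 : K(p, k)))).1 h1

end Cyclotomic

/-! ### Injectivity of the crystalline Frobenius. -/

section Comparison

variable {p : ℕ} [Fact p.Prime] {k : Type*} [Field k] [Finite k] [CharP k p]
variable {T : Type*} [AddCommGroup T] [Module ℤ_[p] T]

/-- The Frobenius of `B_cris ⊗ T` as a semilinear map. -/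
noncomputable def phiBT (p : ℕ) [Fact p.Prime] (k : Type*) [Field k] [Finite k] [CharP k p]
    (T : Type*) [AddCommGroup T] [Module ℤ_[p] T] : BT p k T →ₛₗ[phiB p k] BT p k T where
  toFun := phiTensor p k T
  map_add' := map_add (phiTensor p k T)
  map_smul' b x := by
    induction x using TensorProduct.induction_on with
    | zero =>
      change phiTensor p k T (b • (0 : BcrisF p k ⊗[ℤ_[p]] T)) = phiB p k b •
        phiTensor p k T (0 : BcrisF p k ⊗[ℤ_[p]] T)
      simp
    | add x y hx hy =>
      change phiTensor p k T (b • ((x + y : BcrisF p k ⊗[ℤ_[p]] T))) = phiB p k b •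
        phiTensor p k T (x + y : BcrisF p k ⊗[ℤ_[p]] T)
      rw [smul_add, map_add, map_add, smul_add]
      exact congrArg₂ (· + ·) hx hy
    | tmul c t =>
      change phiTensor p k T (b • (c ⊗ₜ[ℤ_[p]] t)) = phiB p k b • phiTensor p k T (c ⊗ₜ[ℤ_[p]] t)
      rw [TensorProduct.smul_tmul', phiTensor, TensorProduct.map_tmul, TensorProduct.map_tmul,
        TensorProduct.smul_tmul']
      congr 1
      exact map_mul (phiB p k) b c

/-- The Frobenius of `D_cris(V)` is injective if `V` is crystalline. -/
theorem phiD_injective [Module.Finite ℤ_[p] T] {ρ : Representation ℤ_[p] (GalF p k) T}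
    (hcris : IsCrystalline p ρ) {ι : Type*} [Finite ι]
    (e : Module.Basis ι K(p, k) (Dcris p ρ)) : Function.Injective (phiD p ρ) := by
  have := Fintype.ofFinite ι
  let c : BcrisF p k ⊗[K(p, k)] Dcris p ρ ≃ₗ[BcrisF p k] BT p k T :=
    LinearEquiv.ofBijective _ hcris
  let e' : Module.Basis ι (BcrisF p k) (BT p k T) := (e.baseChange (BcrisF p k)).map c
  have he' : ∀ i, e' i = (e i : BT p k T) := fun i => by
    simp only [e', Module.Basis.map_apply, Module.Basis.baseChange_apply]
    change (Dcris p ρ).subtype.liftBaseChange (BcrisF p k) (1 ⊗ₜ e i) = _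
    simp
  -- By the comparison isomorphism a basis of D_cris(V) is a basis of B_cris ⊗ T. This h is the
  -- linearization of Frobenius, and the argument never uses injectivity of Frobenius on B_cris.
  let h : BT p k T →ₗ[BcrisF p k] BT p k T :=
    e'.constr (BcrisF p k) fun i => phiBT p k T (e i)
  have hh : ∀ i, h (e i) = phiBT p k T (e i) := fun i => by
    rw [← he' i, Module.Basis.constr_basis, he' i]
  have hrange : ∀ y, phiBT p k T y ∈ LinearMap.range h := by
    intro y
    rw [← e'.sum_repr y, map_sum]
    refine Submodule.sum_mem _ fun i _ => ?_
    rw [map_smulₛₗ, he', ← hh]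
    exact Submodule.smul_mem _ _ ⟨_, rfl⟩
  -- Frobenius fixes every 1 ⊗ t, so these elements lie in the range of h, and they generate over
  -- B_cris. A surjective endomorphism of a finite module is injective.
  have hsurj : Function.Surjective h := by
    intro z
    rw [← LinearMap.mem_range]
    induction z using TensorProduct.induction_on with
    | zero => exact Submodule.zero_mem _
    | add x y hx hy => exact Submodule.add_mem _ hx hy
    | tmul b t =>
      have h1 : phiBT p k T ((1 : BcrisF p k) ⊗ₜ[ℤ_[p]] t : BcrisF p k ⊗[ℤ_[p]] T)
          = ((1 : BcrisF p k) ⊗ₜ[ℤ_[p]] t : BcrisF p k ⊗[ℤ_[p]] T) := by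
        change phiTensor p k T _ = _
        rw [phiTensor, TensorProduct.map_tmul]
        congr 1
        exact map_one (phiB p k)
      have h2 := Submodule.smul_mem _ b (hrange ((1 : BcrisF p k) ⊗ₜ[ℤ_[p]] t :
        BcrisF p k ⊗[ℤ_[p]] T))
      rw [h1] at h2
      have h3 : (b • ((1 : BcrisF p k) ⊗ₜ[ℤ_[p]] t) : BcrisF p k ⊗[ℤ_[p]] T)
          = b ⊗ₜ[ℤ_[p]] t := by
        rw [TensorProduct.smul_tmul', smul_eq_mul, mul_one]
      obtain ⟨w, hw⟩ := h2
      exact ⟨w, hw.trans h3⟩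
  have hfin : Module.Finite (BcrisF p k) (BT p k T) := Module.Finite.of_basis e'
  have hinj : Function.Injective h := OrzechProperty.injective_of_surjective_endomorphism h hsurj
  rw [injective_iff_map_eq_zero]
  intro x hx
  -- Twisting the coordinates turns the semilinear value φ(x) into the linear value h(y); the twist
  -- loses nothing because σ is injective on F.
  let y : Dcris p ρ := ∑ i, φ(p, k) (e.repr x i) • e i
  have hy : h y = phiBT p k T x := by
    have h3 : (y : BT p k T) = ∑ i, algebraMap K(p, k) (BcrisF p k) (φ(p, k) (e.repr x i)) •
        (e i : BT p k T) := by
      simp only [y, algebraMap_smul]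
      rw [AddSubmonoidClass.coe_finsetSum]
      rfl
    have h4 : (x : BT p k T) = ∑ i, algebraMap K(p, k) (BcrisF p k) (e.repr x i) •
        (e i : BT p k T) := by
      conv_lhs => rw [← e.sum_repr x]
      simp only [algebraMap_smul]
      rw [AddSubmonoidClass.coe_finsetSum]
      rfl
    rw [h3, h4, map_sum, map_sum]
    refine Finset.sum_congr rfl fun i _ => ?_
    rw [map_smul, map_smulₛₗ, hh, phiB_algebraMap]
  have hx' : phiBT p k T x = 0 := congrArg Subtype.val hx
  rw [hx'] at hy
  have hy0 : y = 0 := Subtype.ext (hinj (hy.trans (map_zero h).symm))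
  have h5 : ∀ i, φ(p, k) (e.repr x i) = 0 := fun i => by
    have h6 := e.repr_sum_self fun i => φ(p, k) (e.repr x i)
    change ⇑(e.repr y) = _ at h6
    rw [hy0, map_zero] at h6
    exact (congrFun h6 i).symm
  refine e.repr.map_eq_zero_iff.1 (Finsupp.ext fun i => ?_)
  exact (map_eq_zero_iff _ (RingHom.injective _)).1 (h5 i)

end Comparison

/-! ### Translating the hypotheses on D and φ into matrix coordinates. -/

section LatticeCoordinates

open PowerSeries

variable {p : ℕ} [Fact p.Prime] {k : Type*} [Field k] [Finite k] [CharP k p]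
variable {V : Type*} [AddCommGroup V] [Module K(p, k) V] [Module (WittVector p k) V]
variable [IsScalarTower (WittVector p k) K(p, k) V]
variable {D : Submodule (WittVector p k) V} {ι : Type*} [Fintype ι]

theorem span_range_coe_basis (v : Module.Basis ι (WittVector p k) D) :
    Submodule.span (WittVector p k) (Set.range fun i => (v i : V)) = D := by
  have h : (Set.range fun i => (v i : V)) = D.subtype '' Set.range v := by
    rw [← Set.range_comp]; rfl
  rw [h, ← Submodule.map_span, v.span_eq, Submodule.map_top, Submodule.range_subtype]

/-- The basis of `V` given by a basis of a lattice. -/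
noncomputable def latticeBasis (hD : Submodule.span K(p, k) (D : Set V) = ⊤)
    (v : Module.Basis ι (WittVector p k) D) : Module.Basis ι K(p, k) V :=
  Module.Basis.mk (v := fun i => (v i : V))
    ((LinearIndependent.iff_fractionRing (R := WittVector p k) (K := K(p, k))).1
      (v.linearIndependent.map' D.subtype (Submodule.ker_subtype D))) (by
    rw [← hD, Submodule.span_le]
    intro x hx
    rw [SetLike.mem_coe, ← span_range_coe_basis v] at hx
    exact Submodule.span_le_restrictScalars (WittVector p k) K(p, k) _ hx)

variable (hD : Submodule.span K(p, k) (D : Set V) = ⊤) (v : Module.Basis ι (WittVector p k) D)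

theorem latticeBasis_apply (i : ι) : latticeBasis hD v i = (v i : V) :=
  Module.Basis.mk_apply _ _ i

theorem mem_iff_latticeBasis_repr (x : V) :
    x ∈ D ↔ ∀ i, (latticeBasis hD v).repr x i ∈ wittRange p k := by
  constructor
  · intro hx i
    rw [← span_range_coe_basis v] at hx
    obtain ⟨c, rfl⟩ := (Submodule.mem_span_range_iff_exists_fun _).1 hx
    refine ⟨c i, ?_⟩
    have h : ∑ j, c j • (v j : V) = ∑ j, algebraMap _ K(p, k) (c j) • latticeBasis hD v j :=
      Finset.sum_congr rfl fun j _ => by rw [latticeBasis_apply, algebraMap_smul]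
    rw [h, (latticeBasis hD v).repr_sum_self]
  · intro h
    choose c hc using h
    rw [← (latticeBasis hD v).sum_repr x]
    refine Submodule.sum_mem _ fun i _ => ?_
    rw [← hc i, algebraMap_smul, latticeBasis_apply]
    exact Submodule.smul_mem _ _ (v i).2

variable (F : V →ₛₗ[φ(p, k)] V)

/-- The matrix of a semilinear endomorphism in the basis of a lattice. -/
noncomputable def frobMatrix (i l : ι) : K(p, k) :=
  (latticeBasis hD v).repr (F (latticeBasis hD v l)) i

theorem repr_frob (x : V) :
    ⇑((latticeBasis hD v).repr (F x)) = semi (frobMatrix hD v F) ((latticeBasis hD v).repr x) := by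
  ext i
  conv_lhs => rw [← (latticeBasis hD v).sum_repr x]
  simp only [map_sum, map_smulₛₗ, Finsupp.coe_finsetSum, Finset.sum_apply, Finsupp.smul_apply,
    smul_eq_mul, semi, frobMatrix, RingHom.id_apply]
  exact Finset.sum_congr rfl fun l _ => mul_comm _ _

theorem repr_frob_iterate (j : ℕ) (x : V) : ⇑((latticeBasis hD v).repr (F^[j] x))
    = (semi (frobMatrix hD v F))^[j] ((latticeBasis hD v).repr x) := by
  induction j with
  | zero => rfl
  | succ j ih => rw [Function.iterate_succ_apply', repr_frob, ih, Function.iterate_succ_apply']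

theorem exists_repr_eq (u : ι → K(p, k)) : ∃ x, ⇑((latticeBasis hD v).repr x) = u :=
  ⟨∑ i, u i • latticeBasis hD v i, (latticeBasis hD v).repr_sum_self u⟩

theorem repr_nsmul (m : ℕ) (x : V) :
    ⇑((latticeBasis hD v).repr (m • x)) = (m : K(p, k)) • ⇑((latticeBasis hD v).repr x) := by
  rw [← Nat.cast_smul_eq_nsmul K(p, k), map_smul]
  rfl

theorem iterate_nsmul_frob (r j : ℕ) (x : V) :
    (fun y => (p ^ r) • F y)^[j] x = (p ^ (r * j)) • F^[j] x := by
  induction j with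
  | zero => simp
  | succ j ih =>
    rw [Function.iterate_succ_apply', Function.iterate_succ_apply', ih, map_nsmul, ← mul_smul,
      ← pow_add, mul_add, mul_one, add_comm]

theorem pow_mul_iterMatrix_mem {r s₁ : ℕ}
    (hs₁ : ∀ (j : ℕ), ∀ x ∈ D, (p ^ s₁) • ((fun y => (p ^ r) • F y)^[j] x) ∈ D) (j : ℕ) (i l : ι) :
    (p : K(p, k)) ^ (r * j + s₁) * iterMatrix (frobMatrix hD v F) j i l ∈ wittRange p k := by
  classical
  have h := (mem_iff_latticeBasis_repr hD v _).1 (hs₁ j (v l) (v l).2) i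
  rw [iterate_nsmul_frob, ← mul_smul, ← pow_add, repr_nsmul, Pi.smul_apply, smul_eq_mul,
    repr_frob_iterate, ← latticeBasis_apply hD v, Module.Basis.repr_self,
    Finsupp.single_eq_pi_single, Nat.cast_pow, add_comm] at h
  convert h using 2
  unfold iterMatrix
  congr!

theorem pow_mul_mem_of_sub_semi_mem {s₂ : ℕ} (hs₂ : ∀ x : V, x - F x ∈ D → (p ^ s₂) • x ∈ D)
    (u : ι → K(p, k)) (hu : ∀ i, u i - semi (frobMatrix hD v F) u i ∈ wittRange p k) (i : ι) :
    (p : K(p, k)) ^ s₂ * u i ∈ wittRange p k := by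
  obtain ⟨x, rfl⟩ := exists_repr_eq hD v u
  have h := (mem_iff_latticeBasis_repr hD v _).1 (hs₂ x ((mem_iff_latticeBasis_repr hD v _).2
    fun i => by
      rw [map_sub, Finsupp.sub_apply, repr_frob]
      exact hu i)) i
  rwa [repr_nsmul, Pi.smul_apply, smul_eq_mul, Nat.cast_pow] at h

theorem semi_frobMatrix_eq_smul {F : V →ₛₗ[φ(p, k)] V}
    (hF : ∀ (m : ℤ) (x : V), F x = (p : K(p, k)) ^ m • x → x = 0) (m : ℤ) (u : ι → K(p, k))
    (hu : semi (frobMatrix hD v F) u = (p : K(p, k)) ^ m • u) : u = 0 := by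
  obtain ⟨x, rfl⟩ := exists_repr_eq hD v u
  have h : F x = (p : K(p, k)) ^ m • x := by
    refine (latticeBasis hD v).repr.injective (DFunLike.coe_injective ?_)
    rw [repr_frob, hu, map_smul]
    rfl
  rw [hF m x h, map_zero]
  rfl

/-- A vector killed by 1 - p^m φ would be an eigenvector of φ for p^{-m}, so the operator is
injective and hence surjective. -/
theorem exists_sub_pow_smul_semi {F : V →ₛₗ[φ(p, k)] V}
    (hF : ∀ (m : ℤ) (x : V), F x = (p : K(p, k)) ^ m • x → x = 0) (m : ℕ) (y : ι → K(p, k)) :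
    ∃ u, u - (p : K(p, k)) ^ m • semi (frobMatrix hD v F) u = y := by
  have hp0 : (p : K(p, k)) ≠ 0 := FractionRing.p_nonzero p k
  obtain ⟨u, hu⟩ := semi_surjective_of_injective (B := frobMatrix hD v F) 1 (-(p : ℤ) ^ m)
    (fun u hu => by
      refine semi_frobMatrix_eq_smul hD v hF (-m) u ?_
      push_cast at hu
      rw [one_smul, neg_smul, ← sub_eq_add_neg, sub_eq_zero] at hu
      conv_rhs => rw [hu]
      rw [smul_smul, zpow_neg, zpow_natCast, inv_mul_cancel₀ (pow_ne_zero _ hp0), one_smul]) y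
  refine ⟨u, ?_⟩
  push_cast at hu
  rwa [one_smul, neg_smul, ← sub_eq_add_neg] at hu

theorem exists_smul_semi_sub {F : V →ₛₗ[φ(p, k)] V}
    (hF : ∀ (m : ℤ) (x : V), F x = (p : K(p, k)) ^ m • x → x = 0) (y : ι → K(p, k)) :
    ∃ u, (p : K(p, k)) • semi (frobMatrix hD v F) u - u = y := by
  obtain ⟨u, hu⟩ := exists_sub_pow_smul_semi hD v hF 1 (-y)
  refine ⟨u, ?_⟩
  rw [← neg_inj, ← hu, neg_sub, pow_one]

theorem semi_frobMatrix_surjective {F : V →ₛₗ[φ(p, k)] V} (hF : Function.Injective F) :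
    Function.Surjective (semi (frobMatrix hD v F)) := by
  intro y
  obtain ⟨u, hu⟩ := semi_surjective_of_injective (B := frobMatrix hD v F) 0 1
    (fun u hu => by
      obtain ⟨x, rfl⟩ := exists_repr_eq hD v u
      rw [Int.cast_zero, Int.cast_one, zero_smul, one_smul, zero_add, ← repr_frob] at hu
      have h1 : F x = 0 := (latticeBasis hD v).repr.injective (DFunLike.coe_injective (by
        rw [hu, map_zero]; rfl))
      rw [hF (h1.trans (map_zero F).symm), map_zero]
      rfl) y
  exact ⟨u, by simpa using hu⟩

/-- Expanding φ(v_l) in the basis and comparing coordinates in the base-changed basis over F⟦X⟧. -/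
theorem sum_tmul_sub_eq_iff (f h : ι → K(p, k)⟦X⟧) :
    (∑ i, f i ⊗ₜ[K(p, k)] (v i : V)) - ∑ i, phiPS p φ(p, k) (f i) ⊗ₜ[K(p, k)] F (v i : V)
        = ∑ i, h i ⊗ₜ[K(p, k)] (v i : V)
      ↔ ∀ i, f i - semiPS (frobMatrix hD v F) f i = h i := by
  have h1 : ∑ i, phiPS p φ(p, k) (f i) ⊗ₜ[K(p, k)] F (v i : V)
      = ∑ i, semiPS (frobMatrix hD v F) f i ⊗ₜ[K(p, k)] (v i : V) := by
    simp only [semiPS, TensorProduct.sum_tmul]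
    rw [Finset.sum_comm]
    refine Finset.sum_congr rfl fun l _ => ?_
    conv_lhs => rw [← (latticeBasis hD v).sum_repr (F (v l : V))]
    rw [TensorProduct.tmul_sum]
    refine Finset.sum_congr rfl fun i _ => ?_
    rw [TensorProduct.tmul_smul, TensorProduct.smul_tmul', PowerSeries.smul_eq_C_mul, frobMatrix,
      latticeBasis_apply, latticeBasis_apply]
  have h2 : ∀ c : ι → K(p, k)⟦X⟧, ∑ i, c i ⊗ₜ[K(p, k)] (v i : V)
      = ∑ i, c i • ((latticeBasis hD v).baseChange K(p, k)⟦X⟧) i := fun c => by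
    refine Finset.sum_congr rfl fun i _ => ?_
    rw [Module.Basis.baseChange_apply, TensorProduct.smul_tmul', smul_eq_mul, mul_one,
      latticeBasis_apply]
  rw [h1, ← Finset.sum_sub_distrib]
  simp only [← TensorProduct.sub_tmul]
  rw [h2, h2]
  constructor
  · intro h3
    have h4 := congrArg (fun z => ⇑(((latticeBasis hD v).baseChange K(p, k)⟦X⟧).repr z)) h3
    simp only [Module.Basis.repr_sum_self] at h4
    exact congrFun h4
  · intro h3
    simp only [h3]

end LatticeCoordinates

/-! ### The subgroups A and L in coordinates, and the final estimate. -/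

section Conclusion

open PowerSeries

variable {p : ℕ} [Fact p.Prime] {k : Type*} [Field k] [Finite k] [CharP k p]
variable {T : Type*} [AddCommGroup T] [Module ℤ_[p] T]
variable {ρ : Representation ℤ_[p] (GalF p k) T}
variable {D : Submodule (WittVector p k) (Dcris p ρ)} {ι : Type*} [Fintype ι]

theorem mem_imageA_iff (hD : Submodule.span K(p, k) (D : Set (Dcris p ρ)) = ⊤)
    (v : Module.Basis ι (WittVector p k) D) {n : ℕ} {ζ : Fn p k n} (x : tangent p ρ n) :
    x ∈ imageA v n ζ ↔ IsSolutionValue (frobMatrix hD v (phiD p ρ)) n ζ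
      (fun i => (filZeroD p ρ).mkQ (v i : Dcris p ρ)) x := by
  constructor
  · rintro ⟨g, hg, f, ⟨hf, hfg⟩, y, hy, hx⟩
    exact ⟨g, f, y, hg, hf, (sum_tmul_sub_eq_iff hD v (phiD p ρ) f _).1 hfg, hy, hx⟩
  · rintro ⟨g, f, y, hg, hf, hfg, hy, hx⟩
    exact ⟨g, hg, f, ⟨hf, (sum_tmul_sub_eq_iff hD v (phiD p ρ) f _).2 hfg⟩, y, hy, hx⟩

theorem map_mkQ_eq_span (v : Module.Basis ι (WittVector p k) D) :
    D.map ((filZeroD p ρ).mkQ.restrictScalars (WittVector p k)) =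
      Submodule.span _ (Set.range fun i => (filZeroD p ρ).mkQ (v i : Dcris p ρ)) := by
  conv_lhs => rw [← span_range_coe_basis v]
  rw [Submodule.map_span, ← Set.range_comp]
  rfl

theorem latticeL_eq (D : Submodule (WittVector p k) (Dcris p ρ)) (n : ℕ) :
    latticeL D n = AddSubgroup.closure {z | ∃ a : Fn p k n, IsInt p (k := k) a ∧
      ∃ m ∈ D.map ((filZeroD p ρ).mkQ.restrictScalars (WittVector p k)),
        z = a ⊗ₜ[K(p, k)] m} := by
  unfold latticeL
  congr 1
  ext z
  constructor
  · rintro ⟨a, ha, x, hx, rfl⟩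
    exact ⟨a, ha, _, Submodule.mem_map_of_mem hx, rfl⟩
  · rintro ⟨a, ha, _, ⟨x, hx, rfl⟩, rfl⟩
    exact ⟨a, ha, x, hx, rfl⟩

theorem span_range_mkQ (hD : Submodule.span K(p, k) (D : Set (Dcris p ρ)) = ⊤)
    (v : Module.Basis ι (WittVector p k) D) :
    Submodule.span K(p, k) (Set.range fun i => (filZeroD p ρ).mkQ (v i : Dcris p ρ)) = ⊤ := by
  have h : (Set.range fun i => (filZeroD p ρ).mkQ (v i : Dcris p ρ))
      = (filZeroD p ρ).mkQ '' Set.range (latticeBasis hD v) := by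
    rw [← Set.range_comp]
    simp only [Function.comp_def, latticeBasis_apply]
  rw [h, ← Submodule.map_span, Module.Basis.span_eq, Submodule.map_top, Submodule.range_mkQ]

end Conclusion

end Crystalline

theorem mainTheorem8 (p : ℕ) [Fact p.Prime] (hp : p ≠ 2)
    {k : Type*} [Field k] [Finite k] [CharP k p]
    {T : Type*} [AddCommGroup T] [Module ℤ_[p] T] [Module.Free ℤ_[p] T] [Module.Finite ℤ_[p] T]
    (ρ : Representation ℤ_[p] (Crystalline.GalF p k) T)
    (hcont : Crystalline.IsPadicContinuous p ρ)
    (hcris : Crystalline.IsCrystalline p ρ)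
    (heigen : Crystalline.HEigen p ρ)
    (D : Submodule (WittVector p k) (Crystalline.Dcris p ρ))
    (hD : Submodule.span K(p, k) (D : Set (Crystalline.Dcris p ρ)) = ⊤)
    {ι : Type*} [Fintype ι] (v : Module.Basis ι (WittVector p k) D)
    (r s₁ s₂ : ℕ)
    (hs₁ : ∀ (j : ℕ), ∀ x ∈ D,
      (p ^ s₁) • ((fun y => (p ^ r) • Crystalline.phiD p ρ y)^[j] x) ∈ D)
    (hs₂ : ∀ x : Crystalline.Dcris p ρ, x - Crystalline.phiD p ρ x ∈ D → (p ^ s₂) • x ∈ D)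
    (n : ℕ) (hn : 1 ≤ n) (ζ : Crystalline.Fn p k n) (hζ : IsPrimitiveRoot ζ (p ^ n)) :
    (Crystalline.imageA v n ζ).Commensurable (Crystalline.latticeL D n) ∧
    Crystalline.genIndex (Crystalline.imageA v n ζ) (Crystalline.latticeL D n) ≤
      (p : ℚ) ^ ((r * (p ^ (n - 1) + p - 2) + s₂ * (p - 1)) * Crystalline.dPrime D +
        s₁ * (Crystalline.dPrime D * Module.finrank K(p, k) (Crystalline.Fn p k n))) := by
  open Crystalline in
  obtain ⟨N, rfl⟩ : ∃ N, n = N + 1 := ⟨n - 1, by omega⟩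
  have hpp : p.Prime := Fact.out
  have := charZero_fraction p k
  have : NeZero (p ^ (N + 1)) := ⟨pow_ne_zero _ hpp.ne_zero⟩
  have : NeZero ((p ^ (N + 1) : ℕ) : K(p, k)) := NeZero.charZero
  have hfd : FiniteDimensional K(p, k) (Fn p k (N + 1)) :=
    IsCyclotomicExtension.finiteDimensional {p ^ (N + 1)} _ _
  have hrank : Module.finrank K(p, k) (Fn p k (N + 1)) = p ^ N * (p - 1) := by
    rw [IsCyclotomicExtension.finrank (n := p ^ (N + 1)) (Fn p k (N + 1))
      (irreducible_cyclotomic p k N), Nat.totient_prime_pow_succ hpp]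
  have hgen : Algebra.adjoin K(p, k) {ζ} = ⊤ :=
    IsCyclotomicExtension.adjoin_primitive_root_eq_top hζ
  have : IsScalarTower (WittVector p k) K(p, k) (Fn p k (N + 1)) := inferInstance
  have hA : ∀ x, x ∈ imageA v (N + 1) ζ ↔ _ := mem_imageA_iff hD v
  have h1 := relIndex_le_of_mem_valueSpan (r := r) (s₁ := s₁) (s₂ := s₂) hζ (map_mkQ_eq_span v)
    (latticeL_eq D (N + 1)) (A := imageA v (N + 1) ζ) fun x hx => by
      obtain ⟨g, f, y, hg, hf, hfg, hy, rfl⟩ := (hA x).1 hx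
      exact ⟨y, fun i => value_mem_valueSpan (pow_mul_iterMatrix_mem hD v _ hs₁)
        (pow_mul_mem_of_sub_semi_mem hD v _ hs₂) hζ hf hg hfg hy i, rfl⟩
  have h2 : (imageA v (N + 1) ζ).relIndex (latticeL D (N + 1)) ≠ 0 := by
    refine relIndex_ne_zero_of_forall_pow_smul (map_mkQ_eq_span v) (latticeL_eq D (N + 1))
      (fun z a ha => (hA _).2 (((hA a).1 ha).zp_smul z)) ?_
    refine exists_pow_smul_isSolutionValue hζ (exists_sub_pow_smul_semi hD v heigen)
      (fun u hu => semi_frobMatrix_eq_smul hD v heigen 0 u (by rw [hu, zpow_zero, one_smul]))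
      (exists_smul_semi_sub hD v heigen)
      (semi_frobMatrix_surjective hD v (phiD_injective hcris (latticeBasis hD v))) hgen
      (span_range_mkQ hD v) hA
  refine ⟨⟨h2, h1.1⟩, ?_⟩
  unfold genIndex
  -- Only the numerator [A : A ∩ L] is estimated; the denominator is a nonzero natural number, so
  -- dividing by it does not increase the quotient.
  refine (div_le_self (Nat.cast_nonneg _)
    (Nat.one_le_cast.2 (Nat.one_le_iff_ne_zero.2 h2))).trans ?_
  rw [← Nat.cast_pow, Nat.cast_le]
  refine h1.2.trans (le_of_eq ?_)
  rw [hrank, Nat.add_sub_cancel]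
  change _ = p ^ (_ * zpRank p k (D.map ((filZeroD p ρ).mkQ.restrictScalars (WittVector p k))) +
    s₁ * (zpRank p k (D.map ((filZeroD p ρ).mkQ.restrictScalars (WittVector p k))) * _))
  congr 1
  ring
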